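/- **Theorem (undirected all-pairs shortest paths in the congested clique).** *Model.* In the congested clique with $n$ nodes $1,\dots,n$, computation proceeds in synchronous rounds; in each round every node sends one message of $\lfloor\log_2 n\rfloor+1$ bits to every node, and local computation is free. Let $1\le M\le n$ be integers. The input is an undirected graph on the $n$ nodes with edge weights in $\{0,\dots,M\}$; initially node $u$ knows only its identifier and the $u$-th row (equivalently column) of the adjacency matrix (weight of the edge $\{u,v\}$, or $\infty$ if there is none). In the all-pairs shortest paths problem each node $u$ must output, for every node $v$, the weighted distance from $u$ to $v$ ($\infty$ if $v$ is not reachable) and a node $\mathrm{next}(u,v)$, such that whenever $v$ is reachable from $u$, following the pointers $\mathrm{next}(\cdot,v)$ from $u$ traces a shortest path from $u$ to $v$. Let $T(n,M)$ be the least number of rounds in which a deterministic algorithm solves this problem on all such graphs (for given $n$ and $M$). *Exponent.* An algebraic algorithm of rank $t$ for $n\times n$ matrices over a field $F$ consists of coefficients $\alpha_{ij\mu},\beta_{ij\mu},\lambda_{ij\mu}\in F$, $1\le\mu\le t$, with $(AB)_{ij}=\sum_{\mu=1}^t\lambda_{ij\mu}\bigl(\sum_{i',j'}\alpha_{i'j'\mu}A_{i'j'}\bigr)\bigl(\sum_{i',j'}\beta_{i'j'\mu}B_{j'i'}\bigr)$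 for all $A,B\in F^{n\times n}$ and all $i,j$. The exponent $\omega=\omega(F)$ is the least $\tau$ such that for every $\varepsilon>0$ the product of $n\times n$ matrices over $F$ has algebraic algorithms of rank $O(n^{\tau+\varepsilon})$. *Statement.* Let $\omega$ be the exponent of matrix multiplication over a field of characteristic zero. Then: 1. $T(n,M)=O\bigl(n^{\varepsilon}\,M^{2/\omega}n^{1-2/\omega}\bigr)$ for every $\varepsilon>0$. 2. $T(n,M)=\tilde O\bigl(M^{2/\tau}n^{1-2/\tau}\bigr)$ for every real $\tau>\omega$, and also for every real $\tau$ (possibly $\tau=\omega$) such that, over all but finitely many of the prime fields $\mathbb{Z}/p$, $n\times n$ matrices have algebraic algorithms of rank at most $Cn^{\tau}$ for all $n \geq 1$, with $C$ independent of $p$. Here $\tilde O(f)$ means $O(f\cdot\log^{c}(n+1))$ for some constant $c$. The constants in 1 depend only on $\varepsilon$ and the field, those in 2 only on $\tau$ and the field, and all the bounds hold for all integers $1\le M\le n$. -/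

import Mathlib

/-! ### Bilinear (algebraic) algorithms and the exponent of matrix multiplication -/

/-- An algebraic algorithm of rank `t` for the product of an `n × m` matrix by an `m × n` matrix
over `F`: coefficients `α, β, lam` such that for all `A, B` and all `i, j`,
`(A * B) i j = ∑ μ, lam i j μ * S μ * T μ`, where `S μ = ∑ i j, α i j μ * A i j` and
`T μ = ∑ i j, β i j μ * B j i`. -/
def HasAlgebraicAlgorithm (F : Type*) [CommRing F] (n m t : ℕ) : Prop :=
  ∃ (α β : Fin n → Fin m → Fin t → F) (lam : Fin n → Fin n → Fin t → F),
    ∀ (A : Matrix (Fin n) (Fin m) F) (B : Matrix (Fin m) (Fin n) F) (i j : Fin n),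
      (A * B) i j =
        ∑ μ : Fin t, lam i j μ *
          (∑ i' : Fin n, ∑ j' : Fin m, α i' j' μ * A i' j') *
          (∑ i' : Fin n, ∑ j' : Fin m, β i' j' μ * B j' i')

/-- `n × n` matrices over `F` can be multiplied by algebraic algorithms of rank `n ^ (τ + o(1))`,
that is, of rank `O(n ^ (τ + ε))` for every `ε > 0`. -/
def MatMulInExponent (F : Type*) [CommRing F] (τ : ℝ) : Prop :=
  ∀ ε : ℝ, 0 < ε → ∃ C : ℝ, ∀ n : ℕ, 1 ≤ n →
    ∃ t : ℕ, (t : ℝ) ≤ C * (n : ℝ) ^ (τ + ε) ∧ HasAlgebraicAlgorithm F n n t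

/-- The exponent `ω` of square matrix multiplication over the field `F`. -/
noncomputable def matMulExponent (F : Type*) [Field F] : ℝ :=
  sInf {τ : ℝ | MatMulInExponent F τ}

/-- `n × n` matrices can be multiplied by algebraic algorithms of rank `O(n ^ τ)`, without any
`o(1)` in the exponent, over all but finitely many prime fields, the implied constant being the
same for all these fields. -/
def MatMulUniformRank (τ : ℝ) : Prop :=
  ∃ (C : ℝ) (p₀ : ℕ), ∀ p : ℕ, p.Prime → p₀ ≤ p → ∀ n : ℕ, 1 ≤ n →
    ∃ t : ℕ, (t : ℝ) ≤ C * (n : ℝ) ^ τ ∧ HasAlgebraicAlgorithm (ZMod p) n n t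

/-! ### The congested clique -/

/-- A message in the congested clique with `n` nodes: a string of `⌊log₂ n⌋ + 1` bits. -/
abbrev CliqueMessage (n : ℕ) : Type := Fin (Nat.log 2 n + 1) → Bool

/-- A deterministic algorithm for the congested clique with nodes `Fin n`, where each node gets a
local input in `I` and produces a local output in `O`. Local computation is free. A node starts
knowing its identifier and its local input only; in each round it sends one message to every node,
depending on its current state, and updates its state with the messages received
(`receive s f`: the message from node `i` is `f i`). -/
structure CliqueAlgorithm (n : ℕ) (I O : Type) where
  State : Type
  init : Fin n → I → State
  send : State → Fin n → CliqueMessage n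
  receive : State → (Fin n → CliqueMessage n) → State
  output : State → O

/-- The state of every node after the given number of synchronous rounds, on a given input. -/
def CliqueAlgorithm.stateAfter {n : ℕ} {I O : Type} (P : CliqueAlgorithm n I O)
    (input : Fin n → I) : ℕ → Fin n → P.State
  | 0 => fun i => P.init i (input i)
  | r + 1 => fun i =>
      P.receive (P.stateAfter input r i) (fun j => P.send (P.stateAfter input r j) i)

/-- The outputs of all the nodes when they stop after `T` rounds. -/
def CliqueAlgorithm.run {n : ℕ} {I O : Type} (P : CliqueAlgorithm n I O)
    (input : Fin n → I) (T : ℕ) : Fin n → O :=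
  fun i => P.output (P.stateAfter input T i)

/-! ### All-pairs shortest paths -/

/-- The adjacency matrix of an undirected weighted graph: the weight of the edge `{i, j}` if there
is one and `∞` otherwise. -/
noncomputable def weightedAdjMatrix {n : ℕ} (G : SimpleGraph (Fin n)) (w : Sym2 (Fin n) → ℕ)
    (i j : Fin n) : ℕ∞ :=
  open Classical in if G.Adj i j then (w s(i, j) : ℕ∞) else ⊤

/-- The total weight of a walk. -/
def walkWeight {V : Type*} {G : SimpleGraph V} (w : Sym2 V → ℕ) {u v : V} (p : G.Walk u v) : ℕ :=
  (p.edges.map w).sum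

/-- The weighted distance from `u` to `v`, equal to `∞` if there is no walk from `u` to `v`. -/
noncomputable def weightedDist {V : Type*} (G : SimpleGraph V) (w : Sym2 V → ℕ) (u v : V) : ℕ∞ :=
  ⨅ p : G.Walk u v, (walkWeight w p : ℕ∞)

/-- The local output of a node in the all-pairs shortest paths problem: for each vertex `v`, the
distance to `v` and the next vertex on a shortest path to `v` (a routing table). -/
structure APSPOutput (n : ℕ) where
  dist : Fin n → ℕ∞
  next : Fin n → Fin n

/-- The outputs of the `n` nodes solve the all-pairs shortest paths problem: all distances are
right, and whenever `v` is reachable from `u`, following the pointers towards `v` from `u` traces a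
shortest path from `u` to `v`. -/
def IsAPSPSolution {n : ℕ} (G : SimpleGraph (Fin n)) (w : Sym2 (Fin n) → ℕ)
    (out : Fin n → APSPOutput n) : Prop :=
  (∀ u v : Fin n, (out u).dist v = weightedDist G w u v) ∧
  ∀ u v : Fin n, G.Reachable u v → ∃ p : G.Walk u v, p.IsPath ∧
    (walkWeight w p : ℕ∞) = weightedDist G w u v ∧
    ∀ i : ℕ, i < p.length → p.getVert (i + 1) = (out (p.getVert i)).next v

/-- Some deterministic algorithm for the congested clique with `n` nodes solves, in `T` rounds,
the all-pairs shortest paths problem for all undirected graphs on the `n` nodes with edge weights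
in `{0, …, M}`. Initially each node has its own row of the adjacency matrix, which is also its own
column since the graph is undirected. -/
def APSPSolvableIn (n M T : ℕ) : Prop :=
  ∃ P : CliqueAlgorithm n (Fin n → ℕ∞) (APSPOutput n),
    ∀ (G : SimpleGraph (Fin n)) (w : Sym2 (Fin n) → ℕ), (∀ e ∈ G.edgeSet, w e ≤ M) →
      IsAPSPSolution G w (P.run (weightedAdjMatrix G w) T)

/-! ### Knowledge in the congested clique -/

/-! Local computation is free, so a protocol is a statement about information only. A node is
represented by the pairs of instances that it cannot tell apart, a round shrinks this relation by
the messages heard, and `Reach.exists_algorithm` turns a sequence of such refinements into an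
algorithm. If the pattern of messages is fixed in advance and each node sends and receives at most
`n * L` of them, an edge colouring distributes them over intermediate nodes and `4 * L` rounds
suffice.

The basic operation is the product of matrices over `(ZMod p)[X]` whose entries are monomials of
degree `O(M)` (`Reach.monomialMatrixMul`). The matrices are evaluated at `k = 8 * M + 1` points, cut
into a `d × d` grid of blocks and multiplied by an algorithm of rank `t = O(d ^ τ)`. With `d ≈ (n /
k) ^ (1 / τ)` there are `k * t = O(n)` block products, spread evenly over the nodes, and moving
blocks of side about `n / d` costs about `n / d ^ 2`, that is `roundBound τ n M`, rounds. The prime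
must be `O(n)` for scalars to fit into messages. Algorithms in characteristic zero therefore have to
be moved to `ZMod p`: Zariski's lemma leads to a number field, restriction of scalars to `ℚ`, with a
loss absorbed by a tensor power, and clearing denominators to all large primes.

A distance product with finite entries `O(M)` is one such product. Repeated squaring gives the
distances up to `4 * M`. Larger ones are found by scaling: a shortest path has a vertex within `M`
of any prescribed length, so to decide where a distance lies within `O(M)` of a threshold, only the
parts of the factors within `O(M)` of thresholds matter. Doubling the threshold gives the windows
around `2 ^ j * (2 * M)` (`clipSum_minPlus_clipAt`); halving the scale then refines a coarse
distance to the exact one (`snap_eq_refineSnap`). Symmetry enters through `|D u v - D x v| ≤ D u x`,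
so that parity of the multiple is enough to identify it.

The same inequality makes the equation `A u x + D x v = D u v` decidable modulo `2 * M + 1`, so sums
over all first steps `x` are one more product, of arbitrarily large distances. Actual first steps
are extracted from such sums by a deterministic form of random isolation (`CanSum.exists_choice`): a
small almost pairwise independent family replaces sampling, and averaging shows that a good member
exists. Edges of weight zero could close a cycle of pointers. Only steps of positive weight are
therefore chosen this way; inside a component of zero edges a packet follows hop distances to a
common gateway, and the pair of both distances decreases lexicographically
(`exists_path_routeNext`). -/

/-- What every node knows: `κ u ω ω'` says that node `u` cannot tell `ω` from `ω'`. -/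
abbrev Knowledge (n : ℕ) (Ω : Type) : Type := Fin n → Ω → Ω → Prop

/-- A quantity is known if indistinguishable instances give it the same value. -/
def Knows {Ω : Type} {α : Type*} (r : Ω → Ω → Prop) (f : Ω → α) : Prop :=
  ∀ ω ω', r ω ω' → f ω = f ω'

namespace Knows

variable {Ω : Type} {α β γ : Type*} {r s : Ω → Ω → Prop}

theorem const (a : α) : Knows r (fun _ => a) := fun _ _ _ => rfl

theorem mono {f : Ω → α} (h : Knows r f) (hs : ∀ ω ω', s ω ω' → r ω ω') : Knows s f :=
  fun ω ω' hω => h ω ω' (hs ω ω' hω)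

theorem map {f : Ω → α} (h : Knows r f) (g : α → β) : Knows r (fun ω => g (f ω)) :=
  fun ω ω' hω => congrArg g (h ω ω' hω)

theorem map₂ {f : Ω → α} {f' : Ω → β} (h : Knows r f) (h' : Knows r f') (g : α → β → γ) :
    Knows r (fun ω => g (f ω) (f' ω)) :=
  fun ω ω' hω => congrArg₂ g (h ω ω' hω) (h' ω ω' hω)

theorem pi {ι : Type*} {δ : ι → Type*} {f : Ω → ∀ i, δ i} (h : ∀ i, Knows r (fun ω => f ω i)) :
    Knows r f :=
  fun ω ω' hω => funext fun i => h i ω ω' hω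

/-- A quantity is known if it is a function of a known quantity. -/
theorem of_eq {f : Ω → α} {f' : Ω → β} (h : Knows r f) (g : α → β) (hg : ∀ ω, f' ω = g (f ω)) :
    Knows r f' :=
  fun ω ω' hω => by rw [hg, hg, h ω ω' hω]

end Knows

/-- The knowledge after a round in which node `u` sends the message `m ω u v` to node `v`. -/
def Knowledge.hear {n : ℕ} {Ω : Type} (κ : Knowledge n Ω)
    (m : Ω → Fin n → Fin n → CliqueMessage n) : Knowledge n Ω :=
  fun v ω ω' => κ v ω ω' ∧ ∀ u, m ω u v = m ω' u v

/-- `Reach T κ κ'`: in `T` rounds of communication the knowledge can be brought from `κ` to `κ'`. -/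
inductive Reach {n : ℕ} {Ω : Type} : ℕ → Knowledge n Ω → Knowledge n Ω → Prop
  | refl (κ : Knowledge n Ω) : Reach 0 κ κ
  | step {T : ℕ} {κ κ' : Knowledge n Ω} (m : Ω → Fin n → Fin n → CliqueMessage n)
      (hm : ∀ u v, Knows (κ u) (fun ω => m ω u v)) (h : Reach T (κ.hear m) κ') :
      Reach (T + 1) κ κ'

namespace Reach

variable {n : ℕ} {Ω : Type}

theorem le {T : ℕ} {κ κ' : Knowledge n Ω} (h : Reach T κ κ') :
    ∀ u ω ω', κ' u ω ω' → κ u ω ω' := by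
  induction h with
  | refl κ => exact fun _ _ _ h => h
  | step m hm h ih => exact fun u ω ω' h => (ih u ω ω' h).1

theorem knows {T : ℕ} {κ κ' : Knowledge n Ω} (h : Reach T κ κ') {α : Type*} {u : Fin n}
    {f : Ω → α} (hf : Knows (κ u) f) : Knows (κ' u) f :=
  hf.mono (h.le u)

theorem trans {S T : ℕ} {κ κ' κ'' : Knowledge n Ω} (h : Reach S κ κ') (h' : Reach T κ' κ'') :
    Reach (S + T) κ κ'' := by
  induction h with
  | refl κ => simpa using h'
  | step m hm h ih =>
    rw [Nat.add_right_comm]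
    exact .step m hm (ih h')

theorem mono {S T : ℕ} (hST : S ≤ T) {κ κ' : Knowledge n Ω} (h : Reach S κ κ') :
    Reach T κ κ' := by
  induction hST with
  | refl => exact h
  | step _ ih =>
    refine .step (fun _ _ _ _ => false) (fun _ _ => .const _) ?_
    have : κ.hear (fun _ _ _ _ => false) = κ := by
      funext v ω ω'
      simp [Knowledge.hear]
    rwa [this]

/-- Communication schemes are carried out by algorithms. -/
theorem exists_algorithm {T : ℕ} {κ κ' : Knowledge n Ω} (h : Reach T κ κ') :
    ∀ {S O : Type} [Nonempty O] (X : Ω → Fin n → S) (Y : Ω → Fin n → O),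
      (∀ u ω ω', X ω u = X ω' u → κ u ω ω') → (∀ u, Knows (κ' u) (fun ω => Y ω u)) →
      ∃ P : CliqueAlgorithm n S O, ∀ ω, P.run (X ω) T = Y ω := by
  classical
  induction h with
  | refl κ =>
    intro S O _ X Y hX hY
    -- Any instance with this local input may be chosen: what the node knows has the same value on
    -- all of them.
    let g : Fin n → S → O := fun u s =>
      if h : ∃ ω, X ω u = s then Y h.choose u else Classical.arbitrary O
    refine ⟨⟨O, g, fun _ _ _ => false, fun s _ => s, id⟩, fun ω => funext fun u => ?_⟩
    have h : ∃ ω', X ω' u = X ω u := ⟨ω, rfl⟩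
    change g u (X ω u) = Y ω u
    simp only [g, dif_pos h]
    exact hY u _ _ (hX u _ _ h.choose_spec)
  | @step T κ κ' m hm _ ih =>
    intro S O _ X Y hX hY
    -- The messages heard in the first round are treated as part of the local input of the remaining
    -- algorithm.
    obtain ⟨P, hP⟩ := ih (fun ω u => ((X ω u, fun v => m ω v u) : S × (Fin n → CliqueMessage n)))
      Y (fun u ω ω' h => by
        simp only [Prod.mk.injEq] at h
        exact ⟨hX u _ _ h.1, fun v => congrFun h.2 v⟩) hY
    let g : Fin n → S → Fin n → CliqueMessage n := fun u s v =>
      if h : ∃ ω, X ω u = s then m h.choose u v else fun _ => false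
    have hg : ∀ ω u v, g u (X ω u) v = m ω u v := by
      intro ω u v
      have h : ∃ ω', X ω' u = X ω u := ⟨ω, rfl⟩
      simp only [g, dif_pos h]
      exact hm u v _ _ (hX u _ _ h.choose_spec)
    -- The left summand is the state before the first round, the right one a state of the remaining
    -- algorithm.
    let Q : CliqueAlgorithm n S O :=
      { State := (Fin n × S) ⊕ P.State
        init := fun u s => .inl (u, s)
        send := fun st v => Sum.elim (fun x => g x.1 x.2 v) (fun y => P.send y v) st
        receive := fun st f =>
          .inr (Sum.elim (fun x => P.init x.1 (x.2, f)) (fun y => P.receive y f) st)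
        output := Sum.elim (fun _ => Classical.arbitrary O) P.output }
    have key : ∀ ω r, Q.stateAfter (X ω) (r + 1) =
        fun u => .inr (P.stateAfter (fun u => (X ω u, fun v => m ω v u)) r u) := by
      intro ω r
      induction r with
      | zero =>
        funext u
        simp [CliqueAlgorithm.stateAfter, Q, hg]
      | succ r ihr =>
        funext u
        rw [CliqueAlgorithm.stateAfter, ihr]
        simp [CliqueAlgorithm.stateAfter, Q]
    refine ⟨Q, fun ω => ?_⟩
    rw [← hP ω]
    funext u
    simp only [CliqueAlgorithm.run, key]
    rfl

/-- Sending one message along every link in each of `s` rounds. -/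
theorem exchange (s : ℕ) (κ : Knowledge n Ω) (m : Fin s → Ω → Fin n → Fin n → CliqueMessage n)
    (hm : ∀ i u v, Knows (κ u) (fun ω => m i ω u v)) :
    ∃ κ', Reach s κ κ' ∧ ∀ i u v, Knows (κ' v) (fun ω => m i ω u v) := by
  induction s generalizing κ with
  | zero => exact ⟨κ, .refl κ, fun i => i.elim0⟩
  | succ s ih =>
    have hle : ∀ {α : Type} {u : Fin n} {f : Ω → α}, Knows (κ u) f → Knows (κ.hear (m 0) u) f :=
      fun h => h.mono fun _ _ h => h.1
    obtain ⟨κ', h, h'⟩ := ih (κ.hear (m 0)) (fun i => m i.succ) (fun i u v => hle (hm _ u v))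
    refine ⟨κ', .step (m 0) (hm 0) h, fun i u v => ?_⟩
    refine Fin.cases ?_ (fun i => h' i u v) i
    exact h.knows fun ω ω' hω => hω.2 u

end Reach

/-! ### Oblivious routing and message sizes -/

/-- Greedy edge colouring of a bipartite multigraph of degree at most `d`. -/
theorem exists_bipartite_edge_coloring {E A B : Type*} [Fintype E] [DecidableEq A] [DecidableEq B]
    (src : E → A) (dst : E → B) (d : ℕ)
    (hsrc : ∀ a, (Finset.univ.filter fun e => src e = a).card ≤ d)
    (hdst : ∀ b, (Finset.univ.filter fun e => dst e = b).card ≤ d) :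
    ∃ c : E → Fin (2 * d), ∀ e e', c e = c e' → src e = src e' ∨ dst e = dst e' → e = e' := by
  classical
  suffices H : ∀ s : Finset E, ∃ c : E → ℕ, (∀ e ∈ s, c e < 2 * d) ∧
      ∀ e ∈ s, ∀ e' ∈ s, c e = c e' → src e = src e' ∨ dst e = dst e' → e = e' by
    obtain ⟨c, hc, h⟩ := H Finset.univ
    exact ⟨fun e => ⟨c e, hc e (Finset.mem_univ e)⟩, fun e e' h1 h2 =>
      h e (Finset.mem_univ e) e' (Finset.mem_univ e') (by simpa using h1) h2⟩
  intro s
  induction s using Finset.induction_on with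
  | empty => exact ⟨fun _ => 0, by simp, by simp⟩
  | insert e s hes ih =>
    obtain ⟨c, hc, h⟩ := ih
    let N := (s.filter fun e' => src e' = src e) ∪ (s.filter fun e' => dst e' = dst e)
    have h1 : (s.filter fun e' => src e' = src e).card + 1 ≤ d := by
      refine le_trans ?_ (hsrc (src e))
      rw [← Finset.card_insert_of_notMem (a := e) (by simp [hes])]
      refine Finset.card_le_card fun x hx => ?_
      simp only [Finset.mem_insert, Finset.mem_filter] at hx
      rcases hx with rfl | hx <;> simp_all
    have h2 : (s.filter fun e' => dst e' = dst e).card + 1 ≤ d := by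
      refine le_trans ?_ (hdst (dst e))
      rw [← Finset.card_insert_of_notMem (a := e) (by simp [hes])]
      refine Finset.card_le_card fun x hx => ?_
      simp only [Finset.mem_insert, Finset.mem_filter] at hx
      rcases hx with rfl | hx <;> simp_all
    -- Each endpoint of the new edge has at most `d - 1` other edges, so at most `2 * d - 2` colours
    -- are blocked.
    have hN : (N.image c).card < (Finset.range (2 * d)).card := by
      have := Finset.card_image_le (s := N) (f := c)
      have : N.card ≤ _ := Finset.card_union_le (s.filter fun e' => src e' = src e)
        (s.filter fun e' => dst e' = dst e)
      rw [Finset.card_range]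
      omega
    obtain ⟨k, hk, hkN⟩ := Finset.exists_mem_notMem_of_card_lt_card hN
    have hfree : ∀ e' ∈ s, c e' = k → ¬ (src e' = src e ∨ dst e' = dst e) := by
      intro e' he' hk' hor
      refine hkN (Finset.mem_image.2 ⟨e', ?_, hk'⟩)
      simp only [N, Finset.mem_union, Finset.mem_filter]
      tauto
    have hne : ∀ x ∈ s, x ≠ e := fun x hx h => hes (h ▸ hx)
    refine ⟨Function.update c e k, ?_, ?_⟩
    · intro x hx
      rcases Finset.mem_insert.1 hx with rfl | hx
      · simpa using hk
      · rw [Function.update_of_ne (hne x hx)]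
        exact hc x hx
    · intro x hx y hy hxy hor
      rcases Finset.mem_insert.1 hx with hx' | hx₁ <;>
        rcases Finset.mem_insert.1 hy with hy' | hy₁
      · rw [hx', hy']
      · subst hx'
        rw [Function.update_self, Function.update_of_ne (hne y hy₁)] at hxy
        exact absurd (hor.imp Eq.symm Eq.symm) (hfree y hy₁ hxy.symm)
      · subst hy'
        rw [Function.update_self, Function.update_of_ne (hne x hx₁)] at hxy
        exact absurd hor (hfree x hx₁ hxy)
      · rw [Function.update_of_ne (hne x hx₁), Function.update_of_ne (hne y hy₁)] at hxy
        exact h x hx₁ y hy₁ hxy hor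

namespace Reach

variable {n : ℕ} {Ω : Type}

/-- Oblivious routing: if every node is the source and the destination of at most `n * L` messages,
then all messages can be delivered in `4 * L` rounds. -/
theorem route_messages {E : Type} [Fintype E] (κ : Knowledge n Ω) (L : ℕ) (src dst : E → Fin n)
    (hsrc : ∀ a, (Finset.univ.filter fun e => src e = a).card ≤ n * L)
    (hdst : ∀ b, (Finset.univ.filter fun e => dst e = b).card ≤ n * L)
    (c : E → Ω → CliqueMessage n) (hc : ∀ e, Knows (κ (src e)) (c e)) :
    ∃ κ', Reach (4 * L) κ κ' ∧ ∀ e, Knows (κ' (dst e)) (c e) := by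
  classical
  obtain ⟨col, hcol⟩ := exists_bipartite_edge_coloring src dst (n * L) hsrc hdst
  have hn : ∀ e : E, 0 < n := fun e => (src e).pos
  -- A colour is read as a time slot and an intermediate node. Proper colouring makes both hops
  -- collision free: edges with equal slot and intermediate node share neither source nor
  -- destination.
  let E' : Fin (2 * L) × Fin n ≃ Fin (2 * (n * L)) :=
    finProdFinEquiv.trans (finCongr (by ring))
  let slot : E → Fin (2 * L) := fun e => (E'.symm (col e)).1
  let mid : E → Fin n := fun e => (E'.symm (col e)).2
  have huniq : ∀ e e', slot e = slot e' → mid e = mid e' → src e = src e' ∨ dst e = dst e' →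
      e = e' := by
    intro e e' h1 h2 h3
    refine hcol e e' (E'.symm.injective (Prod.ext h1 h2)) h3
  let m₁ : Fin (2 * L) → Ω → Fin n → Fin n → CliqueMessage n := fun i ω u w =>
    if h : ∃ e, src e = u ∧ slot e = i ∧ mid e = w then c h.choose ω else fun _ => false
  have hm₁ : ∀ e ω, m₁ (slot e) ω (src e) (mid e) = c e ω := by
    intro e ω
    have h : ∃ e', src e' = src e ∧ slot e' = slot e ∧ mid e' = mid e := ⟨e, rfl, rfl, rfl⟩
    simp only [m₁, dif_pos h]
    rw [huniq h.choose e h.choose_spec.2.1 h.choose_spec.2.2 (.inl h.choose_spec.1)]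
  obtain ⟨κ₁, hκ₁, h₁⟩ := exchange (2 * L) κ m₁ (by
    intro i u w
    by_cases h : ∃ e, src e = u ∧ slot e = i ∧ mid e = w
    · simp only [m₁, dif_pos h]
      have := hc h.choose
      rwa [h.choose_spec.1] at this
    · simp only [m₁, dif_neg h]
      exact .const _)
  have hmid : ∀ e, Knows (κ₁ (mid e)) (c e) := by
    intro e
    have := h₁ (slot e) (src e) (mid e)
    simpa only [hm₁] using this
  let m₂ : Fin (2 * L) → Ω → Fin n → Fin n → CliqueMessage n := fun i ω w v =>
    if h : ∃ e, dst e = v ∧ slot e = i ∧ mid e = w then c h.choose ω else fun _ => false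
  have hm₂ : ∀ e ω, m₂ (slot e) ω (mid e) (dst e) = c e ω := by
    intro e ω
    have h : ∃ e', dst e' = dst e ∧ slot e' = slot e ∧ mid e' = mid e := ⟨e, rfl, rfl, rfl⟩
    simp only [m₂, dif_pos h]
    rw [huniq h.choose e h.choose_spec.2.1 h.choose_spec.2.2 (.inr h.choose_spec.1)]
  obtain ⟨κ₂, hκ₂, h₂⟩ := exchange (2 * L) κ₁ m₂ (by
    intro i w v
    by_cases h : ∃ e, dst e = v ∧ slot e = i ∧ mid e = w
    · simp only [m₂, dif_pos h]
      have := hmid h.choose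
      rwa [h.choose_spec.2.2] at this
    · simp only [m₂, dif_neg h]
      exact .const _)
  refine ⟨κ₂, by simpa [← add_mul] using hκ₁.trans hκ₂, fun e => ?_⟩
  have := h₂ (slot e) (mid e) (dst e)
  simpa only [hm₂] using this

end Reach

/-- The values of a type that fit into `b` messages of the congested clique with `n` nodes. -/
def FitsIn (n b : ℕ) (α : Type*) : Prop :=
  ∃ f : α → Fin b → CliqueMessage n, Function.Injective f

theorem fitsIn_of_card_le {n b : ℕ} {α : Type*} [Fintype α]
    (h : Fintype.card α ≤ (2 ^ (Nat.log 2 n + 1)) ^ b) : FitsIn n b α := by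
  have : Fintype.card α ≤ Fintype.card (Fin b → CliqueMessage n) := by
    simpa using h
  obtain ⟨f⟩ := Function.Embedding.nonempty_of_card_le this
  exact ⟨f, f.injective⟩

theorem FitsIn.of_injective {n b : ℕ} {α β : Type*} (h : FitsIn n b β) (f : α → β)
    (hf : Function.Injective f) : FitsIn n b α :=
  let ⟨g, hg⟩ := h
  ⟨g ∘ f, hg.comp hf⟩

/-- A type with at most `K * (n + 1) ^ e` values fits into `K + e` messages. -/
theorem fitsIn_of_card_le_mul_pow {n : ℕ} (K e : ℕ) {α : Type*} [Fintype α]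
    (h : Fintype.card α ≤ K * (n + 1) ^ e) : FitsIn n (K + e) α := by
  refine fitsIn_of_card_le (h.trans ?_)
  rw [pow_add]
  have h1 : n + 1 ≤ 2 ^ (Nat.log 2 n + 1) := Nat.lt_pow_succ_log_self (by norm_num) n
  refine Nat.mul_le_mul ?_ (Nat.pow_le_pow_left h1 e)
  calc K ≤ 2 ^ K := Nat.lt_two_pow_self.le
    _ ≤ _ := Nat.pow_le_pow_left (by
      rw [pow_succ]
      have := Nat.one_le_two_pow (n := Nat.log 2 n)
      omega) K

namespace Reach

variable {n : ℕ} {Ω : Type}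

/-- Oblivious routing of values that fit into `b` messages. -/
theorem route {E : Type} [Fintype E] {α : Type*} {b : ℕ} (hα : FitsIn n b α)
    (κ : Knowledge n Ω) (L : ℕ) (src dst : E → Fin n)
    (hsrc : ∀ a, (Finset.univ.filter fun e => src e = a).card ≤ n * L)
    (hdst : ∀ b, (Finset.univ.filter fun e => dst e = b).card ≤ n * L)
    (c : E → Ω → α) (hc : ∀ e, Knows (κ (src e)) (c e)) :
    ∃ κ', Reach (4 * (L * b)) κ κ' ∧ ∀ e, Knows (κ' (dst e)) (c e) := by
  classical
  obtain ⟨f, hf⟩ := hα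
  have hcard : ∀ (g : E → Fin n) (a : Fin n),
      (Finset.univ.filter fun e => g e = a).card ≤ n * L →
      (Finset.univ.filter fun x : E × Fin b => g x.1 = a).card ≤ n * (L * b) := by
    intro g a h
    have : (Finset.univ.filter fun x : E × Fin b => g x.1 = a) =
        (Finset.univ.filter fun e => g e = a) ×ˢ (Finset.univ : Finset (Fin b)) := by
      ext x
      simp
    rw [this, Finset.card_product, Finset.card_univ, Fintype.card_fin, ← mul_assoc]
    exact Nat.mul_le_mul_right b h
  obtain ⟨κ', h, h'⟩ := route_messages (E := E × Fin b) κ (L * b) (fun x => src x.1)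
    (fun x => dst x.1) (fun a => hcard src a (hsrc a)) (fun a => hcard dst a (hdst a))
    (fun x ω => f (c x.1 ω) x.2) (fun x => (hc x.1).map fun y => f y x.2)
  exact ⟨κ', h, fun e ω ω' hω => hf (funext fun i => h' (e, i) ω ω' hω)⟩

/-- Every node sends one value that fits into `b` messages to every node. -/
theorem exchange_values {α : Type*} {b : ℕ} (hα : FitsIn n b α) (κ : Knowledge n Ω)
    (c : Ω → Fin n → Fin n → α) (hc : ∀ u v, Knows (κ u) (fun ω => c ω u v)) :
    ∃ κ', Reach b κ κ' ∧ ∀ u v, Knows (κ' v) (fun ω => c ω u v) := by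
  obtain ⟨f, hf⟩ := hα
  obtain ⟨κ', h, h'⟩ := exchange b κ (fun i ω u v => f (c ω u v) i)
    (fun i u v => (hc u v).map fun y => f y i)
  exact ⟨κ', h, fun u v ω ω' hω => hf (funext fun i => h' i u v ω ω' hω)⟩

end Reach

/-! ### Algebraic algorithms and change of rings -/

/-- The equations between the coefficients of an algebraic algorithm for square matrices. -/
def BrentEquations {R ι σ : Type*} [CommRing R] [DecidableEq ι] [Fintype σ]
    (α β lam : ι → ι → σ → R) : Prop :=
  ∀ i j i' j' k l, ∑ μ, lam i j μ * α i' j' μ * β k l μ =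
    if i = i' ∧ j' = l ∧ j = k then 1 else 0

theorem BrentEquations.mul_apply {R ι σ : Type*} [CommRing R] [DecidableEq ι] [Fintype ι]
    [Fintype σ] {α β lam : ι → ι → σ → R} (h : BrentEquations α β lam) (A B : Matrix ι ι R)
    (i j : ι) :
    (A * B) i j = ∑ μ, lam i j μ * (∑ i', ∑ j', α i' j' μ * A i' j') *
      (∑ i', ∑ j', β i' j' μ * B j' i') := by
  have h1 : ∀ μ, lam i j μ * (∑ i', ∑ j', α i' j' μ * A i' j') *
      (∑ i', ∑ j', β i' j' μ * B j' i') =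
      ∑ p : ι × ι, ∑ q : ι × ι, A p.1 p.2 * B q.2 q.1 *
        (lam i j μ * α p.1 p.2 μ * β q.1 q.2 μ) := by
    intro μ
    rw [← Fintype.sum_prod_type', ← Fintype.sum_prod_type', mul_assoc, Finset.sum_mul_sum,
      Finset.mul_sum]
    simp_rw [Finset.mul_sum]
    refine Finset.sum_congr rfl fun p _ => Finset.sum_congr rfl fun q _ => ?_
    ring
  simp only [h1]
  rw [Finset.sum_comm]
  simp_rw [fun p : ι × ι => Finset.sum_comm (s := (Finset.univ : Finset σ))
    (t := (Finset.univ : Finset (ι × ι))) (f := fun μ q => A p.1 p.2 * B q.2 q.1 *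
      (lam i j μ * α p.1 p.2 μ * β q.1 q.2 μ)), ← Finset.mul_sum, h i j, Fintype.sum_prod_type]
  simp only [Matrix.mul_apply, ite_and, mul_ite, mul_one, mul_zero]
  rw [Finset.sum_comm' (t' := Finset.univ) (s' := fun _ => Finset.univ) (by simp)]
  simp

/-- Both sides of the identity are bilinear, so it suffices to test it on pairs of matrix units. In
this form the condition is a system of polynomial equations with integer coefficients, which passes
along ring homomorphisms. -/
theorem hasAlgebraicAlgorithm_iff_brent {R : Type*} [CommRing R] {n t : ℕ} :
    HasAlgebraicAlgorithm R n n t ↔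
      ∃ α β lam : Fin n → Fin n → Fin t → R, BrentEquations α β lam := by
  constructor
  · rintro ⟨α, β, lam, h⟩
    refine ⟨α, β, lam, fun i j i' j' k l => ?_⟩
    have := h (Matrix.single i' j' 1) (Matrix.single l k 1) i j
    have e1 : ∀ μ, ∑ x, ∑ y, α x y μ * Matrix.single i' j' (1 : R) x y = α i' j' μ := by
      intro μ
      rw [Finset.sum_eq_single i', Finset.sum_eq_single j'] <;>
        simp +contextual [Matrix.single, eq_comm]
    have e2 : ∀ μ, ∑ x, ∑ y, β x y μ * Matrix.single l k (1 : R) y x = β k l μ := by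
      intro μ
      rw [Finset.sum_eq_single k, Finset.sum_eq_single l] <;>
        simp +contextual [Matrix.single, eq_comm]
    simp only [e1, e2] at this
    rw [← this]
    by_cases hjl : j' = l
    · subst hjl
      rw [Matrix.single_mul_single_same]
      simp [Matrix.single, eq_comm]
    · simp [Matrix.single_mul_single_of_ne, hjl]
  · rintro ⟨α, β, lam, h⟩
    exact ⟨α, β, lam, fun A B i j => h.mul_apply A B i j⟩

/-- Relabelling of the index types of an algebraic algorithm. -/
theorem BrentEquations.reindex {R ι σ ι' σ' : Type*} [CommRing R] [DecidableEq ι] [Fintype σ]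
    [DecidableEq ι'] [Fintype σ'] {α β lam : ι → ι → σ → R} (h : BrentEquations α β lam)
    (f : ι' → ι) (hf : Function.Injective f) (e : σ' ≃ σ) :
    BrentEquations (fun i j μ => α (f i) (f j) (e μ)) (fun i j μ => β (f i) (f j) (e μ))
      (fun i j μ => lam (f i) (f j) (e μ)) := by
  intro i j i' j' k l
  rw [e.sum_comp fun μ => lam (f i) (f j) μ * α (f i') (f j') μ * β (f k) (f l) μ, h]
  simp [hf.eq_iff]

theorem HasAlgebraicAlgorithm.of_equiv {R ι σ : Type*} [CommRing R] [DecidableEq ι] [Fintype σ]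
    {α β lam : ι → ι → σ → R} (h : BrentEquations α β lam) {n t : ℕ} (f : Fin n → ι)
    (hf : Function.Injective f) (ht : Fintype.card σ = t) : HasAlgebraicAlgorithm R n n t :=
  hasAlgebraicAlgorithm_iff_brent.2
    ⟨_, _, _, h.reindex f hf (Fintype.equivFinOfCardEq ht).symm⟩

universe u

namespace HasAlgebraicAlgorithm

variable {R : Type*} [CommRing R]

theorem of_le {m n t : ℕ} (h : HasAlgebraicAlgorithm R n n t) (hmn : m ≤ n) :
    HasAlgebraicAlgorithm R m m t := by
  obtain ⟨α, β, lam, h⟩ := hasAlgebraicAlgorithm_iff_brent.1 h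
  exact .of_equiv h (Fin.castLE hmn) (Fin.castLE_injective hmn) (by simp)

/-- The tensor product of the two algorithms; the Brent equations multiply factor by factor. -/
theorem mul {m n s t : ℕ} (h : HasAlgebraicAlgorithm R m m s)
    (h' : HasAlgebraicAlgorithm R n n t) : HasAlgebraicAlgorithm R (m * n) (m * n) (s * t) := by
  obtain ⟨α, β, lam, h⟩ := hasAlgebraicAlgorithm_iff_brent.1 h
  obtain ⟨α', β', lam', h'⟩ := hasAlgebraicAlgorithm_iff_brent.1 h'
  have key : BrentEquations (ι := Fin m × Fin n) (σ := Fin s × Fin t)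
      (fun i j μ => α i.1 j.1 μ.1 * α' i.2 j.2 μ.2) (fun i j μ => β i.1 j.1 μ.1 * β' i.2 j.2 μ.2)
      (fun i j μ => lam i.1 j.1 μ.1 * lam' i.2 j.2 μ.2) := by
    intro i j i' j' k l
    have e : ∀ μ : Fin s × Fin t, lam i.1 j.1 μ.1 * lam' i.2 j.2 μ.2 *
        (α i'.1 j'.1 μ.1 * α' i'.2 j'.2 μ.2) * (β k.1 l.1 μ.1 * β' k.2 l.2 μ.2) =
        (lam i.1 j.1 μ.1 * α i'.1 j'.1 μ.1 * β k.1 l.1 μ.1) *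
        (lam' i.2 j.2 μ.2 * α' i'.2 j'.2 μ.2 * β' k.2 l.2 μ.2) := fun μ => by ring
    simp only [e]
    rw [Fintype.sum_prod_type]
    dsimp only
    rw [← Finset.sum_mul_sum, h, h', ite_zero_mul_ite_zero]
    simp only [Prod.ext_iff, mul_one]
    congr 1
    apply propext
    tauto
  exact .of_equiv key finProdFinEquiv.symm finProdFinEquiv.symm.injective (by simp)

theorem one : HasAlgebraicAlgorithm R 1 1 1 :=
  hasAlgebraicAlgorithm_iff_brent.2 ⟨fun _ _ _ => 1, fun _ _ _ => 1, fun _ _ _ => 1,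
    fun i j i' j' k l => by simp [Subsingleton.elim i i', Subsingleton.elim j' l,
      Subsingleton.elim j k]⟩

theorem pow {n t : ℕ} (h : HasAlgebraicAlgorithm R n n t) (j : ℕ) :
    HasAlgebraicAlgorithm R (n ^ j) (n ^ j) (t ^ j) := by
  induction j with
  | zero => simpa using one
  | succ j ih => simpa [pow_succ] using ih.mul h

/-- The standard algorithm. -/
theorem cube (n : ℕ) : HasAlgebraicAlgorithm R n n (n ^ 3) := by
  have key : BrentEquations (R := R) (ι := Fin n) (σ := Fin n × Fin n × Fin n)
      (fun i j μ => if i = μ.1 ∧ j = μ.2.1 then 1 else 0)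
      (fun i j μ => if i = μ.2.2 ∧ j = μ.2.1 then 1 else 0)
      (fun i j μ => if i = μ.1 ∧ j = μ.2.2 then 1 else 0) := by
    intro i j i' j' k l
    rw [Finset.sum_eq_single (i, j', j)]
    · simp only [ite_zero_mul_ite_zero, mul_one, and_true]
      congr 1
      apply propext
      tauto
    · rintro ⟨a, b, c⟩ _ hne
      by_contra hcon
      apply hne
      have h1 : i = a ∧ j = c := by
        by_contra h
        simp [h] at hcon
      have h2 : i' = a ∧ j' = b := by
        by_contra h
        simp [h] at hcon
      rw [h1.1, h1.2, h2.2]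
    · simp
  exact .of_equiv key id Function.injective_id (by simp; ring)

/-- An algorithm of rank `t` for `n × n` matrices requires `n ^ 2 ≤ t`. -/
theorem sq_le {F : Type*} [Field F] {n t : ℕ} (h : HasAlgebraicAlgorithm F n n t) :
    n ^ 2 ≤ t := by
  obtain ⟨α, β, lam, h⟩ := h
  let f : (Fin t → F) →ₗ[F] Matrix (Fin n) (Fin n) F :=
    { toFun := fun x => Matrix.of fun i j => ∑ μ, lam i j μ * x μ
      map_add' := fun x y => by ext; simp [mul_add, Finset.sum_add_distrib]
      map_smul' := fun c x => by ext; simp [Finset.mul_sum, mul_left_comm] }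
  have hf : Function.Surjective f := by
    intro A
    refine ⟨fun μ => (∑ i', ∑ j', α i' j' μ * A i' j') *
      (∑ i', ∑ j', β i' j' μ * (1 : Matrix (Fin n) (Fin n) F) j' i'), ?_⟩
    ext i j
    have := h A 1 i j
    rw [mul_one] at this
    rw [this]
    simp [f, mul_assoc]
  have := LinearMap.finrank_le_finrank_of_surjective hf
  simpa [Module.finrank_matrix, sq] using this

theorem map {S : Type*} [CommRing S] (f : R →+* S) {n t : ℕ}
    (h : HasAlgebraicAlgorithm R n n t) : HasAlgebraicAlgorithm S n n t := by
  obtain ⟨α, β, lam, h⟩ := hasAlgebraicAlgorithm_iff_brent.1 h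
  refine hasAlgebraicAlgorithm_iff_brent.2 ⟨fun i j μ => f (α i j μ), fun i j μ => f (β i j μ),
    fun i j μ => f (lam i j μ), fun i j i' j' k l => ?_⟩
  have := congrArg f (h i j i' j' k l)
  simpa only [map_sum, map_mul, apply_ite f, map_one, map_zero] using this

/-- Algorithms with coefficients in a subring. -/
theorem of_subring_mem {t n : ℕ} {S : Type*} [CommRing S] (f : S →+* R)
    (hf : Function.Injective f) (α β lam : Fin n → Fin n → Fin t → S)
    (h : BrentEquations (fun i j μ => f (α i j μ)) (fun i j μ => f (β i j μ))
      (fun i j μ => f (lam i j μ))) : HasAlgebraicAlgorithm S n n t := by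
  refine hasAlgebraicAlgorithm_iff_brent.2 ⟨α, β, lam, fun i j i' j' k l => hf ?_⟩
  simpa only [map_sum, map_mul, apply_ite f, map_one, map_zero] using h i j i' j' k l

/-- Zariski's lemma: the quotient by a maximal ideal is a field of finite type over `ℚ`, hence
finite over `ℚ`, and the Brent equations survive in the quotient. -/
theorem exists_finite_of_finiteType {A : Type u} [CommRing A] [Nontrivial A] [Algebra ℚ A]
    [Algebra.FiniteType ℚ A] {n t : ℕ} (h : HasAlgebraicAlgorithm A n n t) :
    ∃ (L : Type u) (_ : Field L) (_ : Algebra ℚ L), Module.Finite ℚ L ∧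
      HasAlgebraicAlgorithm L n n t := by
  obtain ⟨I, hI⟩ := Ideal.exists_maximal A
  let : Field (A ⧸ I) := Ideal.Quotient.field I
  have : Algebra.FiniteType ℚ (A ⧸ I) :=
    .of_surjective (Ideal.Quotient.mkₐ ℚ I) (Ideal.Quotient.mkₐ_surjective ℚ I)
  exact ⟨A ⧸ I, inferInstance, inferInstance, finite_of_finite_type_of_isJacobsonRing ℚ (A ⧸ I),
    h.map (Ideal.Quotient.mk I)⟩

/-- An algorithm over a field of characteristic zero can be moved to a number field. -/
theorem exists_finite_extension {K : Type u} [Field K] [CharZero K] {n t : ℕ}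
    (h : HasAlgebraicAlgorithm K n n t) :
    ∃ (L : Type u) (_ : Field L) (_ : Algebra ℚ L), Module.Finite ℚ L ∧
      HasAlgebraicAlgorithm L n n t := by
  classical
  obtain ⟨α, β, lam, h⟩ := hasAlgebraicAlgorithm_iff_brent.1 h
  let s : Finset K := (Finset.univ.image fun x : Fin n × Fin n × Fin t => α x.1 x.2.1 x.2.2) ∪
    (Finset.univ.image fun x : Fin n × Fin n × Fin t => β x.1 x.2.1 x.2.2) ∪
    (Finset.univ.image fun x : Fin n × Fin n × Fin t => lam x.1 x.2.1 x.2.2)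
  let A := Algebra.adjoin ℚ (s : Set K)
  have hα : ∀ i j μ, α i j μ ∈ A := fun i j μ => Algebra.subset_adjoin (by
    simp only [s, Finset.coe_union, Set.mem_union, Finset.mem_coe, Finset.mem_image]
    exact .inl (.inl ⟨(i, j, μ), Finset.mem_univ _, rfl⟩))
  have hβ : ∀ i j μ, β i j μ ∈ A := fun i j μ => Algebra.subset_adjoin (by
    simp only [s, Finset.coe_union, Set.mem_union, Finset.mem_coe, Finset.mem_image]
    exact .inl (.inr ⟨(i, j, μ), Finset.mem_univ _, rfl⟩))
  have hlam : ∀ i j μ, lam i j μ ∈ A := fun i j μ => Algebra.subset_adjoin (by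
    simp only [s, Finset.coe_union, Set.mem_union, Finset.mem_coe, Finset.mem_image]
    exact .inr ⟨(i, j, μ), Finset.mem_univ _, rfl⟩)
  have hA : HasAlgebraicAlgorithm A n n t := of_subring_mem A.val.toRingHom
    Subtype.val_injective (fun i j μ => ⟨_, hα i j μ⟩) (fun i j μ => ⟨_, hβ i j μ⟩)
    (fun i j μ => ⟨_, hlam i j μ⟩) h
  have hfin : Algebra.FiniteType ℚ A := A.fg_iff_finiteType.1 ⟨s, rfl⟩
  exact hA.exists_finite_of_finiteType

/-- Restriction of scalars multiplies the rank by the square of the degree. -/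
theorem restrictScalars {F L : Type*} [Field F] [Field L] [Algebra F L] [Module.Finite F L]
    {n t : ℕ} (h : HasAlgebraicAlgorithm L n n t) :
    HasAlgebraicAlgorithm F n n (t * Module.finrank F L ^ 2) := by
  obtain ⟨α, β, lam, h⟩ := hasAlgebraicAlgorithm_iff_brent.1 h
  let b := Module.finBasis F L
  -- A linear functional with value `1` at `1` fixes the right sides of the Brent equations. The
  -- factors `α` and `β` are expanded in a basis, which creates one product for each pair of basis
  -- vectors.
  obtain ⟨π, hπ⟩ := Module.Projective.exists_dual_eq_one F (one_ne_zero : (1 : L) ≠ 0)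
  have key : BrentEquations
      (σ := Fin t × Fin (Module.finrank F L) × Fin (Module.finrank F L))
      (fun i j μ => b.repr (α i j μ.1) μ.2.1) (fun i j μ => b.repr (β i j μ.1) μ.2.2)
      (fun i j μ => π (lam i j μ.1 * b μ.2.1 * b μ.2.2)) := by
    intro i j i' j' k l
    have e := congrArg π (h i j i' j' k l)
    rw [apply_ite π, hπ, map_zero, map_sum] at e
    rw [← e, Fintype.sum_prod_type]
    refine Finset.sum_congr rfl fun μ _ => ?_
    rw [Fintype.sum_prod_type]
    dsimp only
    conv_rhs => rw [← b.sum_repr (α i' j' μ), ← b.sum_repr (β k l μ), mul_assoc,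
      Finset.sum_mul_sum, Finset.mul_sum, map_sum]
    refine Finset.sum_congr rfl fun x _ => ?_
    rw [Finset.mul_sum, map_sum]
    refine Finset.sum_congr rfl fun y _ => ?_
    rw [smul_mul_smul_comm, mul_smul_comm, map_smul, smul_eq_mul, mul_assoc (lam i j μ)]
    ring
  exact .of_equiv key id Function.injective_id (by simp [sq])

/-- A rational algorithm can be reduced modulo all large primes. -/
theorem exists_forall_prime {n t : ℕ} (h : HasAlgebraicAlgorithm ℚ n n t) :
    ∃ p₀ : ℕ, ∀ p : ℕ, p.Prime → p₀ ≤ p → HasAlgebraicAlgorithm (ZMod p) n n t := by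
  obtain ⟨α, β, lam, h⟩ := hasAlgebraicAlgorithm_iff_brent.1 h
  have hden : ∀ γ : Fin n → Fin n → Fin t → ℚ, ∃ (N : ℕ) (γ' : Fin n → Fin n → Fin t → ℤ),
      0 < N ∧ ∀ i j μ, (γ' i j μ : ℚ) = N * γ i j μ := by
    intro γ
    let f : Fin n × Fin n × Fin t → ℕ := fun x => (γ x.1 x.2.1 x.2.2).den
    have hdvd : ∀ i j μ, (γ i j μ).den ∣ ∏ x, f x := fun i j μ =>
      Finset.dvd_prod_of_mem f (Finset.mem_univ (i, j, μ))
    choose q hq using hdvd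
    refine ⟨∏ x, f x, fun i j μ => q i j μ * (γ i j μ).num,
      Finset.prod_pos fun x _ => Rat.den_pos _, fun i j μ => ?_⟩
    rw [hq i j μ]
    push_cast
    rw [mul_comm ((γ i j μ).den : ℚ), mul_assoc, Rat.den_mul_eq_num]
  obtain ⟨a, α', ha, hα⟩ := hden α
  obtain ⟨b, β', hb, hβ⟩ := hden β
  obtain ⟨c, lam', hc, hlam⟩ := hden lam
  have hZ : ∀ i j i' j' k l, ∑ μ, lam' i j μ * α' i' j' μ * β' k l μ =
      (c * a * b : ℤ) * if i = i' ∧ j' = l ∧ j = k then 1 else 0 := by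
    intro i j i' j' k l
    have : ((∑ μ, lam' i j μ * α' i' j' μ * β' k l μ : ℤ) : ℚ) =
        ((c * a * b : ℤ) * if i = i' ∧ j' = l ∧ j = k then 1 else 0 : ℤ) := by
      push_cast
      rw [← h i j i' j' k l, Finset.mul_sum]
      refine Finset.sum_congr rfl fun μ _ => ?_
      rw [hα, hβ, hlam]
      ring
    exact_mod_cast this
  -- A prime above the product of the common denominators cannot divide it, so the integral identity
  -- can be divided by it modulo `p`.
  refine ⟨a * b * c + 1, fun p hp hpN => ?_⟩
  have := Fact.mk hp
  have hne : ((c * a * b : ℕ) : ZMod p) ≠ 0 := by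
    rw [Ne, ZMod.natCast_eq_zero_iff]
    intro hdvd
    have := Nat.le_of_dvd (by positivity) hdvd
    have : c * a * b = a * b * c := by ring
    omega
  refine hasAlgebraicAlgorithm_iff_brent.2 ⟨fun i j μ => (α' i j μ : ZMod p),
    fun i j μ => (β' i j μ : ZMod p),
    fun i j μ => ((c * a * b : ℕ) : ZMod p)⁻¹ * (lam' i j μ : ZMod p), fun i j i' j' k l => ?_⟩
  have := congrArg (Int.cast : ℤ → ZMod p) (hZ i j i' j' k l)
  push_cast at this
  simp only [mul_assoc] at this ⊢
  rw [← Finset.mul_sum, this]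
  rw [← mul_assoc (c : ZMod p), ← mul_assoc (c * a : ZMod p)]
  push_cast at hne ⊢
  rw [← mul_assoc (c : ZMod p), inv_mul_cancel_left₀ hne]

end HasAlgebraicAlgorithm

/-! ### The exponent of matrix multiplication -/

/-- Used to show that admissible exponents are at least `2`. Later this gives `2 / τ ≤ 1`, and with
it that `O(M)` rounds are affordable. -/
theorem two_le_of_forall_sq_le {C σ : ℝ} (h : ∀ n : ℕ, 1 ≤ n → (n : ℝ) ^ 2 ≤ C * (n : ℝ) ^ σ) :
    2 ≤ σ := by
  by_contra! hσ
  have ht : Filter.Tendsto (fun n : ℕ => (n : ℝ) ^ (2 - σ)) Filter.atTop Filter.atTop :=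
    (tendsto_rpow_atTop (sub_pos.2 hσ)).comp tendsto_natCast_atTop_atTop
  obtain ⟨n, hn1, hn⟩ := ((ht.eventually_gt_atTop C).and (Filter.eventually_ge_atTop 1)).exists
  have hpos : (0 : ℝ) < n := by exact_mod_cast hn
  have := h n hn
  rw [Real.rpow_sub hpos, lt_div_iff₀ (Real.rpow_pos_of_pos hpos σ), Real.rpow_two] at hn1
  linarith

theorem MatMulInExponent.two_le {F : Type*} [Field F] {τ : ℝ} (h : MatMulInExponent F τ) :
    2 ≤ τ := by
  refine le_of_forall_pos_le_add fun ε hε => ?_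
  obtain ⟨C, hC⟩ := h ε hε
  refine two_le_of_forall_sq_le (C := C) fun n hn => ?_
  obtain ⟨t, ht, hA⟩ := hC n hn
  exact le_trans (by exact_mod_cast hA.sq_le) ht

theorem MatMulUniformRank.two_le {τ : ℝ} (h : MatMulUniformRank τ) : 2 ≤ τ := by
  obtain ⟨C, p₀, h⟩ := h
  obtain ⟨p, hp, hprime⟩ := Nat.exists_infinite_primes p₀
  have := Fact.mk hprime
  refine two_le_of_forall_sq_le (C := C) fun n hn => ?_
  obtain ⟨t, ht, hA⟩ := h p hprime hp n hn
  exact le_trans (by exact_mod_cast hA.sq_le) ht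

theorem matMulInExponent_three (F : Type*) [CommRing F] : MatMulInExponent F 3 := by
  intro ε hε
  refine ⟨1, fun n hn => ⟨n ^ 3, ?_, .cube n⟩⟩
  have h1 : (1 : ℝ) ≤ n := by exact_mod_cast hn
  rw [one_mul, Nat.cast_pow, ← Real.rpow_natCast]
  exact Real.rpow_le_rpow_of_exponent_le h1 (by push_cast; linarith)

theorem two_le_matMulExponent (F : Type*) [Field F] : 2 ≤ matMulExponent F :=
  le_csInf ⟨3, matMulInExponent_three F⟩ fun _ h => MatMulInExponent.two_le h

/-- Above the exponent, some fixed algorithm is good enough. -/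
theorem exists_algorithm_of_matMulExponent_lt {F : Type*} [Field F] {τ : ℝ}
    (h : matMulExponent F < τ) :
    ∃ (m t : ℕ) (σ : ℝ), 2 ≤ m ∧ σ < τ ∧ (t : ℝ) ≤ (m : ℝ) ^ σ ∧ HasAlgebraicAlgorithm F m m t := by
  obtain ⟨τ', hτ', hlt⟩ := exists_lt_of_csInf_lt ⟨3, matMulInExponent_three F⟩ h
  obtain ⟨C, hC⟩ := hτ' ((τ - τ') / 3) (by linarith)
  have ht : Filter.Tendsto (fun n : ℕ => (n : ℝ) ^ ((τ - τ') / 3)) Filter.atTop Filter.atTop :=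
    (tendsto_rpow_atTop (by linarith)).comp tendsto_natCast_atTop_atTop
  -- One third of the gap pays for the `ε` in the exponent, another third for the constant `C`; the
  -- last third keeps the inequality strict.
  obtain ⟨m, hm1, hm⟩ := ((ht.eventually_ge_atTop C).and (Filter.eventually_ge_atTop 2)).exists
  obtain ⟨t, ht, hA⟩ := hC m (by omega)
  have hpos : (0 : ℝ) < m := by
    have : 0 < m := by omega
    exact_mod_cast this
  refine ⟨m, t, τ' + (τ - τ') / 3 + (τ - τ') / 3, hm, by linarith, ht.trans ?_, hA⟩
  rw [Real.rpow_add hpos (τ' + (τ - τ') / 3), mul_comm]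
  gcongr

/-- A good enough rational algorithm gives good algorithms over all large prime fields. -/
theorem matMulUniformRank_of_rat {m t : ℕ} {τ : ℝ} (hm : 2 ≤ m) (hτ : 0 ≤ τ)
    (ht : (t : ℝ) ≤ (m : ℝ) ^ τ) (h : HasAlgebraicAlgorithm ℚ m m t) : MatMulUniformRank τ := by
  obtain ⟨p₀, hp₀⟩ := h.exists_forall_prime
  refine ⟨(m : ℝ) ^ τ, p₀, fun p hp hpp n hn => ?_⟩
  -- The least power of `m` above `n` overshoots by a factor of at most `m`, which costs the
  -- constant `m ^ τ`.
  let j := Nat.log m n + 1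
  have hmj : n ≤ m ^ j := (Nat.lt_pow_succ_log_self (by omega) n).le
  have hjm : m ^ (j - 1) ≤ n := Nat.pow_log_le_self m (by omega)
  refine ⟨t ^ j, ?_, ((hp₀ p hp hpp).pow j).of_le hmj⟩
  calc ((t ^ j : ℕ) : ℝ) = (t : ℝ) ^ j := by push_cast; rfl
    _ ≤ ((m : ℝ) ^ τ) ^ j := by gcongr
    _ = (m : ℝ) ^ τ * ((m : ℝ) ^ τ) ^ (j - 1) := by
      rw [← pow_succ']
      rfl
    _ = (m : ℝ) ^ τ * (((m ^ (j - 1) : ℕ) : ℝ)) ^ τ := by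
      rw [← Real.rpow_natCast, ← Real.rpow_mul (by positivity), mul_comm τ, Real.rpow_mul
        (by positivity), Real.rpow_natCast, Nat.cast_pow]
    _ ≤ _ := by
      gcongr

/-- One fixed rational algorithm with exponent at most `τ` yields, by tensor powers, algorithms of
all sizes whose constant does not depend on the prime. This uniformity is why the limit defining the
exponent is not taken over each `ZMod p` separately. -/
theorem matMulUniformRank_of_matMulExponent_lt {K : Type*} [Field K] [CharZero K] {τ : ℝ}
    (h : matMulExponent K < τ) : MatMulUniformRank τ := by
  have hτ : 0 ≤ τ := by linarith [two_le_matMulExponent K]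
  obtain ⟨m, t, σ, hm, hσ, ht, hA⟩ := exists_algorithm_of_matMulExponent_lt h
  obtain ⟨L, _, _, _, hL⟩ := hA.exists_finite_extension
  have hm1 : (1 : ℝ) < m := by
    have : 1 < m := by omega
    exact_mod_cast this
  have hm0 : (0 : ℝ) < m := by linarith
  let k := Module.finrank ℚ L
  have htend : Filter.Tendsto (fun j : ℕ => ((m : ℝ) ^ (τ - σ)) ^ j) Filter.atTop Filter.atTop :=
    tendsto_pow_atTop_atTop_of_one_lt (Real.one_lt_rpow hm1 (by linarith))
  -- The power is taken over the number field before restricting scalars, so that the factor `k ^ 2`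
  -- is paid only once and is dominated by `m ^ (j * (τ - σ))`.
  obtain ⟨j, hj, hj1⟩ := ((htend.eventually_ge_atTop ((k : ℝ) ^ 2)).and
    (Filter.eventually_ge_atTop 1)).exists
  refine matMulUniformRank_of_rat (m := m ^ j) (t := t ^ j * k ^ 2) ?_ hτ ?_
    (hL.pow j).restrictScalars
  · exact hm.trans (Nat.le_self_pow (by omega) m)
  · push_cast
    calc (t : ℝ) ^ j * (k : ℝ) ^ 2 ≤ ((m : ℝ) ^ σ) ^ j * ((m : ℝ) ^ (τ - σ)) ^ j := by gcongr
      _ = ((m : ℝ) ^ j) ^ τ := by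
        rw [← mul_pow, ← Real.rpow_add hm0, add_sub_cancel, ← Real.rpow_natCast,
          ← Real.rpow_mul hm0.le, mul_comm τ, Real.rpow_mul hm0.le, Real.rpow_natCast]

/-! ### Products of polynomial matrices in the congested clique -/

open Polynomial in
/-- The monomial with the given coefficient and exponent. -/
noncomputable def pairMonomial {R : Type*} [CommRing R] {k : ℕ} (x : R × Fin k) : R[X] :=
  monomial x.2 x.1

/-- The product of two matrices of monomials. -/
noncomputable def monomialMatrixMul {R : Type*} [CommRing R] {k n : ℕ}
    (X Y : Fin n → Fin n → R × Fin k) (u v : Fin n) : Polynomial R :=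
  ∑ x, pairMonomial (X u x) * pairMonomial (Y x v)

theorem Knows.sum {ι : Type*} {Ω : Type} {R : Type*} [AddCommMonoid R] {r : Ω → Ω → Prop}
    (s : Finset ι) {f : Ω → ι → R} (h : ∀ i, Knows r (fun ω => f ω i)) :
    Knows r (fun ω => ∑ i ∈ s, f ω i) :=
  (Knows.pi h).map fun g => ∑ i ∈ s, g i

theorem Knows.ite {Ω : Type} {α : Type*} {r : Ω → Ω → Prop} {c : Prop} [Decidable c]
    {f g : Ω → α} (hf : c → Knows r f) (hg : ¬ c → Knows r g) :
    Knows r (fun ω => if c then f ω else g ω) := by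
  by_cases h : c
  · simpa [h] using hf h
  · simpa [h] using hg h

/-- The objects of a finite type can be spread evenly over the nodes. -/
theorem exists_balanced_map (A : Type*) [Fintype A] {n : ℕ} (hn : 0 < n) :
    ∃ f : A → Fin n, ∀ v, (Finset.univ.filter fun a => f a = v).card ≤ Fintype.card A / n + 1 := by
  classical
  let e := Fintype.equivFin A
  refine ⟨fun a => ⟨e a % n, Nat.mod_lt _ hn⟩, fun v => ?_⟩
  rw [← Finset.card_range (Fintype.card A / n + 1)]
  refine Finset.card_le_card_of_injOn (fun a => (e a : ℕ) / n) ?_ ?_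
  · intro a _
    simp only [Finset.coe_range, Set.mem_Iio]
    exact Nat.lt_succ_of_le (Nat.div_le_div_right (e a).isLt.le)
  · intro a ha b hb hab
    simp only [Finset.coe_filter, Finset.mem_univ, true_and, Set.mem_ofPred_eq, Fin.ext_iff]
      at ha hb
    apply e.injective
    ext
    dsimp only at hab
    rw [← Nat.div_add_mod (e a : ℕ) n, ← Nat.div_add_mod (e b : ℕ) n, ha, hb, hab]

theorem card_filter_comp_le {A B C : Type*} [Fintype A] [Fintype B] [DecidableEq B]
    [DecidableEq C] (f : A → B) (g : B → C) (c : C) {x y : ℕ}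
    (hf : ∀ b, (Finset.univ.filter fun a => f a = b).card ≤ x)
    (hg : (Finset.univ.filter fun b => g b = c).card ≤ y) :
    (Finset.univ.filter fun a => g (f a) = c).card ≤ y * x := by
  classical
  have : (Finset.univ.filter fun a => g (f a) = c) ⊆
      (Finset.univ.filter fun b => g b = c).biUnion fun b => Finset.univ.filter fun a => f a = b := by
    intro a ha
    simpa using ha
  refine (Finset.card_le_card this).trans (Finset.card_biUnion_le.trans ?_)
  refine (Finset.sum_le_card_nsmul _ _ x fun b _ => hf b).trans ?_
  rw [smul_eq_mul]
  exact Nat.mul_le_mul_right x hg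

theorem card_filter_prod_le {A B : Type*} [Fintype A] [Fintype B] (p : A → Prop) (q : B → Prop)
    [DecidablePred p] [DecidablePred q] {x y : ℕ} (hx : (Finset.univ.filter p).card ≤ x)
    (hy : (Finset.univ.filter q).card ≤ y) :
    (Finset.univ.filter fun z : A × B => p z.1 ∧ q z.2).card ≤ x * y := by
  have : (Finset.univ.filter fun z : A × B => p z.1 ∧ q z.2) =
      Finset.univ.filter p ×ˢ Finset.univ.filter q := by
    ext z
    simp
  rw [this, Finset.card_product]
  exact Nat.mul_le_mul hx hy

theorem card_filter_fst_le {A B : Type*} [Fintype A] [Fintype B] (p : A → Prop)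
    [DecidablePred p] {x : ℕ} (hx : (Finset.univ.filter p).card ≤ x) :
    (Finset.univ.filter fun z : A × B => p z.1).card ≤ x * Fintype.card B := by
  simpa using card_filter_prod_le (B := B) p (fun _ => True) hx (le_refl _)

theorem card_filter_snd_le {A B : Type*} [Fintype A] [Fintype B] (p : B → Prop)
    [DecidablePred p] {x : ℕ} (hx : (Finset.univ.filter p).card ≤ x) :
    (Finset.univ.filter fun z : A × B => p z.2).card ≤ Fintype.card A * x := by
  simpa using card_filter_prod_le (A := A) (fun _ => True) p (le_refl _) hx

open Polynomial in
theorem natDegree_monomialMatrixMul_lt {R : Type*} [CommRing R] {k n : ℕ} (hk : 0 < k)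
    {X Y : Fin n → Fin n → R × Fin k}
    (h : ∀ u x v, ((X u x).2 : ℕ) + (Y x v).2 < k) (u v : Fin n) :
    (monomialMatrixMul X Y u v).natDegree < k := by
  refine lt_of_le_of_lt (Polynomial.natDegree_sum_le_of_forall_le (n := k - 1) _ _ fun x _ => ?_)
    (by omega)
  refine Polynomial.natDegree_mul_le.trans ?_
  have h1 := natDegree_monomial_le (X u x).1 (m := (X u x).2)
  have h2 := natDegree_monomial_le (Y x v).1 (m := (Y x v).2)
  have := h u x v
  simp only [pairMonomial]
  omega

open Polynomial in
-- Since `k ≤ p` the points `0, …, k - 1` are distinct modulo `p`, so interpolation applies.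
theorem eq_of_eval_natCast_eq {p k : ℕ} [Fact p.Prime] (hk : k ≤ p) {f g : (ZMod p)[X]}
    (hf : f.natDegree < k) (hg : g.natDegree < k)
    (h : ∀ i : Fin k, f.eval ((i : ℕ) : ZMod p) = g.eval ((i : ℕ) : ZMod p)) : f = g := by
  have hinj : Function.Injective fun i : Fin k => ((i : ℕ) : ZMod p) := by
    intro i j hij
    have := (ZMod.natCast_eq_natCast_iff' _ _ _).1 hij
    rw [Nat.mod_eq_of_lt (by omega), Nat.mod_eq_of_lt (by omega)] at this
    exact Fin.ext this
  refine Polynomial.eq_of_degree_sub_lt_of_eval_index_eq (v := fun i : Fin k => ((i : ℕ) : ZMod p))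
    (s := Finset.univ) hinj.injOn ?_ (fun i _ => h i)
  rw [Finset.card_univ, Fintype.card_fin]
  refine lt_of_le_of_lt (degree_sub_le f g) (max_lt ?_ ?_)
  · exact lt_of_le_of_lt degree_le_natDegree (by exact_mod_cast hf)
  · exact lt_of_le_of_lt degree_le_natDegree (by exact_mod_cast hg)

/-- The blockwise use of an algebraic algorithm. -/
theorem block_mul_apply {R : Type*} [CommRing R] {d t b : ℕ} {α β lam : Fin d → Fin d → Fin t → R}
    (h : BrentEquations α β lam) (A B : Fin d × Fin b → Fin d × Fin b → R) (P Q : Fin d × Fin b) :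
    ∑ μ, lam P.1 Q.1 μ * ∑ z, (∑ i, ∑ j, α i j μ * A (i, P.2) (j, z)) *
      (∑ i, ∑ j, β i j μ * B (j, z) (i, Q.2)) = ∑ y, A P y * B y Q := by
  simp_rw [Finset.mul_sum (s := (Finset.univ : Finset (Fin b))), ← mul_assoc]
  rw [Finset.sum_comm, Fintype.sum_prod_type, Finset.sum_comm (s := (Finset.univ : Finset (Fin d)))]
  refine Finset.sum_congr rfl fun z _ => ?_
  exact (h.mul_apply (Matrix.of fun i j => A (i, P.2) (j, z))
    (Matrix.of fun i j => B (i, z) (j, Q.2)) P.1 Q.1).symm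

open Polynomial in
/-- Multiplication of `n × n` matrices of monomials. -/
theorem Reach.monomialMatrixMul {n : ℕ} {Ω : Type} {p d t b k β L₁ L₂ L₃ : ℕ} [Fact p.Prime]
    (hn : 0 < n) (halg : HasAlgebraicAlgorithm (ZMod p) d d t) (hdb : n ≤ d * b) (hk0 : 0 < k)
    (hk : k ≤ p) (hβ : FitsIn n β (ZMod p × Fin k))
    (h₁ : (b * b / n + 1) * (d * d) ≤ n * L₁)
    (h₂ : (b * b / n + 1) * (k * t) ≤ n * L₂) (h₂' : (k * t / n + 1) * (b * b) ≤ n * L₂)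
    (h₃ : (b * b / n + 1) * (d * d) * k ≤ n * L₃) (h₃' : k ≤ L₃)
    (κ : Knowledge n Ω) (X Y : Ω → Fin n → Fin n → ZMod p × Fin k)
    (hX : ∀ u v, Knows (κ u) (fun ω => X ω u v)) (hY : ∀ u v, Knows (κ u) (fun ω => Y ω u v))
    (hdeg : ∀ ω u x v, ((X ω u x).2 : ℕ) + (Y ω x v).2 < k) :
    ∃ κ', Reach (4 * β * (2 * L₁ + 3 * L₂ + L₃)) κ κ' ∧
      ∀ u v, Knows (κ' u) (fun ω => _root_.monomialMatrixMul (X ω) (Y ω) u v) := by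
  classical
  obtain ⟨α, γ, lam, hB⟩ := hasAlgebraicAlgorithm_iff_brent.1 halg
  have hβ' : FitsIn n β (ZMod p) :=
    hβ.of_injective (fun x => (x, ⟨0, hk0⟩)) fun x y h => (Prod.mk.inj h).1
  -- An index becomes a block and an offset within the block. The node in charge of a pair of
  -- offsets holds the entries at these offsets in all `d * d` blocks, hence can form every linear
  -- combination of blocks at this position locally.
  let e : Fin n → Fin d × Fin b := fun u => finProdFinEquiv.symm (Fin.castLE hdb u)
  have he : Function.Injective e :=
    finProdFinEquiv.symm.injective.comp (Fin.castLE_injective hdb)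
  obtain ⟨pos, hpos⟩ := exists_balanced_map (Fin b × Fin b) hn
  obtain ⟨task, htask⟩ := exists_balanced_map (Fin k × Fin t) hn
  simp only [Fintype.card_prod, Fintype.card_fin] at hpos htask
  have hd0 : 0 < d := by
    rcases Nat.eq_zero_or_pos d with rfl | h
    · omega
    · exact h
  have hL₁ : 1 ≤ L₁ := by
    by_contra! h
    have : L₁ = 0 := by omega
    subst this
    have : 0 < (b * b / n + 1) * (d * d) := by positivity
    omega
  have hsnd : ∀ a : Fin b, (Finset.univ.filter fun u => (e u).2 = a).card ≤ d := by
    intro a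
    calc _ ≤ (Finset.univ : Finset (Fin d)).card := by
          refine Finset.card_le_card_of_injOn (fun u => (e u).1) (by simp) ?_
          intro u hu v hv huv
          simp only [Finset.coe_filter, Finset.mem_univ, true_and, Set.mem_ofPred_eq] at hu hv
          exact he (Prod.ext huv (hu.trans hv.symm))
      _ = d := by simp
  let cell : Fin n × Fin n → Fin b × Fin b := fun x => ((e x.1).2, (e x.2).2)
  have hcell : ∀ c, (Finset.univ.filter fun x => pos (cell x) = c).card ≤
      (b * b / n + 1) * (d * d) := by
    intro c
    refine card_filter_comp_le cell pos c (fun y => ?_) (hpos c)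
    have := card_filter_prod_le (fun u => (e u).2 = y.1) (fun u => (e u).2 = y.2)
      (hsnd y.1) (hsnd y.2)
    simpa only [cell, Prod.ext_iff] using this
  have hrow : ∀ u : Fin n, (Finset.univ.filter fun x : Fin n × Fin n => x.1 = u).card ≤ n * L₁ := by
    intro u
    refine (card_filter_fst_le (B := Fin n) (fun x => x = u) (x := 1) ?_).trans ?_
    · simp [Finset.filter_eq']
    simpa using Nat.le_mul_of_pos_right n hL₁
  -- the entries are collected at the nodes in charge of their positions
  obtain ⟨κ₁, r₁, k₁⟩ := Reach.route hβ κ L₁ (fun x : Fin n × Fin n => x.1) (fun x => pos (cell x))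
    hrow (fun c => (hcell c).trans h₁) (fun x ω => X ω x.1 x.2) (fun x => hX _ _)
  obtain ⟨κ₂, r₂, k₂⟩ := Reach.route hβ κ₁ L₁ (fun x : Fin n × Fin n => x.1) (fun x => pos (cell x))
    hrow (fun c => (hcell c).trans h₁) (fun x ω => Y ω x.1 x.2) (fun x => r₁.knows (hY _ _))
  replace k₁ := fun x => r₂.knows (k₁ x)
  -- evaluated and padded matrices
  let ev (Z : Ω → Fin n → Fin n → ZMod p × Fin k) (ω : Ω) (c : Fin k)
      (P Q : Fin d × Fin b) : ZMod p :=
    ∑ u, ∑ v, if e u = P ∧ e v = Q then (pairMonomial (Z ω u v)).eval ((c : ℕ) : ZMod p) else 0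
  have hev : ∀ Z : Ω → Fin n → Fin n → ZMod p × Fin k,
      (∀ x, Knows (κ₂ (pos (cell x))) (fun ω => Z ω x.1 x.2)) →
      ∀ c i j a z, Knows (κ₂ (pos (a, z))) (fun ω => ev Z ω c (i, a) (j, z)) := by
    intro Z hZ c i j a z
    refine Knows.sum _ fun u => Knows.sum _ fun v => Knows.ite (fun h => ?_) fun _ => Knows.const _
    have := hZ (u, v)
    simp only [cell, h.1, h.2] at this
    exact this.map fun y => (pairMonomial y).eval ((c : ℕ) : ZMod p)
  let S (ω : Ω) (x : Fin k × Fin t) (y : Fin b × Fin b) : ZMod p :=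
    ∑ i, ∑ j, α i j x.2 * ev X ω x.1 (i, y.1) (j, y.2)
  let T (ω : Ω) (x : Fin k × Fin t) (y : Fin b × Fin b) : ZMod p :=
    ∑ i, ∑ j, γ i j x.2 * ev Y ω x.1 (j, y.1) (i, y.2)
  have hS : ∀ x y, Knows (κ₂ (pos y)) (fun ω => S ω x y) := fun x y =>
    Knows.sum _ fun i => Knows.sum _ fun j => (hev X k₁ x.1 i j y.1 y.2).map fun w => α i j x.2 * w
  have hT : ∀ x y, Knows (κ₂ (pos y)) (fun ω => T ω x y) := fun x y =>
    Knows.sum _ fun i => Knows.sum _ fun j => (hev Y k₂ x.1 j i y.1 y.2).map fun w => γ i j x.2 * w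
  -- the linear combinations are sent to the nodes in charge of the block products
  have hpos' : ∀ c, (Finset.univ.filter fun x : (Fin k × Fin t) × (Fin b × Fin b) =>
      pos x.2 = c).card ≤ n * L₂ := fun c => by
    refine (card_filter_snd_le (fun y => pos y = c) (hpos c)).trans ?_
    rwa [Fintype.card_prod, Fintype.card_fin, Fintype.card_fin, mul_comm]
  have htask' : ∀ c, (Finset.univ.filter fun x : (Fin k × Fin t) × (Fin b × Fin b) =>
      task x.1 = c).card ≤ n * L₂ := fun c => by
    refine (card_filter_fst_le (fun y => task y = c) (htask c)).trans ?_
    rwa [Fintype.card_prod, Fintype.card_fin]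
  obtain ⟨κ₃, r₃, k₃⟩ := Reach.route hβ' κ₂ L₂
    (E := (Fin k × Fin t) × (Fin b × Fin b)) (fun x => pos x.2) (fun x => task x.1) hpos' htask'
    (fun x ω => S ω x.1 x.2) (fun x => hS _ _)
  obtain ⟨κ₄, r₄, k₄⟩ := Reach.route hβ' κ₃ L₂
    (E := (Fin k × Fin t) × (Fin b × Fin b)) (fun x => pos x.2) (fun x => task x.1) hpos' htask'
    (fun x ω => T ω x.1 x.2) (fun x => r₃.knows (hT _ _))
  let W (ω : Ω) (x : Fin k × Fin t) (y : Fin b × Fin b) : ZMod p :=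
    ∑ z, S ω x (y.1, z) * T ω x (z, y.2)
  have hW : ∀ x y, Knows (κ₄ (task x)) (fun ω => W ω x y) := fun x y =>
    Knows.sum _ fun z => (r₄.knows (k₃ (x, (y.1, z)))).map₂ (k₄ (x, (z, y.2))) fun a b => a * b
  -- the block products are sent back
  obtain ⟨κ₅, r₅, k₅⟩ := Reach.route hβ' κ₄ L₂
    (E := (Fin k × Fin t) × (Fin b × Fin b)) (fun x => task x.1) (fun x => pos x.2) htask' hpos'
    (fun x ω => W ω x.1 x.2) (fun x => hW _ _)
  have heval : ∀ ω (u v : Fin n) (c : Fin k),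
      (_root_.monomialMatrixMul (X ω) (Y ω) u v).eval ((c : ℕ) : ZMod p) =
      ∑ μ, lam (e u).1 (e v).1 μ * W ω (c, μ) (cell (u, v)) := by
    intro ω u v c
    refine Eq.trans ?_ (block_mul_apply hB (ev X ω c) (ev Y ω c) (e u) (e v)).symm
    have h1 : ∀ Q, ev X ω c (e u) Q =
        ∑ x, if e x = Q then (pairMonomial (X ω u x)).eval ((c : ℕ) : ZMod p) else 0 := by
      intro Q
      simp only [ev]
      rw [Finset.sum_eq_single u]
      · simp
      · intro u' _ hu'
        simp [he.ne hu']
      · simp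
    have h2 : ∀ x, ev Y ω c (e x) (e v) =
        (pairMonomial (Y ω x v)).eval ((c : ℕ) : ZMod p) := by
      intro x
      simp only [ev]
      rw [Finset.sum_eq_single x, Finset.sum_eq_single v]
      · simp
      · intro v' _ hv'
        simp [he.ne hv']
      · simp
      · intro u' _ hu'
        simp [he.ne hu']
      · simp
    simp_rw [h1, Finset.sum_mul]
    rw [Finset.sum_comm]
    simp only [_root_.monomialMatrixMul, eval_finsetSum, eval_mul]
    refine Finset.sum_congr rfl fun x _ => ?_
    rw [Finset.sum_eq_single (e x)]
    · simp [h2]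
    · intro Q _ hQ
      simp [hQ.symm]
    · simp
  have hlt := fun ω => natDegree_monomialMatrixMul_lt hk0 (hdeg ω)
  -- Interpolation without an explicit formula: the node knows all `k` values, and these determine
  -- the polynomial.
  have hpoly : ∀ x : Fin n × Fin n, Knows (κ₅ (pos (cell x)))
      (fun ω => _root_.monomialMatrixMul (X ω) (Y ω) x.1 x.2) := by
    intro x ω ω' hω
    refine eq_of_eval_natCast_eq hk (hlt ω _ _) (hlt ω' _ _) fun c => ?_
    rw [heval, heval]
    exact Finset.sum_congr rfl fun μ _ => congrArg _ (k₅ ((c, μ), cell x) ω ω' hω)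
  -- the coefficients of the results are sent to the rows
  obtain ⟨κ₆, r₆, k₆⟩ := Reach.route hβ' κ₅ L₃ (E := (Fin n × Fin n) × Fin k)
    (fun x => pos (cell x.1)) (fun x => x.1.1)
    (fun c => (card_filter_fst_le (fun y => pos (cell y) = c) (hcell c)).trans (by simpa using h₃))
    (fun c => by
      refine (card_filter_fst_le (fun y : Fin n × Fin n => y.1 = c) (x := n) ?_).trans ?_
      · simpa using card_filter_fst_le (B := Fin n) (fun x => x = c) (x := 1)
          (by simp [Finset.filter_eq'])
      · simpa using Nat.mul_le_mul_left n h₃')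
    (fun x ω => (_root_.monomialMatrixMul (X ω) (Y ω) x.1.1 x.1.2).coeff x.2)
    (fun x => (hpoly x.1).map fun f => f.coeff x.2)
  refine ⟨κ₆, ?_, fun u v ω ω' hω => ?_⟩
  · refine Reach.mono (le_of_eq ?_) (((((r₁.trans r₂).trans r₃).trans r₄).trans r₅).trans r₆)
    ring
  · ext c
    by_cases hc : c < k
    · exact k₆ ((u, v), ⟨c, hc⟩) ω ω' hω
    · rw [coeff_eq_zero_of_natDegree_lt (lt_of_lt_of_le (hlt ω u v) (not_lt.1 hc)),
        coeff_eq_zero_of_natDegree_lt (lt_of_lt_of_le (hlt ω' u v) (not_lt.1 hc))]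

/-- Products of `n × n` matrices of monomials over `ZMod p`, with all exponents of the result less
than `k`, can be computed in `T` rounds. -/
def MonomialMulIn (n p k T : ℕ) : Prop :=
  ∀ (Ω : Type) (κ : Knowledge n Ω) (X Y : Ω → Fin n → Fin n → ZMod p × Fin k),
    (∀ u v, Knows (κ u) (fun ω => X ω u v)) → (∀ u v, Knows (κ u) (fun ω => Y ω u v)) →
    (∀ ω u x v, ((X ω u x).2 : ℕ) + (Y ω x v).2 < k) →
    ∃ κ', Reach T κ κ' ∧ ∀ u v, Knows (κ' u) (fun ω => monomialMatrixMul (X ω) (Y ω) u v)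

/-- The bound `M ^ (2 / τ) * n ^ (1 - 2 / τ)`. -/
noncomputable def roundBound (τ : ℝ) (n M : ℕ) : ℝ := (M : ℝ) ^ (2 / τ) * (n : ℝ) ^ (1 - 2 / τ)

theorem roundBound_eq {τ : ℝ} {n M : ℕ} (hn : 0 < n) :
    roundBound τ n M = n * ((M : ℝ) / n) ^ (2 / τ) := by
  have : (0 : ℝ) < n := by exact_mod_cast hn
  rw [roundBound, Real.div_rpow (by positivity) this.le, Real.rpow_sub this, Real.rpow_one]
  ring

/-- Handing out all the coefficients of the product costs `O(M)` rounds; this bound absorbs them. -/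
theorem le_roundBound {τ : ℝ} (hτ : 2 ≤ τ) {n M : ℕ} (hM : 1 ≤ M) (hMn : M ≤ n) :
    (M : ℝ) ≤ roundBound τ n M := by
  have h0 : (0 : ℝ) < M := by exact_mod_cast hM
  have h1 : (M : ℝ) ≤ n := by exact_mod_cast hMn
  have h2 : 2 / τ ≤ 1 := by rw [div_le_one (by linarith)]; exact hτ
  calc (M : ℝ) = (M : ℝ) ^ (2 / τ) * (M : ℝ) ^ (1 - 2 / τ) := by
        rw [← Real.rpow_add h0]
        simp
    _ ≤ _ := by
      unfold roundBound
      gcongr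

/-- The ideal grid size is `x = (n / k) ^ (1 / τ)`, for which `k * x ^ τ = n` and `n / x ^ 2` is the
desired bound. Rounding down loses at most a factor `2` in `x`; for `x < 1`, possible since `k` may
exceed `n`, the grid is trivial. -/
theorem exists_grid {τ : ℝ} (hτ : 2 ≤ τ) {n k : ℕ} (hn : 0 < n) (hk : 0 < k) :
    ∃ d : ℕ, 1 ≤ d ∧ d * d ≤ n ∧ (k : ℝ) * (d : ℝ) ^ τ ≤ max (k : ℝ) n ∧
      (n : ℝ) ≤ 4 * roundBound τ n k * (d * d) := by
  have hn' : (0 : ℝ) < n := by exact_mod_cast hn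
  have hk' : (0 : ℝ) < k := by exact_mod_cast hk
  have hτ0 : 0 < τ := by linarith
  set x : ℝ := ((n : ℝ) / k) ^ (1 / τ) with hx
  have hx0 : 0 < x := by positivity
  have hxτ : x ^ τ = n / k := by
    rw [hx, ← Real.rpow_mul (by positivity), one_div_mul_cancel hτ0.ne', Real.rpow_one]
  have hx2 : x ^ 2 * roundBound τ n k = n := by
    rw [roundBound_eq hn, hx, ← Real.rpow_natCast, ← Real.rpow_mul (by positivity),
      mul_left_comm]
    have : (1 / τ * (2 : ℕ) : ℝ) = 2 / τ := by
      push_cast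
      ring
    rw [this, ← Real.mul_rpow (by positivity) (by positivity), 
      div_mul_div_cancel₀ hk'.ne', div_self hn'.ne', Real.one_rpow, mul_one]
  have hR : 0 ≤ roundBound τ n k := by
    unfold roundBound
    positivity
  rcases lt_or_ge x 1 with h | h
  · refine ⟨1, le_refl _, by omega, by simp, ?_⟩
    have : x ^ 2 ≤ 1 := by nlinarith
    push_cast
    nlinarith
  · have h1 : 1 ≤ ⌊x⌋₊ := Nat.le_floor (by simpa using h)
    have hfl : (⌊x⌋₊ : ℝ) ≤ x := Nat.floor_le hx0.le
    have hfl2 : x < ⌊x⌋₊ + 1 := Nat.lt_floor_add_one x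
    have h1' : (1 : ℝ) ≤ ⌊x⌋₊ := by exact_mod_cast h1
    have hpow : (⌊x⌋₊ : ℝ) ^ τ ≤ n / k := by
      rw [← hxτ]
      exact Real.rpow_le_rpow (by positivity) hfl hτ0.le
    refine ⟨⌊x⌋₊, h1, ?_, ?_, ?_⟩
    · have h2 : (⌊x⌋₊ : ℝ) ^ (2 : ℝ) ≤ (⌊x⌋₊ : ℝ) ^ τ := Real.rpow_le_rpow_of_exponent_le h1' hτ
      have h3 : (n : ℝ) / k ≤ n := div_le_self hn'.le (by exact_mod_cast hk)
      rw [Real.rpow_two] at h2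
      have : (⌊x⌋₊ : ℝ) * ⌊x⌋₊ ≤ n := by nlinarith
      exact_mod_cast this
    · refine le_trans ?_ (le_max_right _ _)
      rw [le_div_iff₀ hk'] at hpow
      linarith
    · have : x ^ 2 ≤ 4 * (⌊x⌋₊ * ⌊x⌋₊) := by nlinarith
      calc (n : ℝ) = x ^ 2 * roundBound τ n k := hx2.symm
        _ ≤ (4 * (⌊x⌋₊ * ⌊x⌋₊)) * roundBound τ n k := by gcongr
        _ = _ := by ring

theorem MatMulUniformRank.exists_monomialMulIn {τ : ℝ} (h : MatMulUniformRank τ) :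
    ∃ C : ℝ, ∀ n M : ℕ, 1 ≤ M → M ≤ n → ∃ p T : ℕ, p.Prime ∧ n < p ∧
      MonomialMulIn n p (8 * M + 1) T ∧ (T : ℝ) ≤ C * roundBound τ n M := by
  have hτ := h.two_le
  obtain ⟨C₀, p₀, h⟩ := h
  let C₁ : ℕ := ⌈C₀⌉₊
  have hC₁ : C₀ ≤ C₁ := Nat.le_ceil C₀
  let β : ℕ := 9 * (18 + 2 * p₀) + 2
  refine ⟨4 * β * (10 + 3 * ((9 * C₁ + 1) * 145) + 45), fun n M hM hMn => ?_⟩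
  have hn : 0 < n := by omega
  let k := 8 * M + 1
  have hk9 : k ≤ 9 * n := by omega
  -- Bertrand's postulate: the prime exceeds `k`, `n` and the exceptional primes, but is still
  -- `O(n)`, so scalars fit into boundedly many messages.
  obtain ⟨p, hp, hplt, hple⟩ := Nat.exists_prime_lt_and_le_two_mul (9 * n + p₀) (by omega)
  have := Fact.mk hp
  obtain ⟨d, hd1, hdn, hkd, hnd⟩ := exists_grid hτ hn (show 0 < k by omega)
  obtain ⟨t, ht, hA⟩ := h p hp (by omega) d hd1
  have hkt : k * t ≤ 9 * C₁ * n := by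
    have h1 : (k : ℝ) * d ^ τ ≤ 9 * n := by
      refine hkd.trans (max_le (by exact_mod_cast hk9) ?_)
      have : (0 : ℝ) ≤ n := by positivity
      linarith
    have h2 : (k * t : ℝ) ≤ 9 * C₁ * n := by
      calc (k * t : ℝ) ≤ k * (C₁ * d ^ τ) := by
            gcongr
            refine ht.trans ?_
            gcongr
        _ = C₁ * (k * d ^ τ) := by ring
        _ ≤ C₁ * (9 * n) := by gcongr
        _ = _ := by ring
    exact_mod_cast h2
  let b := n / d + 1
  have hdb : n ≤ d * b := by
    have := Nat.lt_mul_div_succ n (show 0 < d by omega)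
    exact this.le
  have hdn' : d ≤ n := le_trans (Nat.le_mul_self d) hdn
  have hdb2 : d * b ≤ 2 * n := by
    have := Nat.mul_div_le n d
    have : d * b = d * (n / d) + d := by simp only [b]; ring
    omega
  let q := b * b / n + 1
  have hqn : (b * b / n) * n ≤ b * b := Nat.div_mul_le_self _ _
  have hbq : b * b ≤ n * q := (Nat.lt_mul_div_succ (b * b) hn).le
  have hbd : (b * b) * (d * d) ≤ 4 * n * n := by nlinarith
  have hq4 : (b * b / n) * (d * d) ≤ 4 * n := by
    have : ((b * b / n) * (d * d)) * n ≤ (4 * n) * n := by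
      calc ((b * b / n) * (d * d)) * n = ((b * b / n) * n) * (d * d) := by ring
        _ ≤ (b * b) * (d * d) := Nat.mul_le_mul_right _ hqn
        _ ≤ _ := hbd
    exact Nat.le_of_mul_le_mul_right this hn
  have h₁ : q * (d * d) ≤ n * 5 := by
    have : q * (d * d) = (b * b / n) * (d * d) + d * d := by simp only [q]; ring
    omega
  -- A node is in charge of at most `q` positions and at most `9 * C₁ + 1` block products; this is
  -- the dominant term of the communication.
  have h₂ : q * (k * t) ≤ n * ((9 * C₁ + 1) * q) := by nlinarith
  have h₂' : (k * t / n + 1) * (b * b) ≤ n * ((9 * C₁ + 1) * q) := by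
    have : k * t / n ≤ 9 * C₁ := Nat.div_le_of_le_mul (by linarith)
    calc (k * t / n + 1) * (b * b) ≤ (9 * C₁ + 1) * (n * q) :=
          Nat.mul_le_mul (by omega) hbq
      _ = _ := by ring
  have h₃ : q * (d * d) * k ≤ n * (5 * k) := by
    calc q * (d * d) * k ≤ n * 5 * k := Nat.mul_le_mul_right k h₁
      _ = _ := by ring
  have hfits : FitsIn n β (ZMod p × Fin k) := by
    refine fitsIn_of_card_le_mul_pow _ _ ?_
    rw [Fintype.card_prod, ZMod.card, Fintype.card_fin]
    have hp2 : p ≤ (18 + 2 * p₀) * (n + 1) := by nlinarith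
    calc p * k ≤ ((18 + 2 * p₀) * (n + 1)) * (9 * (n + 1)) := Nat.mul_le_mul hp2 (by omega)
      _ = _ := by ring
  refine ⟨p, 4 * β * (2 * 5 + 3 * ((9 * C₁ + 1) * q) + 5 * k), hp, by omega, ?_, ?_⟩
  · intro Ω κ X Y hX hY hdeg
    exact Reach.monomialMatrixMul hn hA hdb (by omega) (by omega) hfits h₁ h₂ h₂' h₃ (by omega)
      κ X Y hX hY hdeg
  · have hB := le_roundBound hτ hM hMn
    have hM1 : (1 : ℝ) ≤ M := by exact_mod_cast hM
    set B := roundBound τ n M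
    have hn' : (0 : ℝ) < n := by exact_mod_cast hn
    have hkB : roundBound τ n k ≤ 9 * B := by
      have h9 : (k : ℝ) ≤ 9 * M := by
        have : k ≤ 9 * M := by omega
        exact_mod_cast this
      have h91 : (9 : ℝ) ^ (2 / τ) ≤ 9 := by
        conv_rhs => rw [← Real.rpow_one 9]
        refine Real.rpow_le_rpow_of_exponent_le (by norm_num) ?_
        rw [div_le_one (by linarith)]
        exact hτ
      have hM0 : (0 : ℝ) ≤ M := by linarith
      simp only [B, roundBound]
      calc (k : ℝ) ^ (2 / τ) * (n : ℝ) ^ (1 - 2 / τ) ≤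
            (9 * M : ℝ) ^ (2 / τ) * (n : ℝ) ^ (1 - 2 / τ) := by gcongr
        _ = (9 : ℝ) ^ (2 / τ) * ((M : ℝ) ^ (2 / τ) * (n : ℝ) ^ (1 - 2 / τ)) := by
          rw [Real.mul_rpow (by norm_num) hM0]
          ring
        _ ≤ _ := by gcongr
    have hq : (q : ℝ) ≤ 145 * B := by
      have hd0 : (0 : ℝ) < d * d := by
        have : 0 < d * d := by positivity
        exact_mod_cast this
      have h1 : ((b * b / n : ℕ) : ℝ) * (d * d) ≤ 4 * n := by exact_mod_cast hq4
      have h2 : (4 : ℝ) * n ≤ 144 * B * (d * d) := by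
        have : 4 * roundBound τ n k * (d * d) ≤ 4 * (9 * B) * (d * d) := by gcongr
        linarith
      have h3 : ((b * b / n : ℕ) : ℝ) ≤ 144 * B := le_of_mul_le_mul_right (h1.trans h2) hd0
      have h4 : (q : ℝ) = ((b * b / n : ℕ) : ℝ) + 1 := by simp only [q]; push_cast; ring
      linarith
    have hk : (k : ℝ) ≤ 9 * B := by
      have : (k : ℝ) = 8 * M + 1 := by simp only [k]; push_cast; ring
      linarith
    have hC : (0 : ℝ) ≤ C₁ := by positivity
    have hB1 : 2 * 5 ≤ 10 * B := by linarith
    calc ((4 * β * (2 * 5 + 3 * ((9 * C₁ + 1) * q) + 5 * k) : ℕ) : ℝ) =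
        4 * (β : ℝ) * (2 * 5 + 3 * ((9 * C₁ + 1) * q) + 5 * k) := by norm_num
      _ ≤ 4 * (β : ℝ) * (10 * B + 3 * ((9 * C₁ + 1) * (145 * B)) + 5 * (9 * B)) := by
          gcongr
      _ = _ := by ring

/-! ### Weighted distances -/

section WeightedDist

variable {V : Type*} {G : SimpleGraph V} {w : Sym2 V → ℕ}

@[simp] theorem walkWeight_nil {u : V} : walkWeight w (SimpleGraph.Walk.nil : G.Walk u u) = 0 := rfl

@[simp] theorem walkWeight_cons {u v x : V} (h : G.Adj u v) (p : G.Walk v x) :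
    walkWeight w (.cons h p) = w s(u, v) + walkWeight w p := by
  simp [walkWeight]

theorem walkWeight_append {u v x : V} (p : G.Walk u v) (q : G.Walk v x) :
    walkWeight w (p.append q) = walkWeight w p + walkWeight w q := by
  simp [walkWeight]

theorem walkWeight_reverse {u v : V} (p : G.Walk u v) :
    walkWeight w p.reverse = walkWeight w p := by
  simp [walkWeight, List.sum_reverse]

theorem weightedDist_le {u v : V} (p : G.Walk u v) : weightedDist G w u v ≤ walkWeight w p :=
  iInf_le _ p

theorem exists_walk_of_weightedDist_ne_top {u v : V} (h : weightedDist G w u v ≠ ⊤) :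
    ∃ p : G.Walk u v, (walkWeight w p : ℕ∞) = weightedDist G w u v := by
  have : Nonempty (G.Walk u v) := by
    by_contra hne
    rw [not_nonempty_iff] at hne
    exact h (by simp [weightedDist])
  exact ciInf_mem fun p : G.Walk u v => (walkWeight w p : ℕ∞)

theorem weightedDist_self (u : V) : weightedDist G w u u = 0 :=
  nonpos_iff_eq_zero.1 (by simpa using weightedDist_le (w := w) (SimpleGraph.Walk.nil : G.Walk u u))

theorem weightedDist_comm (u v : V) : weightedDist G w u v = weightedDist G w v u := by
  suffices H : ∀ u v, weightedDist G w u v ≤ weightedDist G w v u from le_antisymm (H u v) (H v u)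
  intro u v
  refine le_iInf fun p => ?_
  rw [← walkWeight_reverse]
  exact weightedDist_le p.reverse

theorem weightedDist_triangle (u x v : V) :
    weightedDist G w u v ≤ weightedDist G w u x + weightedDist G w x v := by
  by_cases h1 : weightedDist G w u x = ⊤
  · simp [h1]
  by_cases h2 : weightedDist G w x v = ⊤
  · simp [h2]
  obtain ⟨p, hp⟩ := exists_walk_of_weightedDist_ne_top h1
  obtain ⟨q, hq⟩ := exists_walk_of_weightedDist_ne_top h2
  rw [← hp, ← hq, ← Nat.cast_add, ← walkWeight_append]
  exact weightedDist_le _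

theorem weightedDist_le_of_adj {u v : V} (h : G.Adj u v) : weightedDist G w u v ≤ w s(u, v) := by
  simpa using weightedDist_le (w := w) h.toWalk

theorem weightedDist_ne_top_iff {u v : V} : weightedDist G w u v ≠ ⊤ ↔ G.Reachable u v := by
  constructor
  · intro h
    exact ⟨(exists_walk_of_weightedDist_ne_top h).choose⟩
  · rintro ⟨p⟩ h
    have := weightedDist_le (w := w) p
    simp [h] at this

theorem exists_path_of_weightedDist_ne_top [DecidableEq V] {u v : V}
    (h : weightedDist G w u v ≠ ⊤) :
    ∃ p : G.Walk u v, p.IsPath ∧ (walkWeight w p : ℕ∞) = weightedDist G w u v := by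
  obtain ⟨p, hp⟩ := exists_walk_of_weightedDist_ne_top h
  refine ⟨p.bypass, p.bypass_isPath, le_antisymm ?_ (weightedDist_le _)⟩
  rw [← hp]
  have : walkWeight w p.bypass ≤ walkWeight w p :=
    (p.edges_bypass_sublist_edges.map w).sum_le_sum fun _ _ => Nat.zero_le _
  exact_mod_cast this

theorem walkWeight_le {M : ℕ} (hw : ∀ e ∈ G.edgeSet, w e ≤ M) {u v : V} (p : G.Walk u v) :
    walkWeight w p ≤ p.length * M := by
  induction p with
  | nil => simp
  | cons h p ih =>
    have := hw _ ((SimpleGraph.mem_edgeSet G).2 h)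
    rw [walkWeight_cons, SimpleGraph.Walk.length_cons]
    nlinarith

/-- The walk is followed as long as the weight stays at most `t`. The next edge, of weight at most
`M`, would exceed it. -/
theorem exists_split_walk {M : ℕ} (hM : 1 ≤ M) (hw : ∀ e ∈ G.edgeSet, w e ≤ M) {u v : V}
    (p : G.Walk u v) (t : ℕ) (ht : t ≤ walkWeight w p) :
    ∃ (x : V) (q : G.Walk u x) (r : G.Walk x v), walkWeight w q + walkWeight w r = walkWeight w p ∧
      walkWeight w q ≤ t ∧ t < walkWeight w q + M := by
  induction p generalizing t with
  | nil => exact ⟨_, .nil, .nil, by simp, by simp, by simp at ht ⊢; omega⟩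
  | @cons u y v h p ih =>
    have := hw _ ((SimpleGraph.mem_edgeSet G).2 h)
    by_cases htw : t < w s(u, y)
    · exact ⟨u, .nil, .cons h p, by simp, by simp, by simp; omega⟩
    · rw [walkWeight_cons] at ht
      obtain ⟨x, q, r, h1, h2, h3⟩ := ih (t - w s(u, y)) (by omega)
      refine ⟨x, .cons h q, r, ?_, ?_, ?_⟩ <;> simp only [walkWeight_cons] <;> omega

end WeightedDist

/-- The properties of the distances that are used for their computation. -/
structure IsStepMetric {V : Type*} (D : V → V → ℕ∞) (M : ℕ) : Prop where
  self : ∀ u, D u u = 0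
  comm : ∀ u v, D u v = D v u
  triangle : ∀ u x v, D u v ≤ D u x + D x v
  split : ∀ u v (d t : ℕ), D u v = d → t ≤ d → ∃ (x : V) (a b : ℕ), D u x = a ∧ D x v = b ∧
    a + b = d ∧ a ≤ t ∧ t < a + M

theorem isStepMetric_weightedDist {V : Type*} {G : SimpleGraph V} {w : Sym2 V → ℕ} {M : ℕ}
    (hM : 1 ≤ M) (hw : ∀ e ∈ G.edgeSet, w e ≤ M) : IsStepMetric (weightedDist G w) M where
  self := weightedDist_self
  comm := weightedDist_comm
  triangle := weightedDist_triangle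
  split := by
    intro u v d t hd ht
    obtain ⟨p, hp⟩ := exists_walk_of_weightedDist_ne_top (by rw [hd]; exact ENat.natCast_ne_top d)
    rw [hd] at hp
    have hp' : walkWeight w p = d := by exact_mod_cast hp
    obtain ⟨x, q, r, h1, h2, h3⟩ := exists_split_walk hM hw p t (by omega)
    have hq := weightedDist_le (w := w) q
    have hr := weightedDist_le (w := w) r
    have htri := weightedDist_triangle (G := G) (w := w) u x v
    obtain ⟨a, ha⟩ := ENat.ne_top_iff_exists.1 (ne_top_of_le_ne_top (ENat.natCast_ne_top _) hq)
    obtain ⟨b, hb⟩ := ENat.ne_top_iff_exists.1 (ne_top_of_le_ne_top (ENat.natCast_ne_top _) hr)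
    rw [hd, ← ha, ← hb] at htri
    rw [← ha] at hq
    rw [← hb] at hr
    norm_cast at hq hr htri
    refine ⟨x, a, b, ha.symm, hb.symm, ?_, ?_, ?_⟩ <;> omega

theorem weightedDist_le_mul {n M : ℕ} {G : SimpleGraph (Fin n)} {w : Sym2 (Fin n) → ℕ}
    (hw : ∀ e ∈ G.edgeSet, w e ≤ M) {u v : Fin n} (h : weightedDist G w u v ≠ ⊤) :
    weightedDist G w u v ≤ (n * M : ℕ) := by
  obtain ⟨p, hp, hpw⟩ := exists_path_of_weightedDist_ne_top h
  rw [← hpw]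
  have h1 := walkWeight_le hw p
  have h2 := hp.length_lt
  rw [Fintype.card_fin] at h2
  have : walkWeight w p ≤ n * M := h1.trans (Nat.mul_le_mul_right M h2.le)
  exact_mod_cast this

/-! ### Distance products -/

/-- The distance product of two matrices. -/
noncomputable def minPlus {n : ℕ} (X Y : Fin n → Fin n → ℕ∞) (u v : Fin n) : ℕ∞ :=
  ⨅ x, X u x + Y x v

/-- Replacing the values above `B` by `∞`. -/
noncomputable def truncAbove (B : ℕ) (d : ℕ∞) : ℕ∞ := if d ≤ B then d else ⊤

theorem truncAbove_eq_top_or_le (B : ℕ) (d : ℕ∞) : truncAbove B d = ⊤ ∨ truncAbove B d ≤ B := by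
  unfold truncAbove
  split_ifs with h <;> simp [h]

theorem le_truncAbove (B : ℕ) (d : ℕ∞) : d ≤ truncAbove B d := by
  unfold truncAbove
  split_ifs with h <;> simp

open Polynomial in
theorem coeff_monomialMatrixMul {R : Type*} [CommRing R] {k n : ℕ}
    (X Y : Fin n → Fin n → R × Fin k) (u v : Fin n) (e : ℕ) :
    (monomialMatrixMul X Y u v).coeff e = ∑ x, if ((X u x).2 : ℕ) + (Y x v).2 = e then
      (X u x).1 * (Y x v).1 else 0 := by
  simp only [monomialMatrixMul, finsetSum_coeff, pairMonomial, monomial_mul_monomial,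
    coeff_monomial]

/-- The coefficient at `e` counts the intermediate nodes giving the sum `e`. The count is at most `n
< p`, so it vanishes modulo `p` only if there are none, and the least exponent that occurs is the
distance product. -/
theorem MonomialMulIn.minPlus {n p k T B : ℕ} (h : MonomialMulIn n p k T) (hp : p.Prime)
    (hnp : n < p) (hB : 2 * B < k) {Ω : Type} (κ : Knowledge n Ω)
    (X Y : Ω → Fin n → Fin n → ℕ∞) (hX : ∀ u v, Knows (κ u) (fun ω => X ω u v))
    (hY : ∀ u v, Knows (κ u) (fun ω => Y ω u v)) (hXB : ∀ ω u v, X ω u v = ⊤ ∨ X ω u v ≤ B)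
    (hYB : ∀ ω u v, Y ω u v = ⊤ ∨ Y ω u v ≤ B) :
    ∃ κ', Reach T κ κ' ∧ ∀ u v, Knows (κ' u) (fun ω => _root_.minPlus (X ω) (Y ω) u v) := by
  classical
  have := Fact.mk hp
  -- The entry `∞` is encoded by the coefficient `0`, where the exponent is irrelevant. The inner
  -- minimum only provides the bound required by `Fin k`.
  let enc : ℕ∞ → ZMod p × Fin k := fun d =>
    if d ≤ B then (1, ⟨min d.toNat B, by have := min_le_right d.toNat B; omega⟩)
    else (0, ⟨0, by omega⟩)
  have henc : ∀ d, ((enc d).2 : ℕ) ≤ B := by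
    intro d
    simp only [enc]
    split_ifs
    · exact min_le_right _ _
    · simp
  obtain ⟨κ', r, hk⟩ := h Ω κ (fun ω u v => enc (X ω u v)) (fun ω u v => enc (Y ω u v))
    (fun u v => (hX u v).map enc) (fun u v => (hY u v).map enc) (fun ω u x v => by
      have := henc (X ω u x)
      have := henc (Y ω x v)
      omega)
  refine ⟨κ', r, fun u v => (hk u v).of_eq
    (fun f => ⨅ (e : ℕ) (_ : f.coeff e ≠ 0), (e : ℕ∞)) fun ω => ?_⟩
  have hcoeff : ∀ e : ℕ, (monomialMatrixMul (fun u v => enc (X ω u v))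
      (fun u v => enc (Y ω u v)) u v).coeff e =
      ((Finset.univ.filter fun x => X ω u x + Y ω x v = e).card : ZMod p) := by
    intro e
    rw [coeff_monomialMatrixMul, Finset.card_filter, Nat.cast_sum]
    refine Finset.sum_congr rfl fun x _ => ?_
    rcases hXB ω u x with hx | hx
    · simp [hx, enc]
    rcases hYB ω x v with hy | hy
    · simp [hy, enc]
    obtain ⟨a, ha⟩ := ENat.ne_top_iff_exists.1 (ne_top_of_le_ne_top (ENat.natCast_ne_top _) hx)
    obtain ⟨b, hb⟩ := ENat.ne_top_iff_exists.1 (ne_top_of_le_ne_top (ENat.natCast_ne_top _) hy)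
    rw [← ha] at hx ⊢
    rw [← hb] at hy ⊢
    simp only [enc, if_pos hx, if_pos hy]
    norm_cast at hx hy ⊢
    simp [hx, hy]
  have hne : ∀ e : ℕ, (monomialMatrixMul (fun u v => enc (X ω u v))
      (fun u v => enc (Y ω u v)) u v).coeff e ≠ 0 ↔ ∃ x, X ω u x + Y ω x v = e := by
    intro e
    rw [hcoeff, Ne, ZMod.natCast_eq_zero_iff]
    have hle : (Finset.univ.filter fun x => X ω u x + Y ω x v = e).card ≤ n := by
      simpa using Finset.card_filter_le (Finset.univ : Finset (Fin n)) _
    constructor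
    · intro h
      by_contra hcon
      apply h
      rw [Finset.filter_false_of_mem (fun x _ hx => hcon ⟨x, hx⟩)]
      simp
    · rintro ⟨x, hx⟩ hdvd
      have := Nat.le_of_dvd (Finset.card_pos.2 ⟨x, by simpa using hx⟩) hdvd
      omega
  simp only [hne, _root_.minPlus]
  refine le_antisymm (le_iInf₂ fun e ⟨x, hx⟩ => hx ▸ iInf_le _ x) (le_iInf fun x => ?_)
  by_cases hx : X ω u x + Y ω x v = ⊤
  · simp [hx]
  · obtain ⟨e, he⟩ := ENat.ne_top_iff_exists.1 hx
    rw [← he]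
    exact iInf₂_le e ⟨x, he.symm⟩

/-! ### Truncated repeated squaring -/

/-- Repeated squaring of the adjacency matrix, forgetting all values above `B`. -/
noncomputable def truncSquaring {n : ℕ} (B : ℕ) (A : Fin n → Fin n → ℕ∞) :
    ℕ → Fin n → Fin n → ℕ∞
  | 0 => fun u v => truncAbove B (if u = v then 0 else A u v)
  | i + 1 => fun u v => truncAbove B (minPlus (truncSquaring B A i) (truncSquaring B A i) u v)

theorem truncSquaring_eq_top_or_le {n B : ℕ} (A : Fin n → Fin n → ℕ∞) (i : ℕ) (u v : Fin n) :
    truncSquaring B A i u v = ⊤ ∨ truncSquaring B A i u v ≤ B := by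
  cases i <;> exact truncAbove_eq_top_or_le _ _

theorem weightedDist_le_truncSquaring {n B : ℕ} (G : SimpleGraph (Fin n)) (w : Sym2 (Fin n) → ℕ)
    (i : ℕ) (u v : Fin n) :
    weightedDist G w u v ≤ truncSquaring B (weightedAdjMatrix G w) i u v := by
  induction i generalizing u v with
  | zero =>
    refine le_trans ?_ (le_truncAbove _ _)
    split_ifs with h
    · rw [h, weightedDist_self]
    · unfold weightedAdjMatrix
      split_ifs with h'
      · exact weightedDist_le_of_adj h'
      · exact le_top
  | succ i ih =>
    refine le_trans ?_ (le_truncAbove _ _)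
    exact le_iInf fun x => (weightedDist_triangle u x v).trans (add_le_add (ih u x) (ih x v))

/-- The walk is cut after `2 ^ i` edges. As weights are nonnegative, both parts also have weight at
most `B`, so truncation does not remove their values. -/
theorem truncSquaring_le {n B : ℕ} (G : SimpleGraph (Fin n)) (w : Sym2 (Fin n) → ℕ) (i : ℕ)
    {u v : Fin n} (p : G.Walk u v) (hl : p.length ≤ 2 ^ i) (hB : walkWeight w p ≤ B) :
    truncSquaring B (weightedAdjMatrix G w) i u v ≤ walkWeight w p := by
  have htr : ∀ d : ℕ∞, d ≤ walkWeight w p → truncAbove B d ≤ walkWeight w p := by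
    intro d hd
    unfold truncAbove
    rwa [if_pos (hd.trans (by exact_mod_cast hB))]
  induction i generalizing u v with
  | zero =>
    refine htr _ ?_
    match p, hl with
    | .nil, _ => simp
    | .cons h .nil, _ => simp [weightedAdjMatrix, h, h.ne]
    | .cons _ (.cons _ _), hl => simp at hl
  | succ i ih =>
    refine htr _ ?_
    have hw : walkWeight w (p.take (2 ^ i)) + walkWeight w (p.drop (2 ^ i)) = walkWeight w p := by
      rw [← walkWeight_append, SimpleGraph.Walk.append_take_drop_eq]
    refine (iInf_le _ (p.getVert (2 ^ i))).trans ?_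
    rw [← hw, Nat.cast_add]
    have htr' : ∀ {u v : Fin n} (q : G.Walk u v), walkWeight w q ≤ B → ∀ d : ℕ∞,
        d ≤ walkWeight w q → truncAbove B d ≤ walkWeight w q := by
      intro u v q hq d hd
      unfold truncAbove
      rwa [if_pos (hd.trans (by exact_mod_cast hq))]
    refine add_le_add (ih _ ?_ (by omega) (htr' _ (by omega)))
      (ih _ ?_ (by omega) (htr' _ (by omega)))
    · rw [SimpleGraph.Walk.take_length]
      exact min_le_left _ _
    · rw [SimpleGraph.Walk.drop_length]
      rw [pow_succ] at hl
      omega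

theorem truncSquaring_eq {n B i : ℕ} (G : SimpleGraph (Fin n)) (w : Sym2 (Fin n) → ℕ)
    (hi : n ≤ 2 ^ i) (u v : Fin n) :
    truncSquaring B (weightedAdjMatrix G w) i u v = truncAbove B (weightedDist G w u v) := by
  have hle := weightedDist_le_truncSquaring (B := B) G w i u v
  by_cases h : weightedDist G w u v ≤ B
  · obtain ⟨p, hp, hpw⟩ := exists_path_of_weightedDist_ne_top
      (ne_top_of_le_ne_top (ENat.natCast_ne_top B) h)
    have hlen := hp.length_lt
    rw [Fintype.card_fin] at hlen
    rw [truncAbove, if_pos h]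
    refine le_antisymm ?_ hle
    rw [← hpw] at h ⊢
    exact truncSquaring_le G w i p (by omega) (by exact_mod_cast h)
  · rw [truncAbove, if_neg h]
    rcases truncSquaring_eq_top_or_le (B := B) (weightedAdjMatrix G w) i u v with h' | h'
    · exact h'
    · exact absurd (hle.trans h') h

theorem MonomialMulIn.truncSquaring {n p k T B : ℕ} (h : MonomialMulIn n p k T) (hp : p.Prime)
    (hnp : n < p) (hB : 2 * B < k) {Ω : Type} (κ : Knowledge n Ω)
    (A : Ω → Fin n → Fin n → ℕ∞) (hA : ∀ u v, Knows (κ u) (fun ω => A ω u v)) (i : ℕ) :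
    ∃ κ', Reach (i * T) κ κ' ∧
      ∀ u v, Knows (κ' u) (fun ω => _root_.truncSquaring B (A ω) i u v) := by
  induction i with
  | zero =>
    refine ⟨κ, by simpa using Reach.refl κ, fun u v => ?_⟩
    exact (hA u v).map fun d => truncAbove B (if u = v then 0 else d)
  | succ i ih =>
    obtain ⟨κ₁, r₁, h₁⟩ := ih
    obtain ⟨κ₂, r₂, h₂⟩ := h.minPlus hp hnp hB κ₁ (fun ω => _root_.truncSquaring B (A ω) i)
      (fun ω => _root_.truncSquaring B (A ω) i) h₁ h₁
      (fun ω => truncSquaring_eq_top_or_le (A ω) i) (fun ω => truncSquaring_eq_top_or_le (A ω) i)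
    exact ⟨κ₂, by simpa [add_mul] using r₁.trans r₂, fun u v => (h₂ u v).map (truncAbove B)⟩

/-! ### Distances from truncated distances -/

/-- The value `d - S`, clipped to the interval from `-m` to `m` and shifted by `m`; values above `m`
are replaced by `∞`. -/
noncomputable def clipAt (m S : ℕ) (d : ℕ∞) : ℕ∞ := if d ≤ (S + m : ℕ) then d + m - S else ⊤

theorem clipAt_natCast (m S d : ℕ) :
    clipAt m S d = if d ≤ S + m then ((d + m - S : ℕ) : ℕ∞) else ⊤ := by
  simp [clipAt, ← Nat.cast_add]

theorem clipAt_top (m S : ℕ) : clipAt m S ⊤ = ⊤ := by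
  simp [clipAt]

theorem exists_of_clipAt_eq {m S : ℕ} {d : ℕ∞} {y : ℕ} (h : clipAt m S d = y) :
    ∃ e : ℕ, d = e ∧ e ≤ S + m ∧ y = e + m - S := by
  induction d using ENat.recTopCoe with
  | top => simp [clipAt_top] at h
  | coe e =>
    rw [clipAt_natCast] at h
    split_ifs at h with h1
    · exact ⟨e, rfl, h1, by exact_mod_cast h.symm⟩
    · simp at h

theorem clipAt_eq_top_or_le (m S : ℕ) (d : ℕ∞) : clipAt m S d = ⊤ ∨ clipAt m S d ≤ (2 * m : ℕ) := by
  induction d using ENat.recTopCoe with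
  | top => simp [clipAt_top]
  | coe e =>
    rw [clipAt_natCast]
    split_ifs with h
    · right
      norm_cast
      omega
    · simp

/-- Shifting back and clipping sums of two clipped values. -/
noncomputable def clipSum (m : ℕ) (P : ℕ∞) : ℕ∞ := if P ≤ (3 * m : ℕ) then P - m else ⊤

theorem clipSum_top (m : ℕ) : clipSum m ⊤ = ⊤ := if_neg (by simpa using ENat.natCast_ne_top (3 * m))

/-- Each summand carries a shift by `m`, so `P` stands for `d - T + 2 * m`. Clipping from below can
only increase the factors, so the lower bound always holds; above it, `P` must be exact only when
`d` lies in the window, and below the window `P ≤ m` is enough since subtraction is truncated. -/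
theorem clipSum_eq_clipAt {m d T : ℕ} {P : ℕ∞} (hlow : ((d + 2 * m : ℕ) : ℕ∞) ≤ P + T)
    (hup : d ≤ T + m → P ≤ (max (d + 2 * m - T) m : ℕ)) : clipSum m P = clipAt m T d := by
  induction P using ENat.recTopCoe with
  | top =>
    rw [clipAt_natCast, if_neg (fun h => absurd (hup h) (by simp))]
    simp [clipSum]
  | coe P =>
    rw [clipAt_natCast]
    norm_cast at hlow hup
    unfold clipSum
    norm_cast
    split_ifs with h1 h2 h2
    · congr 1
      have := hup h2
      omega
    · omega
    · have := hup h2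
      omega
    · rfl

theorem exists_minPlus_eq {n : ℕ} (X Y : Fin n → Fin n → ℕ∞) (u v : Fin n) :
    ∃ x, minPlus X Y u v = X u x + Y x v := by
  have : Nonempty (Fin n) := ⟨u⟩
  obtain ⟨x, hx⟩ := ENat.exists_eq_iInf fun x => X u x + Y x v
  exact ⟨x, hx.symm⟩

theorem exists_natCast_of_minPlus_ne_top {n : ℕ} {X Y : Fin n → Fin n → ℕ∞} {u v : Fin n}
    (h : minPlus X Y u v ≠ ⊤) :
    ∃ (x : Fin n) (a b : ℕ), X u x = a ∧ Y x v = b ∧ minPlus X Y u v = (a + b : ℕ) := by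
  obtain ⟨x, hx⟩ := exists_minPlus_eq X Y u v
  rw [hx, Ne, ENat.add_eq_top, not_or] at h
  obtain ⟨a, ha⟩ := ENat.ne_top_iff_exists.1 h.1
  obtain ⟨b, hb⟩ := ENat.ne_top_iff_exists.1 h.2
  exact ⟨x, a, b, ha.symm, hb.symm, by rw [hx, ← ha, ← hb, Nat.cast_add]⟩

theorem minPlus_le_natCast {n : ℕ} {X Y : Fin n → Fin n → ℕ∞} {u x v : Fin n} {a b c : ℕ}
    (ha : X u x = a) (hb : Y x v = b) (h : a + b ≤ c) : minPlus X Y u v ≤ c := by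
  refine (iInf_le _ x).trans ?_
  rw [ha, hb]
  exact_mod_cast h

namespace IsStepMetric

variable {n : ℕ} {D : Fin n → Fin n → ℕ∞} {M : ℕ}

theorem natCast_triangle {V : Type*} {D : V → V → ℕ∞} {M : ℕ} (h : IsStepMetric D M)
    {u x v : V} {d a b : ℕ} (hd : D u v = d) (ha : D u x = a) (hb : D x v = b) :
    d ≤ a + b := by
  have := h.triangle u x v
  rw [hd, ha, hb] at this
  exact_mod_cast this

theorem minPlus_eq_top_of_eq_top {V : Type*} {D : V → V → ℕ∞} {M : ℕ} (h : IsStepMetric D M)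
    {u x v : V} {a b : ℕ} (hd : D u v = ⊤) (ha : D u x = a) (hb : D x v = b) : False := by
  have := h.triangle u x v
  rw [hd, ha, hb] at this
  simp [← Nat.cast_add] at this

/-- The distances around `2 * S` from those around `S`. -/
theorem clipSum_minPlus_clipAt (h : IsStepMetric D M) {S : ℕ} (hS : 2 * M ≤ S)
    (u v : Fin n) :
    clipSum (2 * M) (minPlus (fun u v => clipAt (2 * M) S (D u v))
      (fun u v => clipAt (2 * M) S (D u v)) u v) = clipAt (2 * M) (2 * S) (D u v) := by
  set P := minPlus (fun u v => clipAt (2 * M) S (D u v))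
      (fun u v => clipAt (2 * M) S (D u v)) u v with hP
  have hfin : P ≠ ⊤ → ∃ (x : Fin n) (a b : ℕ), D u x = a ∧ D x v = b ∧
      P = ((a + 2 * M - S) + (b + 2 * M - S) : ℕ) := by
    intro hne
    obtain ⟨x, a, b, ha, hb, hab⟩ := exists_natCast_of_minPlus_ne_top hne
    obtain ⟨a', ha', _, rfl⟩ := exists_of_clipAt_eq ha
    obtain ⟨b', hb', _, rfl⟩ := exists_of_clipAt_eq hb
    exact ⟨x, a', b', ha', hb', hab⟩
  by_cases hd : D u v = ⊤
  · have : P = ⊤ := by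
      by_contra hne
      obtain ⟨x, a, b, ha, hb, -⟩ := hfin hne
      exact h.minPlus_eq_top_of_eq_top hd ha hb
    rw [this, hd, clipAt_top, clipSum_top]
  obtain ⟨d, hd⟩ := ENat.ne_top_iff_exists.1 hd
  rw [← hd]
  replace hd := hd.symm
  refine clipSum_eq_clipAt ?_ fun hle => ?_
  · by_cases hne : P = ⊤
    · simp [hne]
    obtain ⟨x, a, b, ha, hb, hab⟩ := hfin hne
    have := h.natCast_triangle hd ha hb
    rw [hab]
    norm_cast
    omega
  -- A vertex near the middle puts both halves at most `S + 2 * M` if `d ≤ 2 * S + 2 * M`. For `d ≤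
  -- S` the vertex `v` itself serves: its distance zero is clipped to the bottom of the window
  -- because `2 * M ≤ S`.
  · obtain ⟨x, a, b, ha, hb, hab, h1, h2⟩ := h.split u v d (d / 2) hd (by omega)
    by_cases hdS : d ≤ S
    · refine minPlus_le_natCast (x := v) (a := d + 2 * M - S) (b := 0) ?_ ?_ ?_
      · simp only [hd, clipAt_natCast]
        rw [if_pos (by omega)]
      · have h0 : (0 : ℕ∞) = ((0 : ℕ) : ℕ∞) := rfl
        simp only [h.self]
        rw [h0, clipAt_natCast, if_pos (by omega)]
        congr 1
        omega
      · omega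
    · refine minPlus_le_natCast (x := x) (a := a + 2 * M - S) (b := b + 2 * M - S) ?_ ?_ ?_
      · simp only [ha, clipAt_natCast]
        rw [if_pos (by omega)]
      · simp only [hb, clipAt_natCast]
        rw [if_pos (by omega)]
      · omega

end IsStepMetric

/-! ### Refining approximate distances from scale `2 * S` to scale `S` -/

/-- The value `d`, where all values that differ by at least `m` from the multiples of `S` are
identified with the next value below that does so. -/
def snapNat (m S d : ℕ) : ℕ := if S < d % S + m then d else d / S * S + min (d % S) m

theorem snapNat_eq {m S q r : ℕ} (hr : r < S) :
    snapNat m S (q * S + r) = if S < r + m then q * S + r else q * S + min r m := by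
  have h1 : (q * S + r) % S = r := by
    rw [Nat.mul_add_mod_of_lt hr]
  have h2 : (q * S + r) / S = q := by
    rw [mul_comm, Nat.mul_add_div (by omega), Nat.div_eq_of_lt hr, add_zero]
  rw [snapNat, h1, h2]

theorem exists_mul_add {S : ℕ} (hS : 0 < S) (d : ℕ) : ∃ q r, r < S ∧ d = q * S + r :=
  ⟨d / S, d % S, Nat.mod_lt d hS, (Nat.div_add_mod' d S).symm⟩

theorem snapNat_self {m : ℕ} (hm : 0 < m) (d : ℕ) : snapNat m m d = d := by
  obtain ⟨q, r, hr, rfl⟩ := exists_mul_add hm d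
  rw [snapNat_eq hr]
  split_ifs with h
  · rfl
  · congr 1
    omega

/-- The shifted difference of `f` and an `S`-multiple with the given parity of the factor that is
at a distance less than `m`, if any. -/
noncomputable def nearMultiple (m S c : ℕ) (f : ℕ) : ℕ∞ :=
  if f % S < m ∧ f / S % 2 = c then (f % S + m : ℕ)
  else if S < f % S + m ∧ (f / S + 1) % 2 = c then (f % S + m - S : ℕ) else ⊤

/-- Snapping changes only values at distance more than `m` above the multiple of `S` below them and
at least `m` below the next. These, and the values onto which they are snapped, are not near any
multiple in the strict sense `0 < y < 2 * m`, so nothing is lost. -/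
theorem nearMultiple_snapNat {m S c d y : ℕ} (hm : 0 < m) (hS : 2 * m ≤ S) :
    nearMultiple m S c (snapNat m S d) = y ↔
      ∃ j, j % 2 = c ∧ d + m = j * S + y ∧ 0 < y ∧ y < 2 * m := by
  obtain ⟨q, r, hr, rfl⟩ := exists_mul_add (show 0 < S by omega) d
  have hdm : ∀ r < S, (q * S + r) % S = r ∧ (q * S + r) / S = q := fun r hr =>
    ⟨Nat.mul_add_mod_of_lt hr, by
      rw [mul_comm, Nat.mul_add_div (by omega), Nat.div_eq_of_lt hr, add_zero]⟩
  have key : ∀ j, q * S + r + m = j * S + y → 0 < y → y < 2 * m →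
      (r < m ∧ j = q ∧ y = r + m) ∨ (S < r + m ∧ j = q + 1 ∧ y + S = r + m) := by
    intro j hj h0 h1
    rcases lt_trichotomy j q with hjq | rfl | hjq
    · exfalso
      have : (j + 1) * S ≤ q * S := Nat.mul_le_mul_right S hjq
      rw [add_mul] at this
      omega
    · left
      refine ⟨?_, rfl, ?_⟩ <;> omega
    · obtain ⟨i, rfl⟩ : ∃ i, j = q + 1 + i := ⟨j - (q + 1), by omega⟩
      rcases Nat.eq_zero_or_pos i with rfl | hi
      · right
        rw [add_zero, add_mul] at hj
        refine ⟨?_, rfl, ?_⟩ <;> omega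
      · exfalso
        have : S ≤ i * S := Nat.le_mul_of_pos_left S hi
        rw [add_mul, add_mul] at hj
        omega
  rw [snapNat_eq hr]
  constructor
  · intro h
    have h2 : ∃ r', r' < S ∧ (if S < r + m then q * S + r else q * S + min r m) = q * S + r' ∧
        (r' < m → r = r') ∧ (S < r' + m → r = r') := by
      split_ifs with h1
      · exact ⟨r, hr, rfl, fun _ => rfl, fun _ => rfl⟩
      · exact ⟨min r m, by omega, rfl, by omega, by omega⟩
    obtain ⟨r', hr', he, e1, e2⟩ := h2
    rw [he, nearMultiple, (hdm r' hr').1, (hdm r' hr').2] at h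
    split_ifs at h with h3 h4
    · have hy : r' + m = y := by exact_mod_cast h
      have := e1 h3.1
      exact ⟨q, h3.2, by omega, by omega, by omega⟩
    · have hy : r' + m - S = y := by exact_mod_cast h
      have := e2 h4.1
      refine ⟨q + 1, h4.2, ?_, by omega, by omega⟩
      rw [add_mul]
      omega
    · simp at h
  · rintro ⟨j, hj, hjd, h0, h1⟩
    rcases key j hjd h0 h1 with ⟨h2, rfl, h3⟩ | ⟨h2, rfl, h3⟩
    · rw [if_neg (by omega), min_eq_left h2.le, nearMultiple, (hdm r hr).1, (hdm r hr).2,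
        if_pos ⟨h2, hj⟩, h3]
    · rw [if_pos h2, nearMultiple, (hdm r hr).1, (hdm r hr).2, if_neg (by omega), if_pos ⟨h2, hj⟩]
      congr 1
      omega

theorem nearMultiple_eq_top_or_le (m c f : ℕ) {S : ℕ} (hS : 0 < S) :
    nearMultiple m S c f = ⊤ ∨ nearMultiple m S c f ≤ (2 * m : ℕ) := by
  unfold nearMultiple
  split_ifs with h1 h2
  · right
    norm_cast
    omega
  · right
    have := Nat.mod_lt f hS
    norm_cast
    omega
  · simp

/-- The extension of a function on the natural numbers by `∞`. -/
noncomputable def extendTop (f : ℕ → ℕ∞) (d : ℕ∞) : ℕ∞ := if d = ⊤ then ⊤ else f d.toNat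

@[simp] theorem extendTop_top (f : ℕ → ℕ∞) : extendTop f ⊤ = ⊤ := by simp [extendTop]

@[simp] theorem extendTop_natCast (f : ℕ → ℕ∞) (d : ℕ) : extendTop f d = f d := by
  simp [extendTop]

/-- The extension of `snapNat` by `∞`. -/
noncomputable def snap (m S : ℕ) : ℕ∞ → ℕ∞ := extendTop fun d => (snapNat m S d : ℕ∞)

/-- The computation of `snapNat m S d` from the values that are available. -/
noncomputable def refineSnap (m S : ℕ) (f : ℕ∞) (P : ℕ → ℕ∞) : ℕ∞ :=
  extendTop (fun f => if f % (2 * S) = m then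
    let s := f / (2 * S)
    let y := clipSum m (P (s % 2))
    if y = 0 then (s * (2 * S) + m : ℕ)
    else if y < (2 * m : ℕ) then (snapNat m S (s * (2 * S) + S + y.toNat - m) : ℕ)
    else (s * (2 * S) + S + m : ℕ)
  else (snapNat m S f : ℕ)) f

/-- The residues near even or odd multiples of `S`, as far as they can be read off from the values
of `snap m S`. -/
noncomputable def nearMatrix {n : ℕ} (m S c : ℕ) (D : Fin n → Fin n → ℕ∞) (u v : Fin n) : ℕ∞ :=
  extendTop (nearMultiple m S c) (snap m S (D u v))

theorem nearMatrix_eq_iff {n : ℕ} {m S c : ℕ} {D : Fin n → Fin n → ℕ∞} {u v : Fin n} {y : ℕ}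
    (hm : 0 < m) (hS : 2 * m ≤ S) :
    nearMatrix m S c D u v = y ↔ ∃ d j : ℕ, D u v = d ∧ j % 2 = c ∧ d + m = j * S + y ∧
      0 < y ∧ y < 2 * m := by
  unfold nearMatrix snap
  generalize D u v = e
  induction e using ENat.recTopCoe with
  | top => simp
  | coe d =>
    rw [extendTop_natCast, extendTop_natCast, nearMultiple_snapNat hm hS]
    constructor
    · rintro ⟨j, h⟩
      exact ⟨d, j, rfl, h⟩
    · rintro ⟨d', j, h, h'⟩
      have : d = d' := by exact_mod_cast h
      exact ⟨j, this ▸ h'⟩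

namespace IsStepMetric

variable {n : ℕ} {D : Fin n → Fin n → ℕ∞} {M : ℕ}

/-- A path from `u` to `v` is cut near `s * (2 * S)`; the first part is seen as a residue, the
second through the window at `S`. A residue does not show its multiple `j * (2 * S)`, but `|d - D u
x| ≤ D x v ≤ S + 2 * M` excludes all `j` except `s` and `s + 1`, and parity excludes `s + 1`. -/
theorem clipSum_minPlus_nearMatrix (h : IsStepMetric D M) (hM : 1 ≤ M) {S : ℕ} (hS : 2 * M ≤ S)
    {u v : Fin n} {d s : ℕ} (hd : D u v = d) (hd1 : s * (2 * S) + 2 * M ≤ d)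
    (hd2 : d + 2 * M ≤ s * (2 * S) + 2 * S) :
    clipSum (2 * M) (minPlus (nearMatrix (2 * M) (2 * S) (s % 2) D)
      (fun u v => clipAt (2 * M) S (D u v)) u v) = clipAt (2 * M) (s * (2 * S) + S) d := by
  have hS' : 2 * (2 * M) ≤ 2 * S := by omega
  have hm : 0 < 2 * M := by omega
  refine clipSum_eq_clipAt ?_ fun hle => ?_
  · by_cases hne : minPlus (nearMatrix (2 * M) (2 * S) (s % 2) D)
      (fun u v => clipAt (2 * M) S (D u v)) u v = ⊤
    · simp [hne]
    obtain ⟨x, y, b, hy, hb, hyb⟩ := exists_natCast_of_minPlus_ne_top hne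
    obtain ⟨a, j, ha, hj, haj, hy0, hym⟩ := (nearMatrix_eq_iff hm hS').1 hy
    obtain ⟨b', hb', hbS, rfl⟩ := exists_of_clipAt_eq hb
    have t1 := h.natCast_triangle hd ha hb'
    have t2 := h.natCast_triangle ha hd ((h.comm v x).trans hb')
    have hjs : j = s := by
      rcases lt_trichotomy j s with hlt | rfl | hlt
      · exfalso
        have : (j + 1) * (2 * S) ≤ s * (2 * S) := Nat.mul_le_mul_right _ hlt
        rw [add_mul] at this
        omega
      · rfl
      · exfalso
        have : (s + 2) * (2 * S) ≤ j * (2 * S) := Nat.mul_le_mul_right _ (by omega)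
        rw [add_mul] at this
        omega
    subst hjs
    rw [hyb]
    norm_cast
    omega
  -- In the lower half the cut is at or below the multiple: if the second part is clipped from
  -- below, the sum is still at most `2 * M`. In the upper half the cut is above the multiple, which
  -- keeps the second part inside its window.
  · rcases le_or_gt d (s * (2 * S) + S) with hcase | hcase
    · obtain ⟨x, a, b, ha, hb, hab, h1, h2⟩ := h.split u v d (s * (2 * S)) hd (by omega)
      refine minPlus_le_natCast (x := x) (a := a + 2 * M - s * (2 * S)) (b := b + 2 * M - S)
        ((nearMatrix_eq_iff hm hS').2 ⟨a, s, ha, rfl, by omega, by omega, by omega⟩) ?_ (by omega)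
      simp only [hb, clipAt_natCast]
      rw [if_pos (by omega)]
    · obtain ⟨x, a, b, ha, hb, hab, h1, h2⟩ := h.split u v d (s * (2 * S) + M) hd (by omega)
      refine minPlus_le_natCast (x := x) (a := a + 2 * M - s * (2 * S)) (b := b + 2 * M - S)
        ((nearMatrix_eq_iff hm hS').2 ⟨a, s, ha, rfl, by omega, by omega, by omega⟩) ?_ (by omega)
      simp only [hb, clipAt_natCast]
      rw [if_pos (by omega)]

/-- Unless its residue is `2 * M`, a value of the coarse approximation is the exact distance.
Otherwise only the multiple of `2 * S` below is known, and the product decides whether the distance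
is below, inside or above the window around the odd multiple of `S` in between; inside, it recovers
the distance exactly. -/
theorem snap_eq_refineSnap (h : IsStepMetric D M) (hM : 1 ≤ M) {S : ℕ} (hS : 2 * M ≤ S)
    (u v : Fin n) :
    snap (2 * M) S (D u v) = refineSnap (2 * M) S (snap (2 * M) (2 * S) (D u v))
      (fun c => minPlus (nearMatrix (2 * M) (2 * S) c D)
        (fun u v => clipAt (2 * M) S (D u v)) u v) := by
  by_cases hd : D u v = ⊤
  · simp [hd, snap, refineSnap]
  obtain ⟨d, hd⟩ := ENat.ne_top_iff_exists.1 hd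
  replace hd := hd.symm
  simp only [hd, snap, refineSnap, extendTop_natCast]
  have hs := h.clipSum_minPlus_nearMatrix hM hS (s := d / (2 * S)) hd
  obtain ⟨q, r, hr, rfl⟩ := exists_mul_add (show 0 < 2 * S by omega) d
  have hdm : ∀ r < 2 * S, (q * (2 * S) + r) % (2 * S) = r ∧ (q * (2 * S) + r) / (2 * S) = q :=
    fun r hr => ⟨Nat.mul_add_mod_of_lt hr, by
      rw [mul_comm, Nat.mul_add_div (by omega), Nat.div_eq_of_lt hr, add_zero]⟩
  rw [(hdm r hr).2] at hs
  rw [snapNat_eq hr]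
  by_cases h1 : 2 * S < r + 2 * M
  · rw [if_pos h1, if_neg]
    rw [(hdm r hr).1]
    omega
  rw [if_neg h1]
  by_cases h2 : r < 2 * M
  · rw [min_eq_left h2.le, if_neg]
    rw [(hdm r hr).1]
    omega
  rw [min_eq_right (by omega), if_pos (hdm _ (by omega)).1, (hdm _ (by omega)).2,
    hs (by omega) (by omega), clipAt_natCast]
  have hq2 : q * (2 * S) = 2 * q * S := by ring
  by_cases h3 : r ≤ S + 2 * M
  · have hc : (if q * (2 * S) + r ≤ q * (2 * S) + S + 2 * M then
        ((q * (2 * S) + r + 2 * M - (q * (2 * S) + S) : ℕ) : ℕ∞) else ⊤) =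
        (r + 2 * M - S : ℕ) := by
      rw [if_pos (by omega)]
      congr 1
      omega
    rw [hc, hq2]
    norm_cast
    by_cases h4 : r + 2 * M ≤ S
    · rw [if_pos (by omega), snapNat_eq (by omega)]
      split_ifs <;> omega
    · rw [if_neg (by omega)]
      by_cases h5 : r < S + 2 * M
      · rw [if_pos (by omega)]
        rw [ENat.toNat_natCast]
        congr 1
        omega
      · rw [if_neg (by omega)]
        have : 2 * q * S + r = (2 * q + 1) * S + 2 * M := by
          rw [add_mul (2 * q)]
          omega
        rw [this]
        by_cases h6 : 2 * M < S
        · rw [snapNat_eq h6, add_mul (2 * q)]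
          split_ifs <;> omega
        · have h7 : 2 * M = S := by omega
          rw [h7, snapNat_self (by omega), add_mul (2 * q)]
          omega
  · have hc : (if q * (2 * S) + r ≤ q * (2 * S) + S + 2 * M then
        ((q * (2 * S) + r + 2 * M - (q * (2 * S) + S) : ℕ) : ℕ∞) else ⊤) = ⊤ :=
      if_neg (by omega)
    rw [hc, if_neg (by simp), if_neg (by simp), hq2]
    have : 2 * q * S + r = (2 * q + 1) * S + (r - S) := by
      rw [add_mul (2 * q)]
      omega
    rw [this, snapNat_eq (by omega), if_neg (by omega), min_eq_right (by omega),
      add_mul (2 * q), one_mul]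

end IsStepMetric

/-- The start of the doubling: the lowest window is centred at `m` itself and contains all values up
to `2 * m`, which repeated squaring provides. -/
theorem clipAt_self (m : ℕ) (d : ℕ∞) : clipAt m m d = truncAbove (2 * m) d := by
  unfold clipAt truncAbove
  rw [← two_mul]
  split_ifs with h
  · obtain ⟨e, rfl⟩ := ENat.ne_top_iff_exists.1 (ne_top_of_le_ne_top (ENat.natCast_ne_top _) h)
    norm_cast
    omega
  · rfl

/-- The end of the refinement: at scale `m` every value lies within `m` of a multiple, so the
approximation is exact. -/
theorem snap_self {m : ℕ} (hm : 0 < m) (d : ℕ∞) : snap m m d = d := by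
  induction d using ENat.recTopCoe with
  | top => simp [snap]
  | coe d => simp [snap, snapNat_self hm]

/-- The coarsest approximation of the distances. -/
theorem snap_eq_of_le {m S N : ℕ} (hm : 0 < m) (hS : N + m ≤ S) {d : ℕ∞} (hd : d ≠ ⊤ → d ≤ N) :
    snap m S d = if clipAt m S d = ⊤ then ⊤ else min (truncAbove (2 * m) d) m := by
  induction d using ENat.recTopCoe with
  | top => simp [snap, clipAt_top]
  | coe d =>
    have hdN : d ≤ N := by exact_mod_cast hd (ENat.natCast_ne_top d)
    rw [clipAt_natCast, if_pos (by omega : d ≤ S + m), if_neg (ENat.natCast_ne_top _), snap,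
      extendTop_natCast]
    have h0 : d = 0 * S + d := by simp
    rw [h0, snapNat_eq (by omega), if_neg (by omega), ← h0, zero_mul, zero_add]
    unfold truncAbove
    split_ifs with h
    · norm_cast
    · norm_cast at h
      rw [min_eq_right (by omega), min_eq_right le_top]

/-- The distances can be computed by `O(log n)` products of matrices of monomials. -/
theorem MonomialMulIn.weightedDist {n p T M : ℕ} (h : MonomialMulIn n p (8 * M + 1) T)
    (hp : p.Prime) (hnp : n < p) (hM : 1 ≤ M) {Ω : Type} (κ : Knowledge n Ω)
    (G : Ω → SimpleGraph (Fin n)) (w : Ω → Sym2 (Fin n) → ℕ)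
    (hw : ∀ ω, ∀ e ∈ (G ω).edgeSet, w ω e ≤ M)
    (hA : ∀ u v, Knows (κ u) (fun ω => weightedAdjMatrix (G ω) (w ω) u v)) :
    ∃ κ', Reach (4 * (Nat.log 2 n + 1) * T) κ κ' ∧
      ∀ u v, Knows (κ' u) (fun ω => _root_.weightedDist (G ω) (w ω) u v) := by
  set l := Nat.log 2 n + 1 with hl
  have hnl : n + 1 ≤ 2 ^ l := Nat.lt_pow_succ_log_self (by norm_num) n
  let D (ω : Ω) : Fin n → Fin n → ℕ∞ := _root_.weightedDist (G ω) (w ω)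
  have hD : ∀ ω, IsStepMetric (D ω) M := fun ω => isStepMetric_weightedDist hM (hw ω)
  have hS : ∀ i, 2 * M ≤ 2 ^ i * (2 * M) := fun i => Nat.le_mul_of_pos_left _ (by positivity)
  -- Windows have radius `2 * M`, so all shifted entries are at most `4 * M` and exponents in
  -- products at most `8 * M`. This explains the degree bound `8 * M + 1`.
  have hB : 2 * (2 * (2 * M)) < 8 * M + 1 := by omega
  obtain ⟨κ₁, r₁, h₁⟩ := h.truncSquaring hp hnp (B := 2 * (2 * M)) hB κ _ hA l
  replace h₁ : ∀ u v, Knows (κ₁ u) (fun ω => truncAbove (2 * (2 * M)) (D ω u v)) :=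
    fun u v => (h₁ u v).of_eq id fun ω => (truncSquaring_eq _ _ (by omega) u v).symm
  have hclip : ∀ i, ∃ κ', Reach (i * T) κ₁ κ' ∧ ∀ j ≤ i, ∀ u v,
      Knows (κ' u) (fun ω => clipAt (2 * M) (2 ^ j * (2 * M)) (D ω u v)) := by
    intro i
    induction i with
    | zero =>
      refine ⟨κ₁, by simpa using Reach.refl κ₁, fun j hj u v => ?_⟩
      obtain rfl : j = 0 := by omega
      simpa [clipAt_self] using h₁ u v
    | succ i ih =>
      obtain ⟨κ₂, r₂, h₂⟩ := ih
      obtain ⟨κ₃, r₃, h₃⟩ := h.minPlus hp hnp (B := 2 * (2 * M)) hB κ₂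
        (fun ω u v => clipAt (2 * M) (2 ^ i * (2 * M)) (D ω u v))
        (fun ω u v => clipAt (2 * M) (2 ^ i * (2 * M)) (D ω u v)) (h₂ i le_rfl) (h₂ i le_rfl)
        (fun _ _ _ => clipAt_eq_top_or_le _ _ _) (fun _ _ _ => clipAt_eq_top_or_le _ _ _)
      refine ⟨κ₃, by simpa [add_mul] using r₂.trans r₃, fun j hj u v => ?_⟩
      rcases Nat.le_succ_iff.1 hj with hj | rfl
      · exact r₃.knows (h₂ j hj u v)
      · refine (h₃ u v).of_eq (clipSum (2 * M)) fun ω => ?_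
        rw [(hD ω).clipSum_minPlus_clipAt (hS i) u v]
        congr 1
        rw [Nat.succ_eq_add_one, pow_succ]
        ring
  obtain ⟨κ₂, r₂, h₂⟩ := hclip l
  have hsnap : ∀ i ≤ l, ∃ κ', Reach (2 * i * T) κ₂ κ' ∧ ∀ u v,
      Knows (κ' u) (fun ω => snap (2 * M) (2 ^ (l - i) * (2 * M)) (D ω u v)) := by
    intro i
    induction i with
    | zero =>
      intro _
      refine ⟨κ₂, by simpa using Reach.refl κ₂, fun u v => ?_⟩
      -- The top scale exceeds `n * M + 2 * M`, hence every finite distance. There the window only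
      -- tells whether the distance is finite, and the truncated distance gives its value below `2 *
      -- M`.
      refine ((h₂ l le_rfl u v).map₂ (r₂.knows (h₁ u v))
        (fun a b => if a = ⊤ then ⊤ else min b ((2 * M : ℕ) : ℕ∞))).of_eq id fun ω => ?_
      refine snap_eq_of_le (N := n * M) (by omega) ?_ (weightedDist_le_mul (hw ω))
      calc n * M + 2 * M ≤ (n + 1) * (2 * M) := by nlinarith
        _ ≤ _ := Nat.mul_le_mul_right _ hnl
    | succ i ih =>
      intro hi
      obtain ⟨κ₃, r₃, h₃⟩ := ih (by omega)
      have h2S : 2 ^ (l - i) * (2 * M) = 2 * (2 ^ (l - (i + 1)) * (2 * M)) := by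
        have : l - i = l - (i + 1) + 1 := by omega
        rw [this]
        ring
      rw [h2S] at h₃
      set S := 2 ^ (l - (i + 1)) * (2 * M) with hSdef
      have hS' : 2 * M ≤ S := hS _
      have hnear : ∀ c u v, Knows (κ₃ u) (fun ω => nearMatrix (2 * M) (2 * S) c (D ω) u v) :=
        fun c u v => (h₃ u v).map (extendTop (nearMultiple (2 * M) (2 * S) c))
      have hnearB : ∀ c ω u v, nearMatrix (2 * M) (2 * S) c (D ω) u v = ⊤ ∨
          nearMatrix (2 * M) (2 * S) c (D ω) u v ≤ (2 * (2 * M) : ℕ) := by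
        intro c ω u v
        unfold nearMatrix extendTop
        split_ifs
        · exact .inl rfl
        · exact nearMultiple_eq_top_or_le _ _ _ (by omega)
      have hclipS : ∀ u v, Knows (κ₃ u) (fun ω => clipAt (2 * M) S (D ω u v)) :=
        fun u v => r₃.knows (h₂ _ (by omega) u v)
      -- One product for each parity of the coarse multiple, since the parity depends on the pair
      -- `u`, `v`.
      obtain ⟨κ₄, r₄, h₄⟩ := h.minPlus hp hnp (B := 2 * (2 * M)) hB κ₃
        (fun ω => nearMatrix (2 * M) (2 * S) 0 (D ω)) (fun ω u v => clipAt (2 * M) S (D ω u v))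
        (hnear 0) hclipS (hnearB 0) (fun _ _ _ => clipAt_eq_top_or_le _ _ _)
      obtain ⟨κ₅, r₅, h₅⟩ := h.minPlus hp hnp (B := 2 * (2 * M)) hB κ₄
        (fun ω => nearMatrix (2 * M) (2 * S) 1 (D ω)) (fun ω u v => clipAt (2 * M) S (D ω u v))
        (fun u v => r₄.knows (hnear 1 u v)) (fun u v => r₄.knows (hclipS u v)) (hnearB 1)
        (fun _ _ _ => clipAt_eq_top_or_le _ _ _)
      refine ⟨κ₅, Reach.mono (le_of_eq (by ring)) ((r₃.trans r₄).trans r₅), fun u v => ?_⟩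
      refine (((r₄.trans r₅).knows (h₃ u v)).map₂ ((r₅.knows (h₄ u v)).map₂ (h₅ u v) Prod.mk)
        (fun f P => refineSnap (2 * M) S f (fun c => if c = 0 then P.1 else P.2))).of_eq id
        fun ω => ?_
      rw [(hD ω).snap_eq_refineSnap hM hS' u v]
      simp only [refineSnap, id]
      congr 1
      funext f
      rcases Nat.mod_two_eq_zero_or_one (f / (2 * S)) with h0 | h0 <;> simp [h0]
  obtain ⟨κ₃, r₃, h₃⟩ := hsnap l le_rfl
  refine ⟨κ₃, Reach.mono (le_of_eq (by ring)) ((r₁.trans r₂).trans r₃), fun u v => ?_⟩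
  refine (h₃ u v).of_eq id fun ω => ?_
  simp [D, snap_self (show 0 < 2 * M by omega)]

/-! ### Almost pairwise independent families of sets -/

open Polynomial in
/-- The polynomial whose coefficients are the `k` lowest binary digits of a number. -/
noncomputable def bitPolynomial (R : Type*) [Semiring R] (k x : ℕ) : R[X] :=
  ∑ i ∈ Finset.range k, monomial i (if x.testBit i then 1 else 0)

open Polynomial in
-- The two polynomials differ in some binary digit, so their difference is nonzero of degree at most
-- `k`. Thus most evaluation points hash `x` and `y` to different elements of the field.
theorem card_eval_bitPolynomial_eq_le {q k x y : ℕ} [Fact q.Prime] (hx : x < 2 ^ k)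
    (hy : y < 2 ^ k) (hxy : x ≠ y) :
    (Finset.univ.filter fun a : ZMod q =>
      (bitPolynomial (ZMod q) k x).eval a = (bitPolynomial (ZMod q) k y).eval a).card ≤ k := by
  classical
  have hcoeff : ∀ (z i : ℕ), (bitPolynomial (ZMod q) k z).coeff i =
      if i < k ∧ z.testBit i then 1 else 0 := by
    intro z i
    simp only [bitPolynomial, finsetSum_coeff, coeff_monomial]
    rw [Finset.sum_ite_eq']
    simp only [Finset.mem_range, ite_and]
  have hne : bitPolynomial (ZMod q) k x - bitPolynomial (ZMod q) k y ≠ 0 := by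
    intro h
    apply hxy
    refine Nat.eq_of_testBit_eq fun i => ?_
    by_cases hi : i < k
    · have := congrArg (fun f => f.coeff i) (sub_eq_zero.1 h)
      simp only [hcoeff, hi, true_and] at this
      cases hbx : x.testBit i <;> cases hby : y.testBit i <;> simp [hbx, hby] at this ⊢
    · rw [Nat.testBit_lt_two_pow (hx.trans_le (Nat.pow_le_pow_right (by omega) (by omega))),
        Nat.testBit_lt_two_pow (hy.trans_le (Nat.pow_le_pow_right (by omega) (by omega)))]
  have hdeg : (bitPolynomial (ZMod q) k x - bitPolynomial (ZMod q) k y).natDegree ≤ k := by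
    refine natDegree_le_iff_coeff_eq_zero.2 fun i hi => ?_
    rw [coeff_sub, hcoeff, hcoeff, if_neg (by omega), if_neg (by omega), sub_zero]
  refine le_trans ?_ ((card_roots' _).trans hdeg)
  refine le_trans (Finset.card_le_card fun a ha => ?_) (Multiset.toFinset_card_le _)
  rw [Multiset.mem_toFinset, mem_roots hne, IsRoot, eval_sub, sub_eq_zero]
  simpa using ha

theorem card_filter_prod_eq_sum {A B : Type*} [Fintype A] [Fintype B] (p : A × B → Prop)
    [DecidablePred p] [∀ a, DecidablePred fun b => p (a, b)] :
    (Finset.univ.filter p).card = ∑ a, (Finset.univ.filter fun b => p (a, b)).card := by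
  rw [Finset.card_filter, Fintype.sum_prod_type]
  refine Finset.sum_congr rfl fun a _ => ?_
  rw [Finset.card_filter]
theorem card_filter_equiv {A B : Type*} [Fintype A] [Fintype B] (e : A ≃ B) (p : B → Prop)
    [DecidablePred p] [DecidablePred fun a => p (e a)] :
    (Finset.univ.filter fun a => p (e a)).card = (Finset.univ.filter p).card :=
  Finset.card_bij (fun i _ => e i) (by simp) (fun _ _ _ _ h => e.injective h)
    fun b hb => ⟨e.symm b, by simpa using hb, by simp⟩

/-- A family of sets in which each point lies with frequency `h` and each pair of points with
frequency at most `g`. -/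
structure IsSamplingFamily {ι V : Type*} [Fintype ι] [DecidableEq V] (P : ι → Finset V) (h g : ℝ) :
    Prop where
  single : ∀ x, ((Finset.univ.filter fun i => x ∈ P i).card : ℝ) = h * Fintype.card ι
  pair : ∀ x y, x ≠ y → ((Finset.univ.filter fun i => x ∈ P i ∧ y ∈ P i).card : ℝ) ≤
    g * Fintype.card ι

/-- The set with index `(a, b, c)` consists of the `x` with `b * f x a + c ∈ H`. The shift `c` makes
every point uniform; if `a` separates two points, the affine map makes them independent, and at most
`k` of the `q` values of `a` do not, which gives the error term `k / η`. -/
theorem exists_isSamplingFamily {n k q : ℕ} [Fact q.Prime] (hn : n ≤ 2 ^ k) (η : ℕ)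
    (hη : η ≤ q) (hη0 : 0 < η) :
    ∃ P : Fin (q ^ 3) → Finset (Fin n), IsSamplingFamily P ((η : ℝ) / q)
      (((η : ℝ) / q) ^ 2 * (1 + (k : ℝ) / η)) := by
  classical
  obtain ⟨H, -, hH⟩ := Finset.exists_subset_card_eq (s := (Finset.univ : Finset (ZMod q)))
    (n := η) (by rwa [Finset.card_univ, ZMod.card])
  let f : Fin n → ZMod q → ZMod q := fun x a => (bitPolynomial (ZMod q) k x).eval a
  let mem : ZMod q × ZMod q × ZMod q → Fin n → Prop := fun i x => i.2.1 * f x i.1 + i.2.2 ∈ H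
  have hq : 0 < q := (Fact.out : q.Prime).pos
  have hq' : (0 : ℝ) < q := by exact_mod_cast hq
  have hη' : (0 : ℝ) < η := by exact_mod_cast hη0
  have hshift : ∀ s : ZMod q, (Finset.univ.filter fun c : ZMod q => s + c ∈ H).card = η := by
    intro s
    rw [← hH]
    refine Finset.card_bij (fun c _ => s + c) (by simp) (by simp) fun b hb => ⟨b - s, ?_, ?_⟩
    · simpa using hb
    · ring
  have hsingle : ∀ x, (Finset.univ.filter fun i => mem i x).card = q ^ 2 * η := by
    intro x
    rw [card_filter_prod_eq_sum fun i => mem i x]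
    simp_rw [fun a => card_filter_prod_eq_sum (fun z : ZMod q × ZMod q => mem (a, z) x)]
    simp only [mem, hshift]
    simp [ZMod.card]
    ring
  have hpair : ∀ x y, x ≠ y →
      (Finset.univ.filter fun i => mem i x ∧ mem i y).card ≤ q * η ^ 2 + k * (q * η) := by
    intro x y hxy
    have hcard : (Finset.univ.filter fun i => mem i x ∧ mem i y).card =
        ∑ a : ZMod q, (Finset.univ.filter fun z : ZMod q × ZMod q =>
          z.1 * f x a + z.2 ∈ H ∧ z.1 * f y a + z.2 ∈ H).card := by
      rw [card_filter_prod_eq_sum fun i => mem i x ∧ mem i y]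
    have hgood : ∀ a, f x a ≠ f y a → (Finset.univ.filter fun z : ZMod q × ZMod q =>
          z.1 * f x a + z.2 ∈ H ∧ z.1 * f y a + z.2 ∈ H).card ≤ η ^ 2 := by
      intro a ha
      rw [sq, ← hH, ← Finset.card_product]
      refine Finset.card_le_card_of_injOn
        (fun z => (z.1 * f x a + z.2, z.1 * f y a + z.2)) ?_ ?_
      · intro z hz
        simpa using hz
      · intro z _ z' _ hzz
        simp only [Prod.mk.injEq] at hzz
        have h1 : (z.1 - z'.1) * (f x a - f y a) = 0 := by linear_combination hzz.1 - hzz.2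
        have h2 : z.1 = z'.1 := by
          rcases mul_eq_zero.1 h1 with h | h
          · exact sub_eq_zero.1 h
          · exact absurd (sub_eq_zero.1 h) ha
        refine Prod.ext h2 ?_
        have := hzz.1
        rw [h2] at this
        exact add_left_cancel this
    have hall : ∀ a, (Finset.univ.filter fun z : ZMod q × ZMod q =>
          z.1 * f x a + z.2 ∈ H ∧ z.1 * f y a + z.2 ∈ H).card ≤ q * η := by
      intro a
      refine (Finset.card_le_card (Finset.monotone_filter_right _
        (fun z _ hz => hz.1 : ∀ z ∈ Finset.univ, _ → z.1 * f x a + z.2 ∈ H))).trans ?_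
      rw [card_filter_prod_eq_sum fun z : ZMod q × ZMod q => z.1 * f x a + z.2 ∈ H]
      simp_rw [hshift]
      simp [ZMod.card]
    rw [hcard, ← Finset.sum_filter_not_add_sum_filter Finset.univ fun a => f x a = f y a]
    refine add_le_add ?_ ?_
    · refine (Finset.sum_le_card_nsmul _ _ (η ^ 2) fun a ha => ?_).trans ?_
      · exact hgood a (by simpa using ha)
      · rw [smul_eq_mul]
        refine Nat.mul_le_mul_right _ ((Finset.card_filter_le _ _).trans ?_)
        rw [Finset.card_univ, ZMod.card]
    · refine (Finset.sum_le_card_nsmul _ _ (q * η) fun a _ => hall a).trans ?_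
      rw [smul_eq_mul]
      refine Nat.mul_le_mul_right _ ?_
      exact card_eval_bitPolynomial_eq_le (x.2.trans_le hn) (y.2.trans_le hn)
        (fun h => hxy (Fin.ext h))
  have hcardι : Fintype.card (ZMod q × ZMod q × ZMod q) = q ^ 3 := by
    simp only [Fintype.card_prod, ZMod.card]
    ring
  let e := (Fintype.equivFinOfCardEq hcardι).symm
  refine ⟨fun i => Finset.univ.filter (mem (e i)), fun x => ?_, fun x y hxy => ?_⟩
  · simp only [Finset.mem_filter, Finset.mem_univ, true_and]
    rw [card_filter_equiv e fun i => mem i x, hsingle, Fintype.card_fin]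
    push_cast
    field_simp
  · simp only [Finset.mem_filter, Finset.mem_univ, true_and]
    rw [card_filter_equiv e fun i => mem i x ∧ mem i y, Fintype.card_fin]
    have : ((Finset.univ.filter fun i => mem i x ∧ mem i y).card : ℝ) ≤
        (q : ℝ) * η ^ 2 + k * (q * η) := by exact_mod_cast hpair x y hxy
    refine this.trans (le_of_eq ?_)
    push_cast
    field_simp

/-- Sampling families of polylogarithmic size. -/
theorem exists_small_isSamplingFamily (n : ℕ) :
    ∃ (N : ℕ) (P : Fin N → Finset (Fin n)) (h g : ℝ), IsSamplingFamily P h g ∧ 0 < N ∧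
      N ≤ (10 * (Nat.log 2 n + 3) ^ 2) ^ 3 ∧ 1 / 3 ≤ h ∧ h ≤ 1 / 2 ∧ 0 ≤ g ∧
      ∀ J ≤ Nat.log 2 n + 3, g ^ J ≤ 2 * (h ^ J) ^ 2 := by
  set l := Nat.log 2 n + 3 with hl
  have hl2 : 9 ≤ l ^ 2 := by nlinarith [Nat.zero_le (Nat.log 2 n)]
  obtain ⟨q, hq, hlt, hle⟩ := Nat.exists_prime_lt_and_le_two_mul (4 * l ^ 2 + 2) (by omega)
  have := Fact.mk hq
  let η := (q - 1) / 2
  have hη1 : 2 * l ^ 2 ≤ η := by omega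
  have hη2 : q ≤ 3 * η := by omega
  have hη3 : 2 * η ≤ q := by omega
  have hq0 : (0 : ℝ) < q := by exact_mod_cast hq.pos
  have hη0 : (0 : ℝ) < η := by
    have : 0 < η := by omega
    exact_mod_cast this
  have hn : n ≤ 2 ^ l := by
    refine (Nat.lt_pow_succ_log_self (b := 2) (by norm_num) n).le.trans ?_
    exact Nat.pow_le_pow_right (by norm_num) (by omega)
  obtain ⟨P, hP⟩ := exists_isSamplingFamily (q := q) hn η (by omega) (by omega)
  refine ⟨q ^ 3, P, _, _, hP, pow_pos hq.pos 3, Nat.pow_le_pow_left (by omega) 3, ?_, ?_,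
    by positivity, fun J hJ => ?_⟩
  · rw [le_div_iff₀ hq0]
    have : (q : ℝ) ≤ 3 * η := by exact_mod_cast hη2
    linarith
  · rw [div_le_iff₀ hq0]
    have : (2 : ℝ) * η ≤ q := by exact_mod_cast hη3
    linarith
  · rw [mul_pow, ← pow_mul, ← pow_mul, mul_comm 2 J, mul_comm]
    refine mul_le_mul_of_nonneg_right ?_ (by positivity)
    have h1 : (1 + (l : ℝ) / η) ^ J ≤ Real.exp ((l : ℝ) / η * J) := by
      rw [mul_comm, Real.exp_nat_mul]
      refine pow_le_pow_left₀ (by positivity) ?_ J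
      rw [add_comm]
      exact Real.add_one_le_exp _
    have h2 : (l : ℝ) / η * J ≤ 1 / 2 := by
      rw [div_mul_eq_mul_div, div_le_iff₀ hη0]
      have e1 : (J : ℝ) ≤ l := by exact_mod_cast hJ
      have e2 : (2 : ℝ) * l ^ 2 ≤ η := by exact_mod_cast hη1
      have e3 : (0 : ℝ) ≤ l := by positivity
      nlinarith
    have h3 : Real.exp (1 / 2) ≤ 2 := by
      have h4 : Real.exp (1 / 2) * Real.exp (1 / 2) = Real.exp 1 := by
        rw [← Real.exp_add]
        norm_num
      have := Real.exp_one_lt_d9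
      nlinarith [Real.exp_pos (1 / 2)]
    exact h1.trans ((Real.exp_le_exp.2 h2).trans h3)

/-! ### Witnesses -/

/-- `κ'.Refines κ`: all that is known in `κ` is known in `κ'`. -/
def Knowledge.Refines {n : ℕ} {Ω : Type} (κ' κ : Knowledge n Ω) : Prop :=
  ∀ u ω ω', κ' u ω ω' → κ u ω ω'

theorem Knowledge.Refines.refl {n : ℕ} {Ω : Type} (κ : Knowledge n Ω) : κ.Refines κ :=
  fun _ _ _ h => h

theorem Knowledge.Refines.trans {n : ℕ} {Ω : Type} {κ κ' κ'' : Knowledge n Ω}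
    (h : κ''.Refines κ') (h' : κ'.Refines κ) : κ''.Refines κ :=
  fun u ω ω' hω => h' u ω ω' (h u ω ω' hω)

theorem Reach.refines {n T : ℕ} {Ω : Type} {κ κ' : Knowledge n Ω} (h : Reach T κ κ') :
    κ'.Refines κ := h.le

theorem Knows.refine {n : ℕ} {Ω : Type} {κ κ' : Knowledge n Ω} {α : Type*} {u : Fin n} {f : Ω → α}
    (h : Knows (κ u) f) (h' : κ'.Refines κ) : Knows (κ' u) f :=
  h.mono (h' u)

/-- Carrying out several tasks one after another. -/
theorem Reach.forall_fin {n T : ℕ} {Ω : Type} (N : ℕ) (κ : Knowledge n Ω)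
    (Q : Fin N → Knowledge n Ω → Prop)
    (hQ : ∀ i κ₁ κ₂, κ₂.Refines κ₁ → Q i κ₁ → Q i κ₂)
    (h : ∀ i κ₁, κ₁.Refines κ → ∃ κ₂, Reach T κ₁ κ₂ ∧ Q i κ₂) :
    ∃ κ', Reach (N * T) κ κ' ∧ ∀ i, Q i κ' := by
  induction N with
  | zero => exact ⟨κ, by simpa using Reach.refl κ, fun i => i.elim0⟩
  | succ N ih =>
    obtain ⟨κ₁, r₁, h₁⟩ := ih (fun i => Q i.castSucc) (fun i => hQ _) (fun i => h _)
    obtain ⟨κ₂, r₂, h₂⟩ := h (Fin.last N) κ₁ r₁.refines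
    refine ⟨κ₂, by simpa [add_mul] using r₁.trans r₂, fun i => ?_⟩
    refine Fin.lastCases h₂ (fun i => hQ _ _ _ r₂.refines (h₁ i)) i

/-! ### The potential function for isolating elements -/

section Potential

variable {V L : Type*}

/-- The number of pairs of an index and an element of the set with this index. -/
def hitCount (U : Finset L) (W : L → Finset V) : ℕ := ∑ l ∈ U, (W l).card

/-- The number of triples of an index and two different elements of the set with this index. -/
def pairCount (U : Finset L) (W : L → Finset V) : ℕ :=
  ∑ l ∈ U, ((W l).card * (W l).card - (W l).card)

theorem sum_card_inter_filter {ι : Type*} [Fintype ι] {α : Type*} [DecidableEq α] (A : Finset α)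
    (p : ι → α → Prop) [∀ i a, Decidable (p i a)] :
    ∑ i, (A.filter (p i)).card = ∑ a ∈ A, (Finset.univ.filter fun i => p i a).card := by
  simp_rw [Finset.card_filter]
  exact Finset.sum_comm

/-- Choosing a good member of a sampling family. -/
theorem IsSamplingFamily.exists_le [DecidableEq V] {ι : Type*} [Fintype ι] [Nonempty ι]
    {P : ι → Finset V}
    {h g : ℝ} (hP : IsSamplingFamily P h g) (U : Finset L) (W : L → Finset V) {a b : ℝ}
    (hb : 0 ≤ b) :
    ∃ i, a * h * hitCount U W - b * g * pairCount U W ≤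
      a * hitCount U (fun l => W l ∩ P i) - b * pairCount U (fun l => W l ∩ P i) := by
  have h1 : ∑ i, (hitCount U (fun l => W l ∩ P i) : ℝ) = h * Fintype.card ι * hitCount U W := by
    simp only [hitCount, Nat.cast_sum]
    rw [Finset.sum_comm, Finset.mul_sum]
    refine Finset.sum_congr rfl fun l _ => ?_
    have := sum_card_inter_filter (W l) (fun (i : ι) x => x ∈ P i)
    simp only [Finset.filter_mem_eq_inter] at this
    rw [← Nat.cast_sum, this, Nat.cast_sum, Finset.sum_congr rfl fun x _ => hP.single x]
    simp [mul_comm]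
  have h2 : ∑ i, (pairCount U (fun l => W l ∩ P i) : ℝ) ≤
      g * Fintype.card ι * pairCount U W := by
    simp only [pairCount, ← Finset.offDiag_card, Nat.cast_sum]
    rw [Finset.sum_comm, Finset.mul_sum]
    refine Finset.sum_le_sum fun l _ => ?_
    have := sum_card_inter_filter (W l).offDiag (fun (i : ι) x => x.1 ∈ P i ∧ x.2 ∈ P i)
    have e : ∀ i, (W l ∩ P i).offDiag = (W l).offDiag.filter fun x => x.1 ∈ P i ∧ x.2 ∈ P i := by
      intro i
      ext x
      simp only [Finset.mem_offDiag, Finset.mem_inter, Finset.mem_filter]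
      tauto
    simp only [e]
    rw [← Nat.cast_sum, this, Nat.cast_sum]
    refine (Finset.sum_le_card_nsmul _ _ (g * Fintype.card ι) fun x hx => ?_).trans ?_
    · exact hP.pair x.1 x.2 (Finset.mem_offDiag.1 hx).2.2
    · rw [nsmul_eq_mul, mul_comm]
  -- If all members were worse than the bound, summing over the family would contradict the two
  -- averages just computed.
  by_contra! hcon
  have hlt := Finset.sum_lt_sum_of_nonempty (Finset.univ_nonempty (α := ι)) fun i _ => hcon i
  rw [Finset.sum_sub_distrib, ← Finset.mul_sum, ← Finset.mul_sum, h1, Finset.sum_const,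
    Finset.card_univ, nsmul_eq_mul] at hlt
  nlinarith [mul_le_mul_of_nonneg_left h2 hb]

/-- A set of size `c` contributes `c - c * (c - 1) = c * (2 - c)`, which is `1` for `c = 1` and at
most `0` for every other natural number. -/
theorem sub_le_card_filter_card_eq_one (U : Finset L) (W : L → Finset V) :
    (hitCount U W : ℝ) - pairCount U W ≤ (U.filter fun l => (W l).card = 1).card := by
  rw [hitCount, pairCount, Nat.cast_sum, Nat.cast_sum, ← Finset.sum_sub_distrib,
    Finset.card_filter, Nat.cast_sum]
  refine Finset.sum_le_sum fun l _ => ?_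
  rw [Nat.cast_sub (Nat.le_mul_self _)]
  push_cast
  split_ifs with h
  · simp [h]
  · rcases Nat.eq_zero_or_pos (W l).card with h0 | h0
    · simp [h0]
    · have : (2 : ℝ) ≤ (W l).card := by
        have : 2 ≤ (W l).card := by omega
        exact_mod_cast this
      nlinarith

end Potential

/-! ### Deterministic search for elements -/

/-- Weighted sums over the parts of the sets `W ω u v` in commonly known sets can be computed in
`T` rounds. -/
def CanSum {n : ℕ} {Ω : Type} (p T : ℕ) (κ : Knowledge n Ω)
    (W : Ω → Fin n → Fin n → Finset (Fin n)) : Prop :=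
  ∀ κ₁ : Knowledge n Ω, κ₁.Refines κ → ∀ S : Ω → Finset (Fin n), (∀ u, Knows (κ₁ u) S) →
    ∀ c : Fin n → ZMod p, ∃ κ₂, Reach T κ₁ κ₂ ∧
      ∀ u v, Knows (κ₂ u) (fun ω => ∑ x ∈ W ω u v ∩ S ω, c x)

namespace CanSum

variable {n p T : ℕ} {Ω : Type} {κ : Knowledge n Ω} {W : Ω → Fin n → Fin n → Finset (Fin n)}

theorem refine (h : CanSum p T κ W) {κ' : Knowledge n Ω} (h' : κ'.Refines κ) :
    CanSum p T κ' W :=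
  fun κ₁ hκ => h κ₁ (hκ.trans h')

theorem card (h : CanSum p T κ W) (hnp : n < p) (S : Ω → Finset (Fin n))
    (hS : ∀ u, Knows (κ u) S) :
    ∃ κ₂, Reach T κ κ₂ ∧ ∀ u v, Knows (κ₂ u) (fun ω => (W ω u v ∩ S ω).card) := by
  obtain ⟨κ₂, r, hk⟩ := h κ (.refl κ) S hS (fun _ => 1)
  refine ⟨κ₂, r, fun u v => (hk u v).of_eq ZMod.val fun ω => ?_⟩
  rw [Finset.sum_const, nsmul_eq_mul, mul_one, ZMod.val_natCast_of_lt]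
  exact (card_finset_fin_le _).trans_lt hnp

/-- The pairs of nodes with a property. -/
noncomputable def pairsWith {n : ℕ} (U : Fin n → Fin n → Prop) : Finset (Fin n × Fin n) :=
  open Classical in Finset.univ.filter fun x => U x.1 x.2

/-- The counts that decide about the choice of a member of a sampling family become common
knowledge. -/
theorem counts (h : CanSum p T κ W) (hnp : n < p) (S : Ω → Finset (Fin n))
    (hS : ∀ u, Knows (κ u) S) (U : Ω → Fin n → Fin n → Prop)
    (hU : ∀ u v, Knows (κ u) (fun ω => U ω u v)) :
    ∃ κ₂, Reach (T + 6) κ κ₂ ∧ ∀ u, Knows (κ₂ u) (fun ω =>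
      (hitCount (pairsWith (U ω)) (fun x => W ω x.1 x.2 ∩ S ω),
        pairCount (pairsWith (U ω)) (fun x => W ω x.1 x.2 ∩ S ω))) := by
  classical
  obtain ⟨κ₁, r₁, h₁⟩ := h.card hnp S hS
  let c (ω : Ω) (u v : Fin n) : ℕ := (W ω u v ∩ S ω).card
  have hc : ∀ ω u v, c ω u v ≤ n := fun ω u v => card_finset_fin_le _
  let R₁ (ω : Ω) (u : Fin n) : ℕ := ∑ v, if U ω u v then c ω u v else 0
  let R₂ (ω : Ω) (u : Fin n) : ℕ := ∑ v, if U ω u v then c ω u v * c ω u v - c ω u v else 0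
  have hR₁ : ∀ ω u, R₁ ω u < (n + 1) ^ 2 := by
    intro ω u
    have : R₁ ω u ≤ n * n := by
      refine (Finset.sum_le_card_nsmul _ _ n fun v _ => ?_).trans (by simp)
      split_ifs
      · exact hc _ _ _
      · exact Nat.zero_le _
    nlinarith
  have hR₂ : ∀ ω u, R₂ ω u < (n + 1) ^ 3 := by
    intro ω u
    have : R₂ ω u ≤ n * (n * n) := by
      refine (Finset.sum_le_card_nsmul _ _ (n * n) fun v _ => ?_).trans (by simp)
      split_ifs
      · exact (Nat.sub_le _ _).trans (Nat.mul_le_mul (hc _ _ _) (hc _ _ _))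
      · exact Nat.zero_le _
    nlinarith [sq_nonneg n]
  have hk : ∀ u, Knows (κ₁ u) (fun ω => (R₁ ω u, R₂ ω u)) := by
    intro u
    refine ((Knows.pi fun v => r₁.knows (hU u v)).map₂ (Knows.pi fun v => h₁ u v)
      (fun a b => (∑ v, if a v then b v else 0, ∑ v, if a v then b v * b v - b v else 0)))
  have hfit : FitsIn n 6 (Fin ((n + 1) ^ 2) × Fin ((n + 1) ^ 3)) := by
    refine fitsIn_of_card_le_mul_pow 1 5 (le_of_eq ?_)
    rw [Fintype.card_prod, Fintype.card_fin, Fintype.card_fin]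
    ring
  obtain ⟨κ₂, r₂, h₂⟩ := Reach.exchange_values hfit κ₁
    (fun ω u _ => (⟨R₁ ω u, hR₁ ω u⟩, ⟨R₂ ω u, hR₂ ω u⟩))
    (fun u _ ω ω' hω => by
      have := hk u ω ω' hω
      simp only [Prod.mk.injEq] at this ⊢
      simp only [Fin.mk.injEq]
      exact this)
  refine ⟨κ₂, r₁.trans r₂, fun v => ?_⟩
  refine (Knows.pi fun u => h₂ u v).of_eq (fun f => (∑ u, ((f u).1 : ℕ), ∑ u, ((f u).2 : ℕ)))
    fun ω => ?_
  simp only [hitCount, pairCount, pairsWith, Finset.sum_filter, Fintype.sum_prod_type, R₁, R₂, c]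

/-- One halving step. -/
theorem sample {N : ℕ} (h : CanSum p T κ W) (hnp : n < p) {P : Fin N → Finset (Fin n)} {h₀ g : ℝ}
    (hP : IsSamplingFamily P h₀ g) (hN : 0 < N) (S : Ω → Finset (Fin n))
    (hS : ∀ u, Knows (κ u) S) (U : Ω → Fin n → Fin n → Prop)
    (hU : ∀ u v, Knows (κ u) (fun ω => U ω u v)) {a b : ℝ} (hb : 0 ≤ b) :
    ∃ κ₂, Reach (N * (T + 6)) κ κ₂ ∧ ∃ S' : Ω → Finset (Fin n), (∀ u, Knows (κ₂ u) S') ∧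
      ∀ ω, a * h₀ * hitCount (pairsWith (U ω)) (fun x => W ω x.1 x.2 ∩ S ω) -
        b * g * pairCount (pairsWith (U ω)) (fun x => W ω x.1 x.2 ∩ S ω) ≤
        a * hitCount (pairsWith (U ω)) (fun x => W ω x.1 x.2 ∩ S' ω) -
        b * pairCount (pairsWith (U ω)) (fun x => W ω x.1 x.2 ∩ S' ω) := by
  have : Nonempty (Fin N) := ⟨⟨0, hN⟩⟩
  obtain ⟨κ₂, r, hk⟩ := Reach.forall_fin N κ (fun i κ' => ∀ u, Knows (κ' u) (fun ω =>
      (hitCount (pairsWith (U ω)) (fun x => W ω x.1 x.2 ∩ (S ω ∩ P i)),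
        pairCount (pairsWith (U ω)) (fun x => W ω x.1 x.2 ∩ (S ω ∩ P i)))))
    (fun i κ₁ κ₂ hr hq u => (hq u).refine hr)
    (fun i κ₁ hκ => (h.refine hκ).counts hnp (fun ω => S ω ∩ P i)
      (fun u => ((hS u).refine hκ).map fun s => s ∩ P i) U (fun u v => (hU u v).refine hκ))
  -- The counts are common knowledge, so all nodes agree on the best member without further
  -- communication.
  have hsel : ∀ f : Fin N → ℕ × ℕ, ∃ i, ∀ j, a * (f j).1 - b * (f j).2 ≤
      a * (f i).1 - b * (f i).2 := fun f =>
    Finite.exists_max fun i => a * ((f i).1 : ℝ) - b * ((f i).2 : ℝ)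
  choose sel hsel using hsel
  let F (ω : Ω) (i : Fin N) : ℕ × ℕ :=
    (hitCount (pairsWith (U ω)) (fun x => W ω x.1 x.2 ∩ (S ω ∩ P i)),
      pairCount (pairsWith (U ω)) (fun x => W ω x.1 x.2 ∩ (S ω ∩ P i)))
  have hF : ∀ u, Knows (κ₂ u) F := fun u => Knows.pi fun i => hk i u
  refine ⟨κ₂, r, fun ω => S ω ∩ P (sel (F ω)), fun u => ?_, fun ω => ?_⟩
  · exact (r.knows (hS u)).map₂ (hF u) fun s f => s ∩ P (sel f)
  · obtain ⟨i, hi⟩ := hP.exists_le (pairsWith (U ω)) (fun x => W ω x.1 x.2 ∩ S ω) (a := a) hb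
    simp only [Finset.inter_assoc] at hi
    exact hi.trans (hsel (F ω) i)

/-- Several halving steps. -/
theorem sample_iterate {N : ℕ} (h : CanSum p T κ W) (hnp : n < p) {P : Fin N → Finset (Fin n)}
    {h₀ g : ℝ} (hP : IsSamplingFamily P h₀ g) (hN : 0 < N) (hg : 0 ≤ g)
    (U : Ω → Fin n → Fin n → Prop) (hU : ∀ u v, Knows (κ u) (fun ω => U ω u v)) (J : ℕ)
    {a b : ℝ} (hb : 0 ≤ b) :
    ∃ κ₂, Reach (J * (N * (T + 6))) κ κ₂ ∧ ∃ S : Ω → Finset (Fin n), (∀ u, Knows (κ₂ u) S) ∧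
      ∀ ω, a * h₀ ^ J * hitCount (pairsWith (U ω)) (fun x => W ω x.1 x.2) -
        b * g ^ J * pairCount (pairsWith (U ω)) (fun x => W ω x.1 x.2) ≤
        a * hitCount (pairsWith (U ω)) (fun x => W ω x.1 x.2 ∩ S ω) -
        b * pairCount (pairsWith (U ω)) (fun x => W ω x.1 x.2 ∩ S ω) := by
  induction J generalizing a b with
  | zero =>
    exact ⟨κ, by simpa using Reach.refl κ, fun _ => Finset.univ, fun u => .const _, by simp⟩
  | succ J ih =>
    -- The last halving step multiplies the two weights by `h₀` and `g`, so the earlier steps must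
    -- optimise the potential with these modified weights.
    obtain ⟨κ₁, r₁, S, hS, h₁⟩ := ih (a := a * h₀) (b := b * g) (by positivity)
    obtain ⟨κ₂, r₂, S', hS', h₂⟩ := (h.refine r₁.refines).sample hnp hP hN S hS U
      (fun u v => r₁.knows (hU u v)) (a := a) hb
    refine ⟨κ₂, by simpa [add_mul] using r₁.trans r₂, S', hS', fun ω => ?_⟩
    refine le_trans (le_of_eq ?_) ((h₁ ω).trans (h₂ ω))
    ring

/-- The elements of the sets `W ω u v ∩ S ω` with only one element become known. -/
theorem isolated (h : CanSum p T κ W) (hnp : n < p) (S : Ω → Finset (Fin n))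
    (hS : ∀ u, Knows (κ u) S) :
    ∃ κ₂, Reach (2 * T) κ κ₂ ∧ ∃ x : Ω → Fin n → Fin n → Option (Fin n),
      (∀ u v, Knows (κ₂ u) (fun ω => x ω u v)) ∧
      (∀ ω u v y, x ω u v = some y → y ∈ W ω u v) ∧
      ∀ ω u v, (W ω u v ∩ S ω).card = 1 → x ω u v ≠ none := by
  classical
  obtain ⟨κ₁, r₁, h₁⟩ := h.card hnp S hS
  obtain ⟨κ₂, r₂, h₂⟩ := h κ₁ r₁.refines S (fun u => r₁.knows (hS u))
    (fun x => ((x : ℕ) : ZMod p))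
  -- If exactly one element is left, the sum of the labels is its label, and `n < p` lets it be read
  -- off.
  let dec : ℕ → ZMod p → Option (Fin n) := fun c s =>
    if h : c = 1 ∧ s.val < n then some ⟨s.val, h.2⟩ else none
  have hsum : ∀ ω u v z, W ω u v ∩ S ω = {z} →
      (∑ x ∈ W ω u v ∩ S ω, ((x : ℕ) : ZMod p)).val = z := by
    intro ω u v z hz
    rw [hz, Finset.sum_singleton, ZMod.val_natCast_of_lt (z.2.trans hnp)]
  refine ⟨κ₂, Reach.mono (le_of_eq (by ring)) (r₁.trans r₂), fun ω u v =>
    dec (W ω u v ∩ S ω).card (∑ x ∈ W ω u v ∩ S ω, ((x : ℕ) : ZMod p)),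
    fun u v => (r₂.knows (h₁ u v)).map₂ (h₂ u v) dec, fun ω u v y hy => ?_, fun ω u v hc => ?_⟩
  · simp only [dec] at hy
    split_ifs at hy with hc
    obtain ⟨z, hz⟩ := Finset.card_eq_one.1 hc.1
    have hzm : z ∈ W ω u v := (Finset.mem_inter.1 (hz ▸ Finset.mem_singleton_self z)).1
    have : z = y := by
      rw [Option.some.injEq] at hy
      rw [← hy]
      exact Fin.ext (hsum ω u v z hz).symm
    exact this ▸ hzm
  · obtain ⟨z, hz⟩ := Finset.card_eq_one.1 hc
    simp only [dec]
    rw [dif_pos ⟨hc, by rw [hsum ω u v z hz]; exact z.2⟩]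
    simp

end CanSum

/-- The sizes of sets for which `J` halving steps are appropriate. -/
def InSamplingClass (h : ℝ) (J c : ℕ) : Prop := 1 / 12 < h ^ J * c ∧ h ^ J * c ≤ 1 / 4

/-- The least `J` bringing the expected size `h ^ J * c` down to `1 / 4` works: a step shrinks it by
at most a factor of three. Since `h ≤ 1 / 2`, logarithmically many steps are enough. -/
theorem exists_inSamplingClass {h : ℝ} (h1 : 1 / 3 ≤ h) (h2 : h ≤ 1 / 2) {c n : ℕ} (hc : 0 < c)
    (hcn : c ≤ n) : ∃ J < Nat.log 2 n + 4, InSamplingClass h J c := by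
  classical
  have hex : h ^ (Nat.log 2 n + 3) * c ≤ 1 / 4 := by
    have e1 : h ^ (Nat.log 2 n + 3) ≤ (1 / 2) ^ (Nat.log 2 n + 3) :=
      pow_le_pow_left₀ (by linarith) h2 _
    have e2 : (c : ℝ) ≤ 2 ^ (Nat.log 2 n + 1) := by
      have : c ≤ 2 ^ (Nat.log 2 n + 1) :=
        hcn.trans (Nat.lt_pow_succ_log_self (by norm_num) n).le
      exact_mod_cast this
    calc h ^ (Nat.log 2 n + 3) * c ≤ (1 / 2) ^ (Nat.log 2 n + 3) * 2 ^ (Nat.log 2 n + 1) := by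
          gcongr
      _ = ((1 / 2) * 2) ^ (Nat.log 2 n + 1) * (1 / 4) := by
          rw [mul_pow]
          ring
      _ ≤ 1 / 4 := by norm_num
  have hP : ∃ J, h ^ J * c ≤ 1 / 4 := ⟨_, hex⟩
  refine ⟨Nat.find hP, Nat.lt_succ_of_le (Nat.find_min' hP hex), ?_, Nat.find_spec hP⟩
  have hc1 : (1 : ℝ) ≤ c := by exact_mod_cast hc
  rcases Nat.eq_zero_or_pos (Nat.find hP) with h0 | h0
  · rw [h0]
    norm_num
    linarith
  · have := Nat.find_min hP (Nat.sub_one_lt h0.ne')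
    rw [not_le] at this
    have e : h ^ Nat.find hP * c = h * (h ^ (Nat.find hP - 1) * c) := by
      rw [← mul_assoc, ← pow_succ', Nat.sub_add_cancel h0]
    rw [e]
    nlinarith

namespace CanSum

variable {n p T : ℕ} {Ω : Type} {κ : Knowledge n Ω} {W : Ω → Fin n → Fin n → Finset (Fin n)}

/-- A partial choice of elements of the sets `W ω u v`, known to the nodes `u`. -/
structure IsPartialChoice (κ : Knowledge n Ω) (W : Ω → Fin n → Fin n → Finset (Fin n))
    (x : Ω → Fin n → Fin n → Option (Fin n)) : Prop where
  knows : ∀ u v, Knows (κ u) (fun ω => x ω u v)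
  mem : ∀ ω u v y, x ω u v = some y → y ∈ W ω u v

/-- The pairs of nodes in a sampling class for which no choice has been made yet. -/
def Open (h : ℝ) (J : ℕ) (W : Fin n → Fin n → Finset (Fin n)) (x : Fin n → Fin n → Option (Fin n))
    (u v : Fin n) : Prop :=
  x u v = none ∧ InSamplingClass h J (W u v).card

theorem open_of_le {h : ℝ} {J : ℕ} {W : Fin n → Fin n → Finset (Fin n)}
    {x x' : Fin n → Fin n → Option (Fin n)} (hx : ∀ u v, x' u v = none → x u v = none)
    {u v : Fin n} (ho : Open h J W x' u v) : Open h J W x u v :=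
  ⟨hx u v ho.1, ho.2⟩

/-- One phase of the search for witnesses in a sampling class. -/
theorem phase {N J : ℕ} (hs : CanSum p T κ W) (hnp : n < p) {P : Fin N → Finset (Fin n)} {h g : ℝ}
    (hP : IsSamplingFamily P h g) (hN : 0 < N) (hg : 0 ≤ g) (hgJ : g ^ J ≤ 2 * (h ^ J) ^ 2)
    (hcard : ∀ u v, Knows (κ u) (fun ω => (W ω u v).card))
    {x : Ω → Fin n → Fin n → Option (Fin n)} (hx : IsPartialChoice κ W x) :
    ∃ κ', Reach (J * (N * (T + 6)) + 2 * T) κ κ' ∧ ∃ x' : Ω → Fin n → Fin n → Option (Fin n),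
      IsPartialChoice κ' W x' ∧ (∀ ω u v, x' ω u v = none → x ω u v = none) ∧
      ∀ ω, ((pairsWith (Open h J (W ω) (x' ω))).card : ℝ) ≤
        23 / 24 * (pairsWith (Open h J (W ω) (x ω))).card := by
  classical
  obtain ⟨κ₁, r₁, S, hS, h₁⟩ := hs.sample_iterate hnp hP hN hg (fun ω => Open h J (W ω) (x ω))
    (fun u v => (hx.knows u v).map₂ (hcard u v) fun a c => a = none ∧ InSamplingClass h J c) J
    (a := 1) (b := 1) zero_le_one
  obtain ⟨κ₂, r₂, y, hy, hyW, hy1⟩ := (hs.refine r₁.refines).isolated hnp S hS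
  refine ⟨κ₂, r₁.trans r₂, fun ω u v => (x ω u v).orElse fun _ => y ω u v, ⟨fun u v => ?_,
    fun ω u v z hz => ?_⟩, fun ω u v h => ?_, fun ω => ?_⟩
  · exact ((r₁.trans r₂).knows (hx.knows u v)).map₂ (hy u v) fun a b => a.orElse fun _ => b
  · cases hxz : x ω u v with
    | none => exact hyW ω u v z (by simpa [hxz] using hz)
    | some z' => exact hx.mem ω u v z (by simpa [hxz] using hz)
  · cases hxz : x ω u v with
    | none => rfl
    | some z' => simp [hxz] at h
  · set U := pairsWith (Open h J (W ω) (x ω)) with hU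
    have hmem : ∀ l, l ∈ U ↔ Open h J (W ω) (x ω) l.1 l.2 := by simp [hU, pairsWith]
    have hiso := sub_le_card_filter_card_eq_one U (fun l => W ω l.1 l.2 ∩ S ω)
    -- With `z = h ^ J * c`, each open pair contributes at least `z - 2 * z ^ 2`, which exceeds `1 /
    -- 24` for `1 / 12 < z ≤ 1 / 4`. A constant fraction of the open pairs is thus settled in each
    -- phase.
    have hpot : (U.card : ℝ) / 24 ≤ h ^ J * hitCount U (fun l => W ω l.1 l.2) -
        g ^ J * pairCount U (fun l => W ω l.1 l.2) := by
      rw [hitCount, pairCount, Nat.cast_sum, Nat.cast_sum, Finset.mul_sum, Finset.mul_sum,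
        ← Finset.sum_sub_distrib]
      have : (U.card : ℝ) / 24 = ∑ l ∈ U, (1 / 24 : ℝ) := by
        rw [Finset.sum_const, nsmul_eq_mul]
        ring
      rw [this]
      refine Finset.sum_le_sum fun l hl => ?_
      obtain ⟨-, hc1, hc2⟩ := (hmem l).1 hl
      rw [Nat.cast_sub (Nat.le_mul_self _)]
      push_cast
      set c : ℝ := ((W ω l.1 l.2).card : ℝ)
      have hc0 : 0 ≤ c := by positivity
      have e1 : g ^ J * (c * c - c) ≤ 2 * (h ^ J * c) ^ 2 := by
        calc g ^ J * (c * c - c) ≤ g ^ J * (c * c) := by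
              gcongr
              linarith
          _ ≤ 2 * (h ^ J) ^ 2 * (c * c) := by gcongr
          _ = _ := by ring
      nlinarith
    have h1 := h₁ ω
    simp only [one_mul] at h1
    rw [← hU] at h1
    have hsub : pairsWith (Open h J (W ω) (fun u v => (x ω u v).orElse fun _ => y ω u v)) ⊆
        U.filter fun l => ¬ (W ω l.1 l.2 ∩ S ω).card = 1 := by
      intro l hl
      simp only [pairsWith, Finset.mem_filter, Finset.mem_univ, true_and] at hl
      have hxn : x ω l.1 l.2 = none := by
        cases hxz : x ω l.1 l.2 with
        | none => rfl
        | some z' => simp [Open, hxz] at hl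
      refine Finset.mem_filter.2 ⟨(hmem l).2 ⟨hxn, hl.2⟩, fun h1 => ?_⟩
      have := hl.1
      simp only [hxn, Option.orElse_none] at this
      exact hy1 ω l.1 l.2 h1 this
    have hle : ((pairsWith (Open h J (W ω)
        (fun u v => (x ω u v).orElse fun _ => y ω u v))).card : ℝ) ≤
        (U.filter fun l => ¬ (W ω l.1 l.2 ∩ S ω).card = 1).card := by
      exact_mod_cast Finset.card_le_card hsub
    have hsum : ((U.filter fun l => (W ω l.1 l.2 ∩ S ω).card = 1).card : ℝ) +
        (U.filter fun l => ¬ (W ω l.1 l.2 ∩ S ω).card = 1).card = U.card := by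
      exact_mod_cast Finset.card_filter_add_card_filter_not _
    linarith

/-- All witnesses in a sampling class. -/
theorem phases {N J : ℕ} (hs : CanSum p T κ W) (hnp : n < p) {P : Fin N → Finset (Fin n)}
    {h g : ℝ} (hP : IsSamplingFamily P h g) (hN : 0 < N) (hg : 0 ≤ g)
    (hgJ : g ^ J ≤ 2 * (h ^ J) ^ 2)
    (hcard : ∀ u v, Knows (κ u) (fun ω => (W ω u v).card))
    {x : Ω → Fin n → Fin n → Option (Fin n)} (hx : IsPartialChoice κ W x) (R : ℕ) :
    ∃ κ', Reach (R * (J * (N * (T + 6)) + 2 * T)) κ κ' ∧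
      ∃ x' : Ω → Fin n → Fin n → Option (Fin n),
      IsPartialChoice κ' W x' ∧ (∀ ω u v, x' ω u v = none → x ω u v = none) ∧
      ∀ ω, ((pairsWith (Open h J (W ω) (x' ω))).card : ℝ) ≤ (23 / 24) ^ R * (n * n) := by
  induction R with
  | zero =>
    refine ⟨κ, by simpa using Reach.refl κ, x, hx, fun _ _ _ h => h, fun ω => ?_⟩
    have : (pairsWith (Open h J (W ω) (x ω))).card ≤ n * n := by
      refine (Finset.card_le_univ _).trans ?_
      simp
    rw [pow_zero, one_mul]
    exact_mod_cast this
  | succ R ih =>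
    obtain ⟨κ₁, r₁, x₁, hx₁, hle₁, hc₁⟩ := ih
    obtain ⟨κ₂, r₂, x₂, hx₂, hle₂, hc₂⟩ := (hs.refine r₁.refines).phase hnp hP hN hg hgJ
      (fun u v => r₁.knows (hcard u v)) hx₁
    refine ⟨κ₂, Reach.mono (le_of_eq (by ring)) (r₁.trans r₂), x₂, hx₂,
      fun ω u v h => hle₁ ω u v (hle₂ ω u v h), fun ω => (hc₂ ω).trans ?_⟩
    rw [pow_succ]
    nlinarith [hc₁ ω]

/-- After this many phases fewer than one of the at most `n * n` open pairs is left, hence none. -/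
theorem pow_mul_sq_lt_one (n : ℕ) :
    (23 / 24 : ℝ) ^ (34 * (Nat.log 2 n + 1)) * (n * n) < 1 := by
  have h1 : (n : ℝ) < 2 ^ (Nat.log 2 n + 1) := by
    exact_mod_cast Nat.lt_pow_succ_log_self (by norm_num) n
  have h2 : (23 / 24 : ℝ) ^ 34 ≤ 1 / 4 := by norm_num
  have h0 : (0 : ℝ) ≤ n := by positivity
  have h3 : (n : ℝ) * n < 4 ^ (Nat.log 2 n + 1) := by
    have : (4 : ℝ) ^ (Nat.log 2 n + 1) = 2 ^ (Nat.log 2 n + 1) * 2 ^ (Nat.log 2 n + 1) := by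
      rw [← mul_pow]
      norm_num
    rw [this]
    nlinarith
  rw [pow_mul]
  calc ((23 / 24 : ℝ) ^ 34) ^ (Nat.log 2 n + 1) * (n * n) ≤
        (1 / 4) ^ (Nat.log 2 n + 1) * (n * n) := by gcongr
    _ < (1 / 4) ^ (Nat.log 2 n + 1) * 4 ^ (Nat.log 2 n + 1) := by gcongr
    _ = 1 := by
      rw [← mul_pow]
      norm_num

/-- Elements of all non-empty sets `W ω u v` can be found in polylogarithmically many steps. -/
theorem exists_choice (hs : CanSum p T κ W) (hnp : n < p) :
    ∃ κ', Reach (34035 * (Nat.log 2 n + 4) ^ 9 * (T + 6)) κ κ' ∧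
      ∃ x : Ω → Fin n → Fin n → Option (Fin n),
      IsPartialChoice κ' W x ∧ ∀ ω u v, (W ω u v).Nonempty → x ω u v ≠ none := by
  obtain ⟨N, P, h, g, hP, hN, hNle, h1, h2, hg, hgJ⟩ := exists_small_isSamplingFamily n
  obtain ⟨κ₀, r₀, hcard⟩ := hs.card hnp (fun _ => Finset.univ) fun _ => .const _
  simp only [Finset.inter_univ] at hcard
  set l := Nat.log 2 n with hl
  have hmain : ∀ j ≤ l + 4, ∃ κ', Reach (j * ((34 * (l + 1)) * ((l + 3) * (N * (T + 6)) + 2 * T)))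
      κ₀ κ' ∧ ∃ x : Ω → Fin n → Fin n → Option (Fin n), IsPartialChoice κ' W x ∧
      ∀ ω u v, ∀ i < j, ¬ Open h i (W ω) (x ω) u v := by
    intro j
    induction j with
    | zero =>
      intro _
      exact ⟨κ₀, by simpa using Reach.refl κ₀, fun _ _ _ => none,
        ⟨fun _ _ => .const _, by simp⟩, by simp⟩
    | succ j ih =>
      intro hj
      obtain ⟨κ₁, r₁, x₁, hx₁, hc₁⟩ := ih (by omega)
      obtain ⟨κ₂, r₂, x₂, hx₂, hle₂, hc₂⟩ := (hs.refine (r₀.trans r₁).refines).phases (J := j) hnp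
        hP hN hg (hgJ j (by omega)) (fun u v => r₁.knows (hcard u v)) hx₁ (34 * (l + 1))
      refine ⟨κ₂, Reach.mono ?_ (r₁.trans r₂), x₂, hx₂, fun ω u v i hi ho => ?_⟩
      · rw [Nat.succ_mul j]
        have : j ≤ l + 3 := by omega
        exact Nat.add_le_add_left (Nat.mul_le_mul_left _ (Nat.add_le_add_right
          (Nat.mul_le_mul_right _ this) _)) _
      · rcases Nat.lt_succ_iff_lt_or_eq.1 hi with hi | rfl
        · exact hc₁ ω u v i hi (open_of_le (hle₂ ω) ho)
        · have hlt := (hc₂ ω).trans_lt (pow_mul_sq_lt_one n)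
          have h0 : (pairsWith (Open h i (W ω) (x₂ ω))).card = 0 := by
            have : (pairsWith (Open h i (W ω) (x₂ ω))).card < 1 := by exact_mod_cast hlt
            omega
          have hm : (u, v) ∈ pairsWith (Open h i (W ω) (x₂ ω)) := by
            simpa [pairsWith] using ho
          rw [Finset.card_eq_zero.1 h0] at hm
          simp at hm
  obtain ⟨κ', r, x, hx, hc⟩ := hmain (l + 4) le_rfl
  refine ⟨κ', Reach.mono ?_ (r₀.trans r), x, hx, fun ω u v hW hnone => ?_⟩
  · set L := l + 4 with hL
    have hN' : N ≤ 1000 * L ^ 6 := by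
      refine hNle.trans ?_
      calc (10 * (l + 3) ^ 2) ^ 3 ≤ (10 * L ^ 2) ^ 3 := by
            gcongr
            omega
        _ = _ := by ring
    have hL4 : 1 ≤ L := by omega
    have e1 : (l + 3) * (N * (T + 6)) + 2 * T ≤ 1001 * L ^ 7 * (T + 6) := by
      have : 2 * T ≤ L ^ 7 * (T + 6) := by
        have h4 : 4 ≤ L := by omega
        have : 2 ≤ L ^ 7 := h4.trans' (by norm_num) |>.trans (Nat.le_self_pow (by norm_num) L)
        exact Nat.mul_le_mul this (by omega)
      calc (l + 3) * (N * (T + 6)) + 2 * T ≤ L * (1000 * L ^ 6 * (T + 6)) + L ^ 7 * (T + 6) := by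
            gcongr
            omega
        _ = _ := by ring
    calc T + L * (34 * (l + 1) * ((l + 3) * (N * (T + 6)) + 2 * T)) ≤
        L ^ 9 * (T + 6) + L * (34 * L * (1001 * L ^ 7 * (T + 6))) := by
          gcongr
          · exact (Nat.le_add_right T 6).trans
              (Nat.le_mul_of_pos_left _ (Nat.pow_pos hL4))
          · omega
      _ = 34035 * L ^ 9 * (T + 6) := by ring
  · obtain ⟨J, hJ, hJc⟩ := exists_inSamplingClass h1 h2 (Finset.card_pos.2 hW)
      (card_finset_fin_le (W ω u v))
    exact hc ω u v J hJ ⟨hnone, hJc⟩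

end CanSum

/-! ### First steps on shortest paths -/

/-- The first steps of positive length from `u` on shortest paths to `v`, given the adjacency
matrix `A` and the distances `D`. -/
noncomputable def positiveSteps {n : ℕ} (A D : Fin n → Fin n → ℕ∞) (u v : Fin n) :
    Finset (Fin n) :=
  open Classical in
  Finset.univ.filter fun x => A u x ≠ ⊤ ∧ A u x ≠ 0 ∧ D u v ≠ ⊤ ∧ A u x + D x v = D u v

theorem mem_positiveSteps {n : ℕ} {A D : Fin n → Fin n → ℕ∞} {u v x : Fin n} :
    x ∈ positiveSteps A D u v ↔
      A u x ≠ ⊤ ∧ A u x ≠ 0 ∧ D u v ≠ ⊤ ∧ A u x + D x v = D u v := by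
  simp [positiveSteps]

/-- The hypotheses put `a + b - d` between `0` and `2 * a ≤ 2 * M`, so it is zero as soon as it is
divisible by `2 * M + 1`. -/
theorem add_mod_eq_mod_iff {M a b d : ℕ} (ha : a ≤ M) (h : d ≤ a + b) (h' : b ≤ a + d) :
    (a + b % (2 * M + 1)) % (2 * M + 1) = d % (2 * M + 1) ↔ a + b = d := by
  rw [Nat.add_mod_mod]
  refine ⟨fun hm => ?_, fun hm => by rw [hm]⟩
  have hdvd := (Nat.modEq_iff_dvd' h).1 (Eq.symm hm : d ≡ a + b [MOD 2 * M + 1])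
  have := Nat.eq_zero_of_dvd_of_lt hdvd (by omega)
  omega

/-- Sums over first steps can be computed with one matrix product. -/
theorem MonomialMulIn.canSum_positiveSteps {n p M T : ℕ} (h : MonomialMulIn n p (8 * M + 1) T)
    {Ω : Type} {κ : Knowledge n Ω} {A D : Ω → Fin n → Fin n → ℕ∞}
    (hA : ∀ u v, Knows (κ u) (fun ω => A ω u v)) (hD : ∀ u v, Knows (κ u) (fun ω => D ω u v))
    (hAM : ∀ ω u v, A ω u v = ⊤ ∨ A ω u v ≤ M) (h₁ : ∀ ω u x v, D ω u v ≤ A ω u x + D ω x v)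
    (h₂ : ∀ ω u x v, D ω x v ≤ A ω u x + D ω u v) :
    CanSum p T κ (fun ω => positiveSteps (A ω) (D ω)) := by
  classical
  intro κ₁ hκ S hS c
  let X : Ω → Fin n → Fin n → ZMod p × Fin (8 * M + 1) := fun ω u x =>
    (if x ∈ S ω ∧ A ω u x ≠ ⊤ ∧ A ω u x ≠ 0 then c x else 0,
      ⟨min (A ω u x).toNat M, by have := min_le_right (A ω u x).toNat M; omega⟩)
  -- Distances enter only modulo `2 * M + 1`, which keeps the degrees small although the distances
  -- may be as large as `n * M`.
  let Y : Ω → Fin n → Fin n → ZMod p × Fin (8 * M + 1) := fun ω x v =>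
    (1, ⟨min ((D ω x v).toNat % (2 * M + 1)) (2 * M), by
      have := min_le_right ((D ω x v).toNat % (2 * M + 1)) (2 * M); omega⟩)
  have hX2 : ∀ ω u x, ((X ω u x).2 : ℕ) ≤ M := fun ω u x => min_le_right _ _
  have hY2 : ∀ ω x v, ((Y ω x v).2 : ℕ) = (D ω x v).toNat % (2 * M + 1) := by
    intro ω x v
    have := Nat.mod_lt (D ω x v).toNat (show 0 < 2 * M + 1 by omega)
    exact min_eq_left (by omega)
  have hY3 : ∀ ω x v, ((Y ω x v).2 : ℕ) ≤ 2 * M := fun ω u x => min_le_right _ _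
  obtain ⟨κ₂, r, hk⟩ := h Ω κ₁ X Y (fun u x => ((hS u).map₂ ((hA u x).refine hκ) fun s a =>
      ((if x ∈ s ∧ a ≠ ⊤ ∧ a ≠ 0 then c x else 0,
        ⟨min a.toNat M, by have := min_le_right a.toNat M; omega⟩) : ZMod p × Fin (8 * M + 1))))
    (fun x v => ((hD x v).refine hκ).map fun d => ((1, ⟨min (d.toNat % (2 * M + 1)) (2 * M), by
      have := min_le_right (d.toNat % (2 * M + 1)) (2 * M); omega⟩) : ZMod p × Fin (8 * M + 1)))
    (fun ω u x v => by
      have := hX2 ω u x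
      have := hY3 ω x v
      omega)
  refine ⟨κ₂, r, fun u v => ((hk u v).map₂ (r.knows ((hD u v).refine hκ)) fun f d =>
    if d = ⊤ then 0 else ∑ e ∈ Finset.range (8 * M + 1),
      if e % (2 * M + 1) = d.toNat % (2 * M + 1) then f.coeff e else 0).of_eq id fun ω => ?_⟩
  simp only [id]
  split_ifs with hd
  · refine Finset.sum_eq_zero fun x hx => ?_
    exact absurd hd (mem_positiveSteps.1 (Finset.mem_inter.1 hx).1).2.2.1
  have hR : ∀ x, x ∈ positiveSteps (A ω) (D ω) u v ∩ S ω ↔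
      x ∈ Finset.univ.filter fun x => x ∈ positiveSteps (A ω) (D ω) u v ∧ x ∈ S ω := by simp
  rw [Finset.ext hR, Finset.sum_filter]
  have hL : ∀ e, (if e % (2 * M + 1) = (D ω u v).toNat % (2 * M + 1) then
      (monomialMatrixMul (X ω) (Y ω) u v).coeff e else 0) =
      ∑ x, if ((X ω u x).2 : ℕ) + (Y ω x v).2 = e then
        (if e % (2 * M + 1) = (D ω u v).toNat % (2 * M + 1) then
          (X ω u x).1 * (Y ω x v).1 else 0) else 0 := by
    intro e
    rw [coeff_monomialMatrixMul]
    split_ifs <;> simp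
  simp only [hL]
  rw [Finset.sum_comm]
  refine Finset.sum_congr rfl fun x _ => ?_
  rw [Finset.sum_ite_eq, if_pos (Finset.mem_range.2 (by
      have := hX2 ω u x
      have := hY3 ω x v
      omega)), hY2]
  by_cases hx : x ∈ S ω ∧ A ω u x ≠ ⊤ ∧ A ω u x ≠ 0
  · obtain ⟨hxS, hA1, hA2⟩ := hx
    have haM := (hAM ω u x).resolve_left hA1
    have h1 := h₁ ω u x v
    have h2 := h₂ ω u x v
    have hD1 : D ω x v ≠ ⊤ := ne_top_of_le_ne_top (WithTop.add_ne_top.2 ⟨hA1, hd⟩) h2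
    have hX1 : X ω u x = (c x, ⟨min (A ω u x).toNat M, by
        have := min_le_right (A ω u x).toNat M; omega⟩) := by
      simp only [X]
      rw [if_pos ⟨hxS, hA1, hA2⟩]
    rw [hX1]
    simp only [mem_positiveSteps]
    obtain ⟨a, ha⟩ := ENat.ne_top_iff_exists.1 hA1
    obtain ⟨b, hb⟩ := ENat.ne_top_iff_exists.1 hD1
    obtain ⟨d, hd'⟩ := ENat.ne_top_iff_exists.1 hd
    rw [← ha] at haM h1 h2 hA2 ⊢
    rw [← hb] at h1 h2 ⊢
    rw [← hd'] at h1 h2 ⊢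
    norm_cast at haM h1 h2 hA2
    simp only [ENat.toNat_natCast, min_eq_left haM, add_mod_eq_mod_iff haM h1 h2, hxS, and_true, Y,
      mul_one]
    refine if_congr ?_ rfl rfl
    norm_cast
    simp [hA2]
  · have hX1 : (X ω u x).1 = 0 := if_neg hx
    rw [hX1, zero_mul, ite_self, if_neg]
    rintro ⟨hx1, hx2⟩
    obtain ⟨hA1, hA2, -⟩ := mem_positiveSteps.1 hx1
    exact hx ⟨hx2, hA1, hA2⟩

theorem weightedDist_le_weightedAdjMatrix_add {n : ℕ} (G : SimpleGraph (Fin n))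
    (w : Sym2 (Fin n) → ℕ) (u x v : Fin n) :
    weightedDist G w u v ≤ weightedAdjMatrix G w u x + weightedDist G w x v := by
  unfold weightedAdjMatrix
  split_ifs with h
  · exact (weightedDist_triangle u x v).trans (add_le_add_left (weightedDist_le_of_adj h) _)
  · simp

theorem weightedAdjMatrix_comm {n : ℕ} (G : SimpleGraph (Fin n))
    (w : Sym2 (Fin n) → ℕ) (u v : Fin n) :
    weightedAdjMatrix G w u v = weightedAdjMatrix G w v u := by
  unfold weightedAdjMatrix
  rw [G.adj_comm, Sym2.eq_swap]

theorem weightedAdjMatrix_eq_top_or_le {n M : ℕ} {G : SimpleGraph (Fin n)}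
    {w : Sym2 (Fin n) → ℕ} (hw : ∀ e ∈ G.edgeSet, w e ≤ M) (u v : Fin n) :
    weightedAdjMatrix G w u v = ⊤ ∨ weightedAdjMatrix G w u v ≤ M := by
  unfold weightedAdjMatrix
  split_ifs with h
  · exact .inr (by exact_mod_cast hw _ h)
  · exact .inl rfl

/-- Distances, together with first steps of positive length on shortest paths. -/
theorem exists_positiveSteps_of_monomialMulIn {n p M T : ℕ}
    (h : MonomialMulIn n p (8 * M + 1) T)
    (hp : p.Prime) (hnp : n < p) (hM : 1 ≤ M) {Ω : Type} (κ : Knowledge n Ω)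
    (G : Ω → SimpleGraph (Fin n)) (w : Ω → Sym2 (Fin n) → ℕ)
    (hw : ∀ ω, ∀ e ∈ (G ω).edgeSet, w ω e ≤ M)
    (hA : ∀ u v, Knows (κ u) (fun ω => weightedAdjMatrix (G ω) (w ω) u v)) :
    ∃ κ', Reach (34039 * (Nat.log 2 n + 4) ^ 9 * (T + 6)) κ κ' ∧
      (∀ u v, Knows (κ' u) (fun ω => weightedDist (G ω) (w ω) u v)) ∧
      ∃ x : Ω → Fin n → Fin n → Option (Fin n), CanSum.IsPartialChoice κ'
        (fun ω => positiveSteps (weightedAdjMatrix (G ω) (w ω)) (weightedDist (G ω) (w ω))) x ∧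
        ∀ ω u v, (positiveSteps (weightedAdjMatrix (G ω) (w ω)) (weightedDist (G ω) (w ω))
          u v).Nonempty → x ω u v ≠ none := by
  obtain ⟨κ₁, r₁, h₁⟩ := h.weightedDist hp hnp hM κ G w hw hA
  have hs := h.canSum_positiveSteps (κ := κ₁) (fun u v => r₁.knows (hA u v)) h₁
    (fun ω => weightedAdjMatrix_eq_top_or_le (hw ω))
    (fun ω => weightedDist_le_weightedAdjMatrix_add (G ω) (w ω)) (fun ω u x v => by
      rw [weightedAdjMatrix_comm]
      exact weightedDist_le_weightedAdjMatrix_add (G ω) (w ω) x u v)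
  obtain ⟨κ₂, r₂, x, hx⟩ := hs.exists_choice hnp
  refine ⟨κ₂, (r₁.trans r₂).mono ?_, fun u v => r₂.knows (h₁ u v), x, hx⟩
  have e1 : Nat.log 2 n + 1 ≤ (Nat.log 2 n + 4) ^ 9 :=
    (Nat.le_self_pow (by norm_num) _).trans (Nat.pow_le_pow_left (by omega) 9)
  calc 4 * (Nat.log 2 n + 1) * T + 34035 * (Nat.log 2 n + 4) ^ 9 * (T + 6) ≤
      4 * (Nat.log 2 n + 4) ^ 9 * (T + 6) + 34035 * (Nat.log 2 n + 4) ^ 9 * (T + 6) := by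
        gcongr
        omega
    _ = _ := by ring

/-! ### Routing tables -/

theorem lt_add_of_ne_zero_of_ne_top {a b : ℕ∞} (ha : a ≠ 0) (hb : b ≠ ⊤) : b < a + b := by
  simpa using (ENat.add_lt_add_iff_right hb).2 (pos_iff_ne_zero.2 ha)

section Trace

variable {V : Type*} {G : SimpleGraph V} {w : Sym2 V → ℕ}

/-- Pointers along shortest paths that decrease a rank trace shortest paths. -/
theorem exists_path_of_rank {α : Type*} [Preorder α] [WellFoundedLT α] (v : V) (next : V → V)
    (rank : V → α) (h : ∀ u, u ≠ v → G.Reachable u v → G.Adj u (next u) ∧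
      (w s(u, next u) : ℕ∞) + weightedDist G w (next u) v = weightedDist G w u v ∧
      rank (next u) < rank u) (u : V) (hu : G.Reachable u v) :
    ∃ p : G.Walk u v, p.IsPath ∧ (walkWeight w p : ℕ∞) = weightedDist G w u v ∧
      (∀ i : ℕ, i < p.length → p.getVert (i + 1) = next (p.getVert i)) ∧
      ∀ y ∈ p.support, rank y ≤ rank u := by
  induction hr : rank u using WellFoundedLT.induction generalizing u with
  | ind r ih =>
    subst hr
    by_cases huv : u = v
    · subst huv
      exact ⟨.nil, .nil, by simp [weightedDist_self], by simp, by simp⟩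
    · obtain ⟨hadj, hd, hlt⟩ := h u huv hu
      obtain ⟨p, hp, hpw, hpn, hps⟩ := ih _ hlt (next u) (hadj.symm.reachable.trans hu) rfl
      refine ⟨.cons hadj p, hp.cons fun hmem => (hps u hmem).not_gt hlt, ?_, ?_, ?_⟩
      · rw [walkWeight_cons, ← hd, ← hpw]
        norm_cast
      · rintro (_ | i) hi
        · simp
        · simpa using hpn i (by simpa using hi)
      · intro y hy
        rcases List.mem_cons.1 (SimpleGraph.Walk.support_cons hadj p ▸ hy) with rfl | hy
        · exact le_rfl
        · exact (hps y hy).trans hlt.le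

theorem weightedDist_eq_of_cons {u y v : V} (h : G.Adj u y) (q : G.Walk y v)
    (hq : (walkWeight w (.cons h q) : ℕ∞) = weightedDist G w u v) :
    (walkWeight w q : ℕ∞) = weightedDist G w y v ∧
      (w s(u, y) : ℕ∞) + weightedDist G w y v = weightedDist G w u v := by
  have h1 : weightedDist G w u v ≤ w s(u, y) + weightedDist G w y v :=
    (weightedDist_triangle u y v).trans (add_le_add_left (weightedDist_le_of_adj h) _)
  have h2 := weightedDist_le (w := w) q
  rw [walkWeight_cons, Nat.cast_add] at hq
  have h3 : (walkWeight w q : ℕ∞) = weightedDist G w y v := by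
    refine le_antisymm ?_ h2
    rw [← hq] at h1
    exact (ENat.add_le_add_iff_left (ENat.natCast_ne_top _)).1 h1
  exact ⟨h3, by rw [← h3, hq]⟩

theorem exists_first_step {u v : V} (huv : u ≠ v) (h : weightedDist G w u v ≠ ⊤) :
    ∃ y, G.Adj u y ∧ (w s(u, y) : ℕ∞) + weightedDist G w y v = weightedDist G w u v := by
  obtain ⟨p, hp⟩ := exists_walk_of_weightedDist_ne_top h
  match p, hp with
  | .nil, _ => exact absurd rfl huv
  | .cons (v := y) hadj q, hp => exact ⟨y, hadj, (weightedDist_eq_of_cons hadj q hp).2⟩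

end Trace

/-! ### Components of zero edges and their gateways -/

/-- The subgraph of edges of weight zero. -/
def zeroGraph {V : Type*} (G : SimpleGraph V) (w : Sym2 V → ℕ) : SimpleGraph V where
  Adj u v := G.Adj u v ∧ w s(u, v) = 0
  symm := ⟨fun u v h => ⟨h.1.symm, by rw [Sym2.eq_swap]; exact h.2⟩⟩
  loopless := ⟨fun _ h => h.1.ne rfl⟩

/-- The number of edges on a shortest path using edges of weight zero only. -/
noncomputable def zeroDist {V : Type*} (G : SimpleGraph V) (w : Sym2 V → ℕ) (u v : V) : ℕ∞ :=
  weightedDist (zeroGraph G w) (fun _ => 1) u v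

section Zero

variable {n : ℕ} {G : SimpleGraph (Fin n)} {w : Sym2 (Fin n) → ℕ}

theorem weightedAdjMatrix_zeroGraph (u v : Fin n) :
    weightedAdjMatrix (zeroGraph G w) (fun _ => 1) u v =
      if weightedAdjMatrix G w u v = 0 then 1 else ⊤ := by
  unfold weightedAdjMatrix zeroGraph
  by_cases h : G.Adj u v <;> simp [h]

theorem zeroDist_comm (u v : Fin n) : zeroDist G w u v = zeroDist G w v u := weightedDist_comm u v

theorem zeroDist_trans {u x v : Fin n} (h : zeroDist G w u x ≠ ⊤) (h' : zeroDist G w x v ≠ ⊤) :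
    zeroDist G w u v ≠ ⊤ :=
  ne_top_of_le_ne_top (WithTop.add_ne_top.2 ⟨h, h'⟩) (weightedDist_triangle u x v)

theorem zeroDist_self_ne_top (u : Fin n) : zeroDist G w u u ≠ ⊤ := by
  simp [zeroDist, weightedDist_self]

theorem zeroDist_ne_top_of_adj {u v : Fin n} (h : (zeroGraph G w).Adj u v) :
    zeroDist G w u v ≠ ⊤ :=
  weightedDist_ne_top_iff.2 h.reachable

theorem weightedDist_eq_of_zeroGraph_adj {u y : Fin n} (h : (zeroGraph G w).Adj u y) (v : Fin n) :
    weightedDist G w y v = weightedDist G w u v := by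
  have key : ∀ {u y : Fin n}, (zeroGraph G w).Adj u y →
      weightedDist G w u v ≤ weightedDist G w y v := by
    intro u y h
    have := (weightedDist_triangle u y v).trans
      (add_le_add_left (weightedDist_le_of_adj (w := w) h.1) _)
    simpa [h.2] using this
  exact le_antisymm (key h.symm) (key h)

/-- A shortest path is followed along its initial edges of weight zero. Either it ends in this way,
or its first edge of positive weight starts at a node `a` of the same component. -/
theorem exists_gateway {u v : Fin n} (h : weightedDist G w u v ≠ ⊤) :
    zeroDist G w u v ≠ ⊤ ∨ ∃ a, zeroDist G w u a ≠ ⊤ ∧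
      (positiveSteps (weightedAdjMatrix G w) (weightedDist G w) a v).Nonempty := by
  obtain ⟨p, hp⟩ := exists_walk_of_weightedDist_ne_top h
  induction p with
  | nil => exact .inl (zeroDist_self_ne_top _)
  | @cons u y v hadj q ih =>
    obtain ⟨hq, hstep⟩ := weightedDist_eq_of_cons hadj q hp
    by_cases hw : w s(u, y) = 0
    · have hz := zeroDist_ne_top_of_adj (show (zeroGraph G w).Adj u y from ⟨hadj, hw⟩)
      rcases ih (hq ▸ ENat.natCast_ne_top _) hq with h' | ⟨a, ha, hne⟩
      · exact .inl (zeroDist_trans hz h')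
      · exact .inr ⟨a, zeroDist_trans hz ha, hne⟩
    · refine .inr ⟨u, zeroDist_self_ne_top u, y, mem_positiveSteps.2 ?_⟩
      simp only [weightedAdjMatrix, if_pos hadj]
      exact ⟨ENat.natCast_ne_top _, by exact_mod_cast hw, h, hstep⟩

end Zero

/-- The least node at finite distance. -/
noncomputable def nearMin {n : ℕ} (d : Fin n → Fin n → ℕ∞) (u : Fin n) : WithTop (Fin n) :=
  open Classical in (Finset.univ.filter fun a => d u a ≠ ⊤).min

/-- Finite zero distance is an equivalence relation, and the least node of a class is a canonical
label for it. -/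
theorem nearMin_zeroDist_eq_iff {n : ℕ} {G : SimpleGraph (Fin n)} {w : Sym2 (Fin n) → ℕ}
    {a u : Fin n} :
    nearMin (zeroDist G w) a = nearMin (zeroDist G w) u ↔ zeroDist G w u a ≠ ⊤ := by
  classical
  have hm : ∀ u, ∃ b : Fin n, nearMin (zeroDist G w) u = (b : WithTop (Fin n)) ∧
      zeroDist G w u b ≠ ⊤ := by
    intro u
    obtain ⟨b, hb⟩ := Finset.min_of_mem (s := Finset.univ.filter fun a => zeroDist G w u a ≠ ⊤)
      (a := u) (by simp [zeroDist_self_ne_top])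
    refine ⟨b, ?_, by simpa using Finset.mem_of_min hb⟩
    rw [← hb, nearMin]
  constructor
  · intro h
    obtain ⟨b, hb, hub⟩ := hm u
    obtain ⟨b', hb', hab⟩ := hm a
    rw [hb, hb'] at h
    rw [WithTop.coe_injective h] at hab
    exact zeroDist_trans hub (zeroDist_comm a b ▸ hab)
  · intro h
    unfold nearMin
    congr 1
    ext b
    simp only [Finset.mem_filter, Finset.mem_univ, true_and]
    exact ⟨zeroDist_trans h, zeroDist_trans (zeroDist_comm u a ▸ h)⟩

/-- The least node with the label of `u` at which a choice has been made. -/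
noncomputable def gateway {n : ℕ} (l : Fin n → WithTop (Fin n)) (x : Fin n → Option (Fin n))
    (u : Fin n) : WithTop (Fin n) :=
  open Classical in (Finset.univ.filter fun a => l a = l u ∧ x a ≠ none).min

/-- The first node to make for on the way from `u` to `v`, given the distance from `u` to `v` in
the graph of edges of weight zero and the gateway of `u`. -/
noncomputable def routeTarget {n : ℕ} (d : ℕ∞) (g : WithTop (Fin n)) (u v : Fin n) : Fin n :=
  open Classical in if d ≠ ⊤ then v else g.untopD u

/-- The entry of the routing table of `u` for `v`, given the first steps of positive weight and of
weight zero. -/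
def routeNext {n : ℕ} (x : Option (Fin n)) (x₀ : Fin n → Option (Fin n)) (u t : Fin n) : Fin n :=
  if t = u then x.getD u else (x₀ t).getD u

/-- The lexicographic rank of the distance to `v` and the hop distance to the current target
decreases along pointers. A positive step lowers the first entry; a zero step keeps it and lowers
the second, because all nodes of a zero component on the way to `v` have the same target. -/
theorem exists_path_routeNext {n : ℕ} {G : SimpleGraph (Fin n)} {w : Sym2 (Fin n) → ℕ}
    {x x₀ : Fin n → Fin n → Option (Fin n)}
    (hx : ∀ u v y, x u v = some y →
      y ∈ positiveSteps (weightedAdjMatrix G w) (weightedDist G w) u v)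
    (hx' : ∀ u v, (positiveSteps (weightedAdjMatrix G w) (weightedDist G w) u v).Nonempty →
      x u v ≠ none)
    (hx₀ : ∀ u v y, x₀ u v = some y → y ∈ positiveSteps
      (weightedAdjMatrix (zeroGraph G w) fun _ => 1) (zeroDist G w) u v)
    (hx₀' : ∀ u v, (positiveSteps (weightedAdjMatrix (zeroGraph G w) fun _ => 1)
      (zeroDist G w) u v).Nonempty → x₀ u v ≠ none)
    {u v : Fin n} (huv : G.Reachable u v) :
    ∃ p : G.Walk u v, p.IsPath ∧ (walkWeight w p : ℕ∞) = weightedDist G w u v ∧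
      ∀ i : ℕ, i < p.length → p.getVert (i + 1) = (fun u => routeNext (x u v) (x₀ u) u
        (routeTarget (zeroDist G w u v)
          (gateway (nearMin (zeroDist G w)) (fun a => x a v) u) u v)) (p.getVert i) := by
  classical
  set t : Fin n → Fin n := fun u => routeTarget (zeroDist G w u v)
    (gateway (nearMin (zeroDist G w)) (fun a => x a v) u) u v with ht
  have hgate : ∀ u, G.Reachable u v → zeroDist G w u v = ⊤ →
      ∃ a : Fin n, gateway (nearMin (zeroDist G w)) (fun a => x a v) u = (a : WithTop (Fin n)) ∧
        zeroDist G w u a ≠ ⊤ ∧ x a v ≠ none := by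
    intro u hu hz
    obtain ⟨a, ha, hne⟩ := (exists_gateway (weightedDist_ne_top_iff.2 hu)).resolve_left
      (not_not_intro hz)
    obtain ⟨b, hb⟩ := Finset.min_of_mem (s := Finset.univ.filter fun a =>
      nearMin (zeroDist G w) a = nearMin (zeroDist G w) u ∧ x a v ≠ none) (a := a)
      (by simpa using ⟨nearMin_zeroDist_eq_iff.2 ha, hx' a v hne⟩)
    have hbm := Finset.mem_of_min hb
    simp only [Finset.mem_filter, Finset.mem_univ, true_and] at hbm
    refine ⟨b, ?_, nearMin_zeroDist_eq_iff.1 hbm.1, hbm.2⟩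
    rw [← hb, gateway]
  have ht1 : ∀ u, G.Reachable u v → zeroDist G w u (t u) ≠ ⊤ := by
    intro u hu
    simp only [ht, routeTarget]
    by_cases hz : zeroDist G w u v = ⊤
    · obtain ⟨a, hg, ha, -⟩ := hgate u hu hz
      rw [if_neg (not_not_intro hz), hg]
      exact ha
    · rwa [if_pos hz]
  have ht2 : ∀ u, u ≠ v → G.Reachable u v → t u = u → x u v ≠ none := by
    intro u huv hu htu
    simp only [ht, routeTarget] at htu
    by_cases hz : zeroDist G w u v = ⊤
    · obtain ⟨a, hg, -, ha⟩ := hgate u hu hz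
      rw [if_neg (not_not_intro hz), hg, WithTop.untopD_coe] at htu
      rwa [htu] at ha
    · rw [if_pos hz] at htu
      exact absurd htu.symm huv
  have ht3 : ∀ u y, G.Reachable u v → (zeroGraph G w).Adj u y → t y = t u := by
    intro u y hu hadj
    have huy := zeroDist_ne_top_of_adj hadj
    have hyu := zeroDist_comm u y ▸ huy
    simp only [ht, routeTarget]
    by_cases hz : zeroDist G w u v = ⊤
    · have hz' : zeroDist G w y v = ⊤ := by
        by_contra hcon
        exact zeroDist_trans huy hcon hz
      obtain ⟨a, hg, -⟩ := hgate u hu hz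
      have hg' : gateway (nearMin (zeroDist G w)) (fun a => x a v) y =
          gateway (nearMin (zeroDist G w)) (fun a => x a v) u := by
        simp only [gateway, nearMin_zeroDist_eq_iff.2 huy]
      rw [if_neg (not_not_intro hz), if_neg (not_not_intro hz'), hg', hg]
      rfl
    · rw [if_pos hz, if_pos (zeroDist_trans hyu hz)]
  refine (exists_path_of_rank (G := G) (w := w) v (fun u => routeNext (x u v) (x₀ u) u (t u))
    (fun u => toLex (weightedDist G w u v, zeroDist G w u (t u))) (fun u hne hu => ?_) u huv).imp
    fun p hp => ⟨hp.1, hp.2.1, hp.2.2.1⟩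
  simp only [routeNext]
  split_ifs with htu
  · obtain ⟨y, hy⟩ := Option.ne_none_iff_exists'.1 (ht2 u hne hu htu)
    obtain ⟨h1, h2, h3, h4⟩ := mem_positiveSteps.1 (hx u v y hy)
    rw [hy, Option.getD_some]
    have hadj : G.Adj u y := by
      by_contra hcon
      exact h1 (if_neg hcon)
    rw [weightedAdjMatrix, if_pos hadj] at h2 h4
    refine ⟨hadj, h4, Prod.Lex.toLex_lt_toLex.2 (.inl ?_)⟩
    show weightedDist G w y v < weightedDist G w u v
    have hyt : weightedDist G w y v ≠ ⊤ := by
      intro hcon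
      rw [hcon, add_top] at h4
      exact h3 h4.symm
    rw [← h4]
    exact lt_add_of_ne_zero_of_ne_top h2 hyt
  · have hz := ht1 u hu
    obtain ⟨y', hadj', hy'⟩ := exists_first_step (Ne.symm htu) hz
    have hne' := hx₀' u (t u) ⟨y', mem_positiveSteps.2 (by
      simp only [weightedAdjMatrix, if_pos hadj']
      exact ⟨by simp, by simp, hz, hy'⟩)⟩
    obtain ⟨y, hy⟩ := Option.ne_none_iff_exists'.1 hne'
    obtain ⟨h1, -, h3, h4⟩ := mem_positiveSteps.1 (hx₀ u (t u) y hy)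
    rw [hy, Option.getD_some]
    have hadj : (zeroGraph G w).Adj u y := by
      by_contra hcon
      exact h1 (if_neg hcon)
    rw [weightedAdjMatrix, if_pos hadj] at h4
    have hD := weightedDist_eq_of_zeroGraph_adj hadj v
    refine ⟨hadj.1, by simp [hadj.2, hD], Prod.Lex.toLex_lt_toLex.2 (.inr ⟨hD, ?_⟩)⟩
    show zeroDist G w y (t y) < zeroDist G w u (t u)
    rw [ht3 u y hu hadj]
    have hyt : zeroDist G w y (t u) ≠ ⊤ := by
      intro hcon
      rw [hcon, add_top] at h4
      exact h3 h4.symm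
    rw [← h4]
    exact lt_add_of_ne_zero_of_ne_top (by simp) hyt

/-- All-pairs shortest paths by products of matrices of monomials. -/
theorem apspSolvableIn_of_monomialMulIn {n p M T : ℕ}
    (h : MonomialMulIn n p (8 * M + 1) T)
    (hp : p.Prime) (hnp : n < p) (hM : 1 ≤ M) :
    APSPSolvableIn n M (68079 * (Nat.log 2 n + 4) ^ 9 * (T + 6)) := by
  classical
  let Ω := {I : SimpleGraph (Fin n) × (Sym2 (Fin n) → ℕ) // ∀ e ∈ I.1.edgeSet, I.2 e ≤ M}
  let A : Ω → Fin n → Fin n → ℕ∞ := fun ω => weightedAdjMatrix ω.1.1 ω.1.2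
  let κ : Knowledge n Ω := fun u ω ω' => A ω u = A ω' u
  have hA : ∀ u v, Knows (κ u) (fun ω => A ω u v) := fun u v ω ω' hω => congrFun hω v
  obtain ⟨κ₁, r₁, hD, x, hx, hx'⟩ := exists_positiveSteps_of_monomialMulIn h hp hnp hM κ
    (fun ω => ω.1.1) (fun ω => ω.1.2) (fun ω => ω.2) hA
  obtain ⟨κ₂, r₂, hz, x₀, hx₀, hx₀'⟩ := exists_positiveSteps_of_monomialMulIn h hp hnp hM κ₁
    -- The same procedure with unit weights, which are at most `M`, routes inside the components of
    -- zero edges.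
    (fun ω => zeroGraph ω.1.1 ω.1.2) (fun ω _ => 1) (fun ω _ _ => hM)
    (fun u v => ((r₁.knows (hA u v)).map fun a => if a = 0 then 1 else ⊤).of_eq id fun ω =>
      weightedAdjMatrix_zeroGraph u v)
  have hl : ∀ u, Knows (κ₂ u) (fun ω : Ω => nearMin (zeroDist ω.1.1 ω.1.2) u) := by
    intro u ω ω' hω
    have : ∀ a, zeroDist ω.1.1 ω.1.2 u a = zeroDist ω'.1.1 ω'.1.2 u a :=
      fun a => hz u a ω ω' hω
    simp only [nearMin, this]
  have hfit1 : FitsIn n 3 (WithTop (Fin n) × Option (Fin n)) :=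
    fitsIn_of_card_le_mul_pow 1 2 (by
      rw [Fintype.card_prod, show Fintype.card (WithTop (Fin n)) = Fintype.card (Option (Fin n))
        from Fintype.card_congr (Equiv.refl _)]
      simp [sq])
  obtain ⟨κ₃, r₃, h₃⟩ := Reach.exchange_values hfit1 κ₂
    (fun ω u v => (nearMin (zeroDist ω.1.1 ω.1.2) u, x ω u v))
    (fun u v => (hl u).map₂ (r₂.knows (hx.knows u v)) Prod.mk)
  have hfit2 : FitsIn n 2 (WithTop (Fin n)) :=
    fitsIn_of_card_le_mul_pow 1 1 (by
      rw [show Fintype.card (WithTop (Fin n)) = Fintype.card (Option (Fin n))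
        from Fintype.card_congr (Equiv.refl _)]
      simp)
  obtain ⟨κ₄, r₄, h₄⟩ := Reach.exchange_values hfit2 κ₃
    -- Node `v` has received the label of every node and its choice towards `v`, so it can compute
    -- the gateways towards itself for all `u` and send them back.
    (fun ω v u => gateway (nearMin (zeroDist ω.1.1 ω.1.2)) (fun a => x ω a v) u) (by
      intro v u ω ω' hω
      have h1 : ∀ a, nearMin (zeroDist ω.1.1 ω.1.2) a = nearMin (zeroDist ω'.1.1 ω'.1.2) a :=
        fun a => congrArg Prod.fst (h₃ a v ω ω' hω)
      have h2 : ∀ a, x ω a v = x ω' a v := fun a => congrArg Prod.snd (h₃ a v ω ω' hω)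
      simp only [gateway, h1, h2])
  have : Nonempty (APSPOutput n) := ⟨⟨fun _ => ⊤, id⟩⟩
  let Y : Ω → Fin n → APSPOutput n := fun ω u =>
    ⟨fun v => weightedDist ω.1.1 ω.1.2 u v, fun v => routeNext (x ω u v) (x₀ ω u) u
      (routeTarget (zeroDist ω.1.1 ω.1.2 u v)
        (gateway (nearMin (zeroDist ω.1.1 ω.1.2)) (fun a => x ω a v) u) u v)⟩
  have r := ((r₁.trans r₂).trans r₃).trans r₄
  have hY : ∀ u, Knows (κ₄ u) (fun ω => Y ω u) := by
    intro u ω ω' hω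
    have e1 : ∀ v, weightedDist ω.1.1 ω.1.2 u v = weightedDist ω'.1.1 ω'.1.2 u v :=
      fun v => ((r₂.trans r₃).trans r₄).knows (hD u v) ω ω' hω
    have e2 : ∀ v, zeroDist ω.1.1 ω.1.2 u v = zeroDist ω'.1.1 ω'.1.2 u v :=
      fun v => (r₃.trans r₄).knows (hz u v) ω ω' hω
    have e3 : ∀ v, x ω u v = x ω' u v :=
      fun v => ((r₂.trans r₃).trans r₄).knows (hx.knows u v) ω ω' hω
    have e4 : x₀ ω u = x₀ ω' u :=
      funext fun v => (r₃.trans r₄).knows (hx₀.knows u v) ω ω' hω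
    have e5 : ∀ v, gateway (nearMin (zeroDist ω.1.1 ω.1.2)) (fun a => x ω a v) u =
        gateway (nearMin (zeroDist ω'.1.1 ω'.1.2)) (fun a => x ω' a v) u :=
      fun v => h₄ v u ω ω' hω
    simp only [Y, e1, e2, e3, e4, e5]
  have hT : 34039 * (Nat.log 2 n + 4) ^ 9 * (T + 6) + 34039 * (Nat.log 2 n + 4) ^ 9 * (T + 6) +
      3 + 2 ≤ 68079 * (Nat.log 2 n + 4) ^ 9 * (T + 6) := by
    have : 1 * 6 ≤ (Nat.log 2 n + 4) ^ 9 * (T + 6) :=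
      Nat.mul_le_mul (Nat.one_le_pow _ _ (by omega)) (by omega)
    linarith
  obtain ⟨P, hP⟩ := (r.mono hT).exists_algorithm A Y (fun u ω ω' h => h) hY
  refine ⟨P, fun G w hw => ?_⟩
  rw [show weightedAdjMatrix G w = A ⟨(G, w), hw⟩ from rfl, hP]
  refine ⟨fun u v => rfl, fun u v huv => ?_⟩
  exact exists_path_routeNext (hx.mem ⟨(G, w), hw⟩) (hx' ⟨(G, w), hw⟩) (hx₀.mem ⟨(G, w), hw⟩)
    (hx₀' ⟨(G, w), hw⟩) huv

/-! ### The number of rounds -/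

theorem exists_log_add_le : ∃ C : ℝ, 0 ≤ C ∧ ∀ n : ℕ, 1 ≤ n →
    ((Nat.log 2 n + 4 : ℕ) : ℝ) ≤ C * Real.log (n + 1) := by
  have h2 : 0 < Real.log 2 := Real.log_pos (by norm_num)
  refine ⟨5 / Real.log 2, by positivity, fun n hn => ?_⟩
  have hn' : (1 : ℝ) ≤ n := by exact_mod_cast hn
  have h1 : Real.log 2 ≤ Real.log (n + 1) := Real.log_le_log (by norm_num) (by linarith)
  have h3 : (Nat.log 2 n : ℝ) * Real.log 2 ≤ Real.log (n + 1) := by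
    rw [← Real.log_pow]
    refine Real.log_le_log (by positivity) ?_
    have : 2 ^ Nat.log 2 n ≤ n := Nat.pow_log_le_self 2 (by omega)
    have : (2 : ℝ) ^ Nat.log 2 n ≤ n := by exact_mod_cast this
    linarith
  rw [div_mul_eq_mul_div, le_div_iff₀ h2]
  push_cast
  linarith

theorem MatMulUniformRank.exists_apspSolvableIn {τ : ℝ} (h : MatMulUniformRank τ) :
    ∃ C : ℝ, 0 ≤ C ∧ ∀ n M : ℕ, 1 ≤ M → M ≤ n → ∃ T : ℕ, APSPSolvableIn n M T ∧
      (T : ℝ) ≤ C * Real.log (n + 1) ^ 9 * roundBound τ n M := by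
  obtain ⟨C, hC⟩ := h.exists_monomialMulIn
  obtain ⟨C', hC'0, hC'⟩ := exists_log_add_le
  refine ⟨68079 * C' ^ 9 * (max C 0 + 6), by positivity, fun n M hM hMn => ?_⟩
  obtain ⟨p, T, hp, hnp, hmul, hT⟩ := hC n M hM hMn
  refine ⟨_, apspSolvableIn_of_monomialMulIn hmul hp hnp hM, ?_⟩
  have h1 : 1 ≤ roundBound τ n M :=
    le_trans (by exact_mod_cast hM) (le_roundBound h.two_le hM hMn)
  have h2 : (T : ℝ) + 6 ≤ (max C 0 + 6) * roundBound τ n M := by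
    have := mul_le_mul_of_nonneg_right (le_max_left C 0) (zero_le_one.trans h1)
    linarith
  have h3 := hC' n (by omega)
  calc ((68079 * (Nat.log 2 n + 4) ^ 9 * (T + 6) : ℕ) : ℝ) =
        68079 * ((Nat.log 2 n + 4 : ℕ) : ℝ) ^ 9 * (T + 6) := by push_cast; ring
    _ ≤ 68079 * (C' * Real.log (n + 1)) ^ 9 * ((max C 0 + 6) * roundBound τ n M) := by
        have h4 : 0 ≤ C' * Real.log (n + 1) := (Nat.cast_nonneg _).trans h3
        gcongr
    _ = _ := by ring

theorem exists_log_pow_le (c : ℕ) {δ : ℝ} (hδ : 0 < δ) : ∃ C : ℝ, 0 ≤ C ∧ ∀ n : ℕ, 1 ≤ n →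
    Real.log (n + 1) ^ c ≤ C * (n : ℝ) ^ δ := by
  have hη : 0 < δ / (c + 1) := by positivity
  refine ⟨(2 ^ (δ / (c + 1)) / (δ / (c + 1))) ^ c, by positivity, fun n hn => ?_⟩
  have hn' : (1 : ℝ) ≤ n := by exact_mod_cast hn
  have h0 : 0 ≤ Real.log (n + 1) := Real.log_nonneg (by linarith)
  have h1 : Real.log (n + 1) ≤ 2 ^ (δ / (c + 1)) / (δ / (c + 1)) * (n : ℝ) ^ (δ / (c + 1)) := by
    refine (Real.log_le_rpow_div (by positivity) hη).trans ?_
    rw [div_mul_eq_mul_div, ← Real.mul_rpow (by norm_num) (by positivity)]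
    gcongr
    linarith
  calc Real.log (n + 1) ^ c ≤
        (2 ^ (δ / (c + 1)) / (δ / (c + 1)) * (n : ℝ) ^ (δ / (c + 1))) ^ c := by
        gcongr
    _ = (2 ^ (δ / (c + 1)) / (δ / (c + 1))) ^ c * (n : ℝ) ^ (δ / (c + 1) * c) := by
        rw [mul_pow, ← Real.rpow_mul_natCast (by positivity)]
    _ ≤ _ := by
        gcongr
        rw [div_mul_eq_mul_div, div_le_iff₀ (by positivity)]
        nlinarith

/-- Increasing the exponent a little increases the bound only a little. -/
theorem roundBound_le_rpow_mul {σ τ ε : ℝ} (hσ : 0 < σ) (hε : 2 / σ ≤ 2 / τ + ε)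
    {n M : ℕ} (hM : 1 ≤ M) (hMn : M ≤ n) (hστ : σ ≤ τ) :
    roundBound τ n M ≤ (n : ℝ) ^ ε * roundBound σ n M := by
  have hM' : (1 : ℝ) ≤ M := by exact_mod_cast hM
  have hn' : (1 : ℝ) ≤ n := by exact_mod_cast hM.trans hMn
  have h1 : (M : ℝ) ^ (2 / τ) ≤ (M : ℝ) ^ (2 / σ) :=
    Real.rpow_le_rpow_of_exponent_le hM' (div_le_div_of_nonneg_left (by norm_num) hσ hστ)
  have h2 : (n : ℝ) ^ (1 - 2 / τ) ≤ (n : ℝ) ^ ε * (n : ℝ) ^ (1 - 2 / σ) := by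
    rw [← Real.rpow_add (by linarith)]
    exact Real.rpow_le_rpow_of_exponent_le hn' (by linarith)
  calc roundBound τ n M ≤ (M : ℝ) ^ (2 / σ) * ((n : ℝ) ^ ε * (n : ℝ) ^ (1 - 2 / σ)) := by
        unfold roundBound
        gcongr
    _ = _ := by
        unfold roundBound
        ring

theorem theorem4 (K : Type*) [Field K] [CharZero K] :
    (∀ ε : ℝ, 0 < ε → ∃ C : ℝ, ∀ n M : ℕ, 1 ≤ M → M ≤ n →
      ∃ T : ℕ, APSPSolvableIn n M T ∧
        (T : ℝ) ≤ C * (n : ℝ) ^ ε *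
          ((M : ℝ) ^ (2 / matMulExponent K) * (n : ℝ) ^ (1 - 2 / matMulExponent K))) ∧
    (∀ τ : ℝ, matMulExponent K < τ ∨ MatMulUniformRank τ →
      ∃ (C : ℝ) (c : ℕ), ∀ n M : ℕ, 1 ≤ M → M ≤ n →
        ∃ T : ℕ, APSPSolvableIn n M T ∧
          (T : ℝ) ≤ C * Real.log (n + 1) ^ c *
            ((M : ℝ) ^ (2 / τ) * (n : ℝ) ^ (1 - 2 / τ))) := by
  constructor
  · intro ε hε
    have hω := two_le_matMulExponent K
    set σ := matMulExponent K with hσ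
    obtain ⟨C, hC0, hC⟩ := (matMulUniformRank_of_matMulExponent_lt (K := K) (τ := σ + ε)
      (by linarith)).exists_apspSolvableIn
    obtain ⟨C', hC'0, hC'⟩ := exists_log_pow_le 9 (half_pos hε)
    refine ⟨C * C', fun n M hM hMn => ?_⟩
    obtain ⟨T, hT, hTle⟩ := hC n M hM hMn
    refine ⟨T, hT, hTle.trans ?_⟩
    have hn : 1 ≤ n := hM.trans hMn
    have hn' : (0 : ℝ) < n := by exact_mod_cast hn
    have hστ : 2 / σ ≤ 2 / (σ + ε) + ε / 2 := by
      rw [div_add_div _ _ (by positivity) (by norm_num), div_le_div_iff₀ (by positivity)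
        (by positivity)]
      nlinarith [mul_pos hε hε, mul_nonneg hε.le (sub_nonneg.2 hω)]
    have hR := roundBound_le_rpow_mul (by linarith) hστ hM hMn (by linarith)
    have hR0 : 0 ≤ roundBound (σ + ε) n M := by
      unfold roundBound
      positivity
    calc C * Real.log (n + 1) ^ 9 * roundBound (σ + ε) n M ≤
          C * (C' * (n : ℝ) ^ (ε / 2)) * ((n : ℝ) ^ (ε / 2) * roundBound σ n M) := by
          gcongr
          exact hC' n hn
      _ = C * C' * ((n : ℝ) ^ (ε / 2) * (n : ℝ) ^ (ε / 2)) * roundBound σ n M := by ring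
      _ = _ := by
          rw [← Real.rpow_add hn', add_halves, roundBound]
  · intro τ hτ
    obtain ⟨C, -, hC⟩ := (hτ.elim matMulUniformRank_of_matMulExponent_lt id).exists_apspSolvableIn
    exact ⟨C, 9, hC⟩
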